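/- **Conventions.** For a $C^*$-algebra $D$, $M(D)$ is its multiplier algebra with the strict topology; $\otimes$ is the minimal tensor product of $C^*$-algebras. A $*$-homomorphism $D\to M(E)$ is *strict* if it is strictly continuous on the unit ball; it then extends uniquely to a $*$-homomorphism $M(D)\to M(E)$ that is strictly continuous on bounded sets, and we denote the extension by the same letter; likewise for $*$-homomorphisms such as $\delta\otimes\mathrm{id}$ and $\mathrm{id}\otimes\Delta$. For $\omega\in A^*$, written as $\omega(x)=\upsilon(xa)$ with $a\in A$, $\upsilon\in A^*$, and $T\in M(D\otimes A)$, the slice $(\mathrm{id}\otimes\omega)(T)\in M(D)$ is determined by $(\mathrm{id}\otimes\omega)(T)d=(\mathrm{id}\otimes\upsilon)(T(d\otimes a))$ for $d\in D$. A *$C^*$-bialgebra* is a $C^*$-algebra $A$ with a nondegenerate $*$-homomorphism $\Delta:A\to M(A\otimes A)$ such that $(\Delta\otimes\mathrm{id})\Delta=(\mathrm{id}\otimes\Delta)\Delta$. A *partial coaction* of $(A,\Delta)$ on a $C^*$-algebra $C$ is a strict $*$-homomorphism $\delta_C:C\to M(C\otimes A)$ such that $\delta_C(C)(1\otimes A)\subseteq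 C\otimes A$ and $(\delta_C\otimes\mathrm{id})\delta_C(c)=(\delta_C(1_{M(C)})\otimes 1)\,(\mathrm{id}\otimes\Delta)\delta_C(c)$ for all $c\in C$. It is *regular* if $(\mathrm{id}\otimes\Delta)(\delta_C(C))(1\otimes1\otimes A)\subseteq M(C\otimes A)\otimes A$. A *coaction* on $B$ is a strict $*$-homomorphism $\delta_B:B\to M(B\otimes A)$ with $\delta_B(B)(1\otimes A)\subseteq B\otimes A$ and $(\delta_B\otimes\mathrm{id})\delta_B=(\mathrm{id}\otimes\Delta)\delta_B$; put $\omega\triangleright b=(\mathrm{id}\otimes\omega)(\delta_B(b))\in B$ for $\omega\in A^*$, $b\in B$. A *dilation* of $\delta_C$ is a triple $(B,\delta_B,\iota)$ consisting of a $C^*$-algebra $B$, a coaction $\delta_B$ on $B$ and an injective $*$-homomorphism $\iota:C\to B$ such that $\delta_B(\iota(c))(\iota(c')\otimes a)=(\iota\otimes\mathrm{id})(\delta_C(c)(c'\otimes a))$ for all $c,c'\in C$, $a\in A$. It is *minimal* if $\iota(C)$ and $A^*\triangleright\iota(C)$ generate $B$ as a $C^*$-algebra. A *morphism* of dilations $(B,\delta_B,\iota_B)\to(D,\delta_D,\iota_D)$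 is a $*$-homomorphism $\phi:B\to D$ with $\phi(\iota_B(c))=\iota_D(c)$ and $\delta_D(\phi(b))(1\otimes a)=(\phi\otimes\mathrm{id})(\delta_B(b)(1\otimes a))$ for all $c\in C$, $b\in B$, $a\in A$. $A$ has the *slice map property* if for every $C^*$-algebra $D$ and every $C^*$-subalgebra $S\subseteq D$, each $x\in D\otimes A$ with $(\mathrm{id}\otimes\omega)(x)\in S$ for all $\omega\in A^*$ lies in $S\otimes A$. Let $\mathfrak G(C)\subseteq M(C\otimes A)$ be the $C^*$-subalgebra generated by $\delta_C(C)$ and all $(\mathrm{id}\otimes\mathrm{id}\otimes\omega)((\mathrm{id}\otimes\Delta)\delta_C(c))$ with $c\in C$, $\omega\in A^*$, and let $\mathfrak G(\delta_C)=(\mathfrak G(C),\delta_{\mathfrak G},\delta_C)$, where $\delta_{\mathfrak G}$ is the restriction of $\mathrm{id}\otimes\Delta$ to $\mathfrak G(C)$. **Proposition.** Let $\delta_C$ be an injective, regular partial coaction of a $C^*$-bialgebra $(A,\Delta)$ on a $C^*$-algebra $C$, let $\mathcal B=(B,\delta_B,\iota)$ be a minimal dilation of $\delta_C$, and suppose that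 $A$ has the slice map property. Then $\mathfrak G(\delta_C)$ is a well-defined dilation of $\delta_C$, and there is a unique morphism of dilations $\phi_{\mathcal B}$ from $\mathcal B$ to $\mathfrak G(\delta_C)$; as a map $B\to\mathfrak G(C)$ it is surjective. Moreover, $\iota\otimes\mathrm{id}:C\otimes A\to B\otimes A$ is injective, its image $\iota(C)\otimes A$ is a two-sided ideal of $B\otimes A$, and for each $b\in B$ the multiplier $\phi_{\mathcal B}(b)\in\mathfrak G(C)\subseteq M(C\otimes A)$ is the restriction of $\delta_B(b)$ to this ideal: for all $z\in C\otimes A$, $$(\iota\otimes\mathrm{id})(\phi_{\mathcal B}(b)\,z)=\delta_B(b)\,(\iota\otimes\mathrm{id})(z),\qquad (\iota\otimes\mathrm{id})(z\,\phi_{\mathcal B}(b))=(\iota\otimes\mathrm{id})(z)\,\delta_B(b).$$ -/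

import Mathlib

open scoped TensorProduct MultiplierAlgebra
open UniformSpace Topology

universe u

namespace CStarTensor

section Reps

/-- A `*`-representation of a `C*`-algebra `A` on a Hilbert space. -/
structure HilbRep (A : Type u) [NonUnitalCStarAlgebra A] : Type (u + 1) where
  H : Type u
  [normed : NormedAddCommGroup H]
  [inner : InnerProductSpace ℂ H]
  [complete : CompleteSpace H]
  π : A →⋆ₙₐ[ℂ] (H →L[ℂ] H)

attribute [instance] HilbRep.normed HilbRep.inner HilbRep.complete

/-- The Hilbert space tensor product: the completion of the algebraic tensor product. -/
def HilbTensor (H K : Type u) [NormedAddCommGroup H] [InnerProductSpace ℂ H]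
    [NormedAddCommGroup K] [InnerProductSpace ℂ K] : Type u :=
  Completion (H ⊗[ℂ] K)

section HilbTensor

variable {H K : Type u} [NormedAddCommGroup H] [InnerProductSpace ℂ H]
    [NormedAddCommGroup K] [InnerProductSpace ℂ K]

noncomputable instance : NormedAddCommGroup (HilbTensor H K) :=
  inferInstanceAs (NormedAddCommGroup (Completion (H ⊗[ℂ] K)))

noncomputable instance : InnerProductSpace ℂ (HilbTensor H K) :=
  inferInstanceAs (InnerProductSpace ℂ (Completion (H ⊗[ℂ] K)))

instance : CompleteSpace (HilbTensor H K) :=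
  inferInstanceAs (CompleteSpace (Completion (H ⊗[ℂ] K)))

/-- The inclusion of the algebraic into the Hilbert space tensor product. -/
noncomputable def toHilb : H ⊗[ℂ] K →ₗ[ℂ] HilbTensor H K :=
  (Completion.toComplL (𝕜 := ℂ) (E := H ⊗[ℂ] K)).toLinearMap

theorem toHilb_inner (v w : H ⊗[ℂ] K) : inner ℂ (toHilb v) (toHilb w) = inner ℂ v w :=
  Completion.inner_coe (𝕜 := ℂ) v w

theorem denseRange_toHilb : DenseRange (toHilb (H := H) (K := K)) :=
  Completion.denseRange_coe (α := H ⊗[ℂ] K)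

/-- The bounded operator `S ⊗ T` on the Hilbert space tensor product. -/
noncomputable def opTensor (S : H →L[ℂ] H) (T : K →L[ℂ] K) :
    HilbTensor H K →L[ℂ] HilbTensor H K :=
  ContinuousLinearMap.completion (α := H ⊗[ℂ] K) (β := H ⊗[ℂ] K) (TensorProduct.mapL S T)

theorem opTensor_apply (S : H →L[ℂ] H) (T : K →L[ℂ] K) (v : H ⊗[ℂ] K) :
    opTensor S T (toHilb v) = toHilb (TensorProduct.map S.toLinearMap T.toLinearMap v) := by
  rw [← TensorProduct.mapL_apply]
  exact ContinuousLinearMap.completion_apply_coe (α := H ⊗[ℂ] K) (β := H ⊗[ℂ] K) _ v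

theorem hilb_ext {S T : HilbTensor H K →L[ℂ] HilbTensor H K}
    (h : ∀ x y, S (toHilb (x ⊗ₜ y)) = T (toHilb (x ⊗ₜ y))) : S = T := by
  have h' : S.toLinearMap ∘ₗ toHilb = T.toLinearMap ∘ₗ toHilb :=
    TensorProduct.ext' fun x y => h x y
  refine ContinuousLinearMap.ext fun v => ?_
  refine congrFun (denseRange_toHilb.equalizer S.continuous T.continuous ?_) v
  funext v
  exact LinearMap.congr_fun h' v

theorem opTensor_tmul (S : H →L[ℂ] H) (T : K →L[ℂ] K) (x : H) (y : K) :
    opTensor S T (toHilb (x ⊗ₜ y)) = toHilb (S x ⊗ₜ T y) := by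
  rw [opTensor_apply]; rfl

theorem opTensor_mul (S S' : H →L[ℂ] H) (T T' : K →L[ℂ] K) :
    opTensor (S * S') (T * T') = opTensor S T * opTensor S' T' :=
  hilb_ext fun x y => by
    rw [opTensor_tmul]
    change _ = opTensor S T (opTensor S' T' (toHilb (x ⊗ₜ y)))
    rw [opTensor_tmul, opTensor_tmul]
    rfl

theorem opTensor_star [CompleteSpace H] [CompleteSpace K] (S : H →L[ℂ] H) (T : K →L[ℂ] K) :
    opTensor (star S) (star T) = star (opTensor S T) := by
  rw [ContinuousLinearMap.star_eq_adjoint (opTensor S T), ContinuousLinearMap.eq_adjoint_iff]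
  intro v w
  induction v using denseRange_toHilb.induction_on with
  | hp => exact isClosed_eq (by fun_prop) (by fun_prop)
  | ih v =>
    induction w using denseRange_toHilb.induction_on with
    | hp => exact isClosed_eq (by fun_prop) (by fun_prop)
    | ih w =>
      induction v using TensorProduct.induction_on with
      | zero => simp
      | add v v' hv hv' => simp only [map_add, inner_add_left, hv, hv']
      | tmul h k =>
        induction w using TensorProduct.induction_on with
        | zero => simp
        | add w w' hw hw' => simp only [map_add, inner_add_right, hw, hw']
        | tmul h' k' =>
          simp only [opTensor_tmul, toHilb_inner, TensorProduct.inner_tmul,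
            ContinuousLinearMap.star_eq_adjoint, ContinuousLinearMap.adjoint_inner_left]

theorem norm_opTensor_le (S : H →L[ℂ] H) (T : K →L[ℂ] K) : ‖opTensor S T‖ ≤ ‖S‖ * ‖T‖ := by
  refine ContinuousLinearMap.opNorm_le_bound _ (by positivity) fun v => ?_
  induction v using denseRange_toHilb.induction_on with
  | hp => exact isClosed_le (by fun_prop) (by fun_prop)
  | ih v =>
    rw [opTensor_apply, ← TensorProduct.mapL_apply]
    have h := ((TensorProduct.mapL S T).le_opNorm v).trans
      (mul_le_mul_of_nonneg_right (TensorProduct.norm_mapL_le S T) (norm_nonneg v))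
    have h1 : ∀ v : H ⊗[ℂ] K, ‖toHilb v‖ = ‖v‖ := fun v => Completion.norm_coe v
    rw [h1, h1]
    exact h

end HilbTensor

variable {B A : Type u} [NonUnitalCStarAlgebra B] [NonUnitalCStarAlgebra A]

/-- The linear extension `∑ bᵢ ⊗ aᵢ ↦ ∑ π(bᵢ) ⊗ ρ(aᵢ)` to the algebraic tensor product, for two
representations `π` and `ρ`. -/
noncomputable def tensorRep (p : HilbRep B) (q : HilbRep A) :
    B ⊗[ℂ] A →ₗ[ℂ] (HilbTensor p.H q.H →L[ℂ] HilbTensor p.H q.H) :=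
  TensorProduct.lift <| LinearMap.mk₂ ℂ (fun b a => opTensor (p.π b) (q.π a))
    (fun b b' a => hilb_ext fun x y => by
      simp [opTensor_tmul, TensorProduct.add_tmul])
    (fun c b a => hilb_ext fun x y => by
      simp [opTensor_tmul, ← TensorProduct.smul_tmul'])
    (fun b a a' => hilb_ext fun x y => by
      simp [opTensor_tmul, TensorProduct.tmul_add])
    (fun c b a => hilb_ext fun x y => by
      simp [opTensor_tmul])

@[simp] theorem tensorRep_tmul (p : HilbRep B) (q : HilbRep A) (b : B) (a : A) :
    tensorRep p q (b ⊗ₜ a) = opTensor (p.π b) (q.π a) := rfl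

theorem tensorRep_mul (p : HilbRep B) (q : HilbRep A) (x y : B ⊗[ℂ] A) :
    tensorRep p q (x * y) = tensorRep p q x * tensorRep p q y := by
  induction x using TensorProduct.induction_on with
  | zero => simp
  | add x x' hx hx' => simp [add_mul, hx, hx']
  | tmul b a =>
    induction y using TensorProduct.induction_on with
    | zero => simp
    | add y y' hy hy' => simp [mul_add, hy, hy']
    | tmul b' a' =>
      rw [Algebra.TensorProduct.tmul_mul_tmul]
      simp only [tensorRep_tmul, map_mul, opTensor_mul]

theorem tensorRep_star (p : HilbRep B) (q : HilbRep A) (x : B ⊗[ℂ] A) :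
    tensorRep p q (star x) = star (tensorRep p q x) := by
  induction x using TensorProduct.induction_on with
  | zero => simp
  | add x x' hx hx' => simp [hx, hx']
  | tmul b a => simp only [TensorProduct.star_tmul, tensorRep_tmul, map_star, opTensor_star]

theorem tensorRep_norm_bdd (x : B ⊗[ℂ] A) :
    ∃ C : ℝ, ∀ (p : HilbRep B) (q : HilbRep A), ‖tensorRep p q x‖ ≤ C := by
  induction x using TensorProduct.induction_on with
  | zero => exact ⟨0, fun p q => by simp⟩
  | add x x' hx hx' =>
    obtain ⟨C, hC⟩ := hx
    obtain ⟨C', hC'⟩ := hx'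
    refine ⟨C + C', fun p q => ?_⟩
    rw [map_add]
    exact (norm_add_le _ _).trans (add_le_add (hC p q) (hC' p q))
  | tmul b a =>
    refine ⟨‖b‖ * ‖a‖, fun p q => ?_⟩
    rw [tensorRep_tmul]
    refine (norm_opTensor_le _ _).trans ?_
    exact mul_le_mul (NonUnitalStarAlgHom.norm_apply_le p.π b)
      (NonUnitalStarAlgHom.norm_apply_le q.π a) (norm_nonneg _) (norm_nonneg _)

/-- The minimal (spatial) `C*`-seminorm on the algebraic tensor product:
the supremum of `‖(π ⊗ ρ)(x)‖` over all representations `π` of `B` and `ρ` of `A`. -/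
noncomputable def minNorm (x : B ⊗[ℂ] A) : ℝ :=
  ⨆ r : HilbRep B × HilbRep A, ‖tensorRep r.1 r.2 x‖

theorem minNorm_bddAbove (x : B ⊗[ℂ] A) :
    BddAbove (Set.range fun r : HilbRep B × HilbRep A => ‖tensorRep r.1 r.2 x‖) := by
  obtain ⟨C, hC⟩ := tensorRep_norm_bdd x
  exact ⟨C, by rintro _ ⟨r, rfl⟩; exact hC r.1 r.2⟩

theorem le_minNorm (p : HilbRep B) (q : HilbRep A) (x : B ⊗[ℂ] A) :
    ‖tensorRep p q x‖ ≤ minNorm x :=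
  le_ciSup (minNorm_bddAbove x) (p, q)

theorem minNorm_nonneg (x : B ⊗[ℂ] A) : 0 ≤ minNorm x :=
  Real.iSup_nonneg fun _ => norm_nonneg _

theorem minNorm_le {x : B ⊗[ℂ] A} {C : ℝ} (hC : 0 ≤ C)
    (h : ∀ (p : HilbRep B) (q : HilbRep A), ‖tensorRep p q x‖ ≤ C) : minNorm x ≤ C :=
  Real.iSup_le (fun r => h r.1 r.2) hC

theorem minNorm_add_le (x y : B ⊗[ℂ] A) : minNorm (x + y) ≤ minNorm x + minNorm y :=
  minNorm_le (add_nonneg (minNorm_nonneg x) (minNorm_nonneg y)) fun p q => by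
    rw [map_add]
    exact (norm_add_le _ _).trans (add_le_add (le_minNorm p q x) (le_minNorm p q y))

theorem minNorm_smul (c : ℂ) (x : B ⊗[ℂ] A) : minNorm (c • x) = ‖c‖ * minNorm x := by
  unfold minNorm
  rw [Real.mul_iSup_of_nonneg (norm_nonneg c)]
  simp only [map_smul, norm_smul]

theorem minNorm_zero : minNorm (0 : B ⊗[ℂ] A) = 0 := by
  have h := minNorm_smul (0 : ℂ) (0 : B ⊗[ℂ] A)
  rwa [zero_smul, norm_zero, zero_mul] at h

theorem minNorm_neg (x : B ⊗[ℂ] A) : minNorm (-x) = minNorm x := by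
  have h := minNorm_smul (-1 : ℂ) x
  rwa [norm_neg, norm_one, one_mul, neg_one_smul] at h

theorem minNorm_mul_le (x y : B ⊗[ℂ] A) : minNorm (x * y) ≤ minNorm x * minNorm y :=
  minNorm_le (mul_nonneg (minNorm_nonneg x) (minNorm_nonneg y)) fun p q => by
    rw [tensorRep_mul]
    exact (norm_mul_le _ _).trans
      (mul_le_mul (le_minNorm p q x) (le_minNorm p q y) (norm_nonneg _) (minNorm_nonneg x))

theorem star_mul_tensor (x y : B ⊗[ℂ] A) : star (x * y) = star y * star x := by
  induction x using TensorProduct.induction_on with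
  | zero => simp
  | add x x' hx hx' => simp [add_mul, mul_add, hx, hx']
  | tmul b a =>
    induction y using TensorProduct.induction_on with
    | zero => simp
    | add y y' hy hy' => simp [mul_add, add_mul, hy, hy']
    | tmul b' a' => simp [Algebra.TensorProduct.tmul_mul_tmul]

theorem minNorm_sq_le (x : B ⊗[ℂ] A) : minNorm x * minNorm x ≤ minNorm (star x * x) := by
  have h : ∀ (p : HilbRep B) (q : HilbRep A),
      ‖tensorRep p q x‖ ≤ Real.sqrt (minNorm (star x * x)) := fun p q => by
    refine Real.le_sqrt_of_sq_le ?_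
    rw [sq, ← CStarRing.norm_star_mul_self, ← tensorRep_star, ← tensorRep_mul]
    exact le_minNorm p q _
  have h2 := minNorm_le (Real.sqrt_nonneg _) h
  exact (mul_le_mul h2 h2 (minNorm_nonneg x) (Real.sqrt_nonneg _)).trans_eq
    (Real.mul_self_sqrt (minNorm_nonneg _))

theorem minNorm_star_le (x : B ⊗[ℂ] A) : minNorm (star x) ≤ minNorm x := by
  have h := (minNorm_sq_le (star x)).trans (minNorm_mul_le _ _)
  rw [star_star] at h
  rcases (minNorm_nonneg (star x)).eq_or_lt with h0 | h0
  · rw [← h0]; exact minNorm_nonneg x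
  · exact le_of_mul_le_mul_right h h0

theorem minNorm_star (x : B ⊗[ℂ] A) : minNorm (star x) = minNorm x :=
  le_antisymm (minNorm_star_le x) (by simpa using minNorm_star_le (star x))

end Reps

section Completion

variable (B A : Type u) [NonUnitalCStarAlgebra B] [NonUnitalCStarAlgebra A]

/-- The algebraic tensor product, to be equipped with the minimal `C*`-seminorm. -/
def PreMinTensor : Type u := B ⊗[ℂ] A

noncomputable instance : AddCommGroup (PreMinTensor B A) :=
  inferInstanceAs (AddCommGroup (B ⊗[ℂ] A))

noncomputable instance : Module ℂ (PreMinTensor B A) :=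
  inferInstanceAs (Module ℂ (B ⊗[ℂ] A))

noncomputable instance : SeminormedAddCommGroup (PreMinTensor B A) :=
  AddGroupSeminorm.toSeminormedAddCommGroup
    { toFun := fun x => minNorm (B := B) (A := A) x
      map_zero' := minNorm_zero
      add_le' := minNorm_add_le
      neg' := minNorm_neg }

variable {B A} in
theorem norm_preMinTensor (x : PreMinTensor B A) : ‖x‖ = minNorm (B := B) (A := A) x := rfl

noncomputable instance : NormedSpace ℂ (PreMinTensor B A) where
  norm_smul_le c x := (minNorm_smul (B := B) (A := A) c x).le

/-- The minimal tensor product of two `C*`-algebras: the (Hausdorff) completion of the algebraic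
tensor product with respect to the minimal `C*`-seminorm. -/
def MinTensor : Type u := Completion (PreMinTensor B A)

infixl:70 " ⊗ᵐ " => MinTensor

noncomputable instance : NormedAddCommGroup (B ⊗ᵐ A) :=
  inferInstanceAs (NormedAddCommGroup (Completion (PreMinTensor B A)))

noncomputable instance : NormedSpace ℂ (B ⊗ᵐ A) :=
  inferInstanceAs (NormedSpace ℂ (Completion (PreMinTensor B A)))

instance : CompleteSpace (B ⊗ᵐ A) :=
  inferInstanceAs (CompleteSpace (Completion (PreMinTensor B A)))

/-- The canonical map from the algebraic to the minimal tensor product. -/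
noncomputable def toMin : B ⊗[ℂ] A →ₗ[ℂ] B ⊗ᵐ A :=
  (Completion.toComplL (𝕜 := ℂ) (E := PreMinTensor B A)).toLinearMap

variable {B A}

theorem norm_toMin (x : B ⊗[ℂ] A) : ‖toMin B A x‖ = minNorm x :=
  Completion.norm_coe (E := PreMinTensor B A) x

theorem denseRange_toMin : DenseRange (toMin B A) :=
  Completion.denseRange_coe (α := PreMinTensor B A)

theorem toMin_ext {F : Type*} [NormedAddCommGroup F] [NormedSpace ℂ F]
    {f g : B ⊗ᵐ A →L[ℂ] F} (h : ∀ x, f (toMin B A x) = g (toMin B A x)) : f = g :=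
  ContinuousLinearMap.ext fun x =>
    congrFun (denseRange_toMin.equalizer f.continuous g.continuous (funext h)) x

theorem preMul_aux (x y : B ⊗[ℂ] A) :
    (toMin B A ∘ₗ LinearMap.mulLeft ℂ x).extendOfNorm (toMin B A) (toMin B A y) =
      toMin B A (x * y) := by
  rw [LinearMap.extendOfNorm_eq denseRange_toMin ⟨minNorm x, fun y => ?_⟩]
  · rfl
  · simp only [LinearMap.comp_apply, LinearMap.mulLeft_apply, norm_toMin]
    exact minNorm_mul_le x y

/-- Left multiplication by an element of the algebraic tensor product. -/
noncomputable def preMul : B ⊗[ℂ] A →ₗ[ℂ] (B ⊗ᵐ A →L[ℂ] B ⊗ᵐ A) where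
  toFun x := (toMin B A ∘ₗ LinearMap.mulLeft ℂ x).extendOfNorm (toMin B A)
  map_add' x y := toMin_ext fun z => by
    simp only [preMul_aux, add_apply, add_mul, map_add]
  map_smul' c x := toMin_ext fun z => by
    simp only [preMul_aux, smul_apply, smul_mul_assoc, map_smul,
      RingHom.id_apply]

theorem preMul_apply (x y : B ⊗[ℂ] A) : preMul x (toMin B A y) = toMin B A (x * y) :=
  preMul_aux x y

theorem norm_preMul_le (x : B ⊗[ℂ] A) : ‖preMul x‖ ≤ 1 * ‖toMin B A x‖ := by
  rw [one_mul]
  refine ContinuousLinearMap.opNorm_le_bound _ (norm_nonneg _) fun y => ?_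
  refine LinearMap.norm_extendOfNorm_apply_le denseRange_toMin _ (fun y => ?_) y
  simp only [LinearMap.comp_apply, LinearMap.mulLeft_apply, norm_toMin]
  exact minNorm_mul_le x y

/-- The multiplication of the minimal tensor product, as a bilinear map. -/
noncomputable def mulMin : B ⊗ᵐ A →L[ℂ] B ⊗ᵐ A →L[ℂ] B ⊗ᵐ A :=
  preMul.extendOfNorm (toMin B A)

theorem mulMin_toMin (x y : B ⊗[ℂ] A) :
    mulMin (toMin B A x) (toMin B A y) = toMin B A (x * y) := by
  unfold mulMin
  rw [LinearMap.extendOfNorm_eq denseRange_toMin ⟨1, norm_preMul_le⟩, preMul_apply]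

noncomputable instance : Mul (B ⊗ᵐ A) := ⟨fun x y => mulMin x y⟩

theorem mul_def (x y : B ⊗ᵐ A) : x * y = mulMin x y := rfl

theorem toMin_mul (x y : B ⊗[ℂ] A) : toMin B A (x * y) = toMin B A x * toMin B A y :=
  (mulMin_toMin x y).symm

theorem continuous_mulMin {X : Type*} [TopologicalSpace X] {f g : X → B ⊗ᵐ A}
    (hf : Continuous f) (hg : Continuous g) : Continuous fun x => f x * g x := by
  simp only [mul_def]; fun_prop

noncomputable instance : NonUnitalNormedRing (B ⊗ᵐ A) where
  __ := (inferInstance : NormedAddCommGroup (B ⊗ᵐ A))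
  __ := (inferInstance : Mul (B ⊗ᵐ A))
  left_distrib x y z := by simp [mul_def]
  right_distrib x y z := by simp [mul_def]
  zero_mul x := by simp [mul_def]
  mul_zero x := by simp [mul_def]
  mul_assoc x y z := by
    induction x using denseRange_toMin.induction_on with
    | hp => exact isClosed_eq (continuous_mulMin (continuous_mulMin continuous_id continuous_const) continuous_const) (continuous_mulMin continuous_id continuous_const)
    | ih x =>
    induction y using denseRange_toMin.induction_on with
    | hp => exact isClosed_eq (continuous_mulMin (continuous_mulMin continuous_const continuous_id) continuous_const) (continuous_mulMin continuous_const (continuous_mulMin continuous_id continuous_const))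
    | ih y =>
    induction z using denseRange_toMin.induction_on with
    | hp => exact isClosed_eq (continuous_mulMin continuous_const continuous_id) (continuous_mulMin continuous_const (continuous_mulMin continuous_const continuous_id))
    | ih z => simp only [← toMin_mul, mul_assoc]
  norm_mul_le x y := by
    induction x using denseRange_toMin.induction_on with
    | hp => exact isClosed_le (continuous_mulMin continuous_id continuous_const).norm
              (by fun_prop)
    | ih x =>
    induction y using denseRange_toMin.induction_on with
    | hp => exact isClosed_le (continuous_mulMin continuous_const continuous_id).norm
              (by fun_prop)
    | ih y =>
      simp only [← toMin_mul, norm_toMin]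
      exact minNorm_mul_le x y

/-- The involution of the minimal tensor product. -/
noncomputable def starMin : B ⊗ᵐ A →L⋆[ℂ] B ⊗ᵐ A :=
  ((toMin B A).comp (starLinearEquiv ℂ (A := B ⊗[ℂ] A)).toLinearMap).extendOfNorm (toMin B A)

noncomputable instance : Star (B ⊗ᵐ A) := ⟨fun x => starMin x⟩

theorem star_def (x : B ⊗ᵐ A) : star x = starMin x := rfl

theorem toMin_star (x : B ⊗[ℂ] A) : toMin B A (star x) = star (toMin B A x) := by
  rw [star_def]
  unfold starMin
  rw [LinearMap.extendOfNorm_eq denseRange_toMin ⟨1, fun x => ?_⟩]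
  · rfl
  · rw [one_mul, norm_toMin]
    exact (norm_toMin _).trans_le (minNorm_star_le x)

theorem continuous_starMin {X : Type*} [TopologicalSpace X] {f : X → B ⊗ᵐ A}
    (hf : Continuous f) : Continuous fun x => star (f x) := by
  simp only [star_def]; fun_prop

noncomputable instance : StarRing (B ⊗ᵐ A) where
  star_involutive x := by
    induction x using denseRange_toMin.induction_on with
    | hp => exact isClosed_eq (continuous_starMin (continuous_starMin continuous_id))
              continuous_id
    | ih x => simp only [← toMin_star, star_star]
  star_mul x y := by
    induction x using denseRange_toMin.induction_on with
    | hp => exact isClosed_eq (continuous_starMin (continuous_mul_const y))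
              ((continuous_starMin continuous_id).const_mul (star y))
    | ih x =>
    induction y using denseRange_toMin.induction_on with
    | hp => exact isClosed_eq (continuous_starMin (continuous_const_mul _))
              ((continuous_starMin continuous_id).mul_const _)
    | ih y => simp only [← toMin_star, ← toMin_mul, star_mul_tensor]
  star_add x y := by simp only [star_def, map_add]

noncomputable instance : NonUnitalCStarAlgebra (B ⊗ᵐ A) where
  __ := (inferInstance : NonUnitalNormedRing (B ⊗ᵐ A))
  __ := (inferInstance : StarRing (B ⊗ᵐ A))
  __ := (inferInstance : NormedSpace ℂ (B ⊗ᵐ A))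
  complete := (inferInstance : CompleteSpace (B ⊗ᵐ A)).complete
  smul_assoc c x y := by
    change mulMin (c • x) y = c • mulMin x y
    simp
  smul_comm c x y := by
    change c • mulMin x y = mulMin x (c • y)
    simp
  star_smul c x := by simp [star_def]
  norm_mul_self_le x := by
    induction x using denseRange_toMin.induction_on with
    | hp => exact isClosed_le (by fun_prop)
              (continuous_mulMin (continuous_starMin continuous_id) continuous_id).norm
    | ih x =>
      rw [← toMin_star, ← toMin_mul, norm_toMin, norm_toMin]
      exact minNorm_sq_le x

/-- The elementary tensor `b ⊗ a` in the minimal tensor product. -/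
noncomputable def tmul (b : B) (a : A) : B ⊗ᵐ A := toMin B A (b ⊗ₜ a)

end Completion

section Multipliers

variable {D E F G : Type u} [NonUnitalCStarAlgebra D] [NonUnitalCStarAlgebra E]
  [NonUnitalCStarAlgebra F] [NonUnitalCStarAlgebra G]

/-- `m ⊗ n` acting from the left on the algebraic tensor product. -/
noncomputable def leftMap (m : 𝓜(ℂ, D)) (n : 𝓜(ℂ, E)) : D ⊗[ℂ] E →ₗ[ℂ] D ⊗[ℂ] E :=
  TensorProduct.map m.fst.toLinearMap n.fst.toLinearMap

/-- `m ⊗ n` acting from the right on the algebraic tensor product. -/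
noncomputable def rightMap (m : 𝓜(ℂ, D)) (n : 𝓜(ℂ, E)) : D ⊗[ℂ] E →ₗ[ℂ] D ⊗[ℂ] E :=
  TensorProduct.map m.snd.toLinearMap n.snd.toLinearMap

@[simp] theorem leftMap_tmul (m : 𝓜(ℂ, D)) (n : 𝓜(ℂ, E)) (d : D) (e : E) :
    leftMap m n (d ⊗ₜ e) = m.fst d ⊗ₜ n.fst e := rfl

@[simp] theorem rightMap_tmul (m : 𝓜(ℂ, D)) (n : 𝓜(ℂ, E)) (d : D) (e : E) :
    rightMap m n (d ⊗ₜ e) = m.snd d ⊗ₜ n.snd e := rfl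

theorem unitary_fst {u : 𝓜(ℂ, D)} (hu : u ∈ unitary 𝓜(ℂ, D)) (d d' : D) :
    star (u.fst d) * u.fst d' = star d * d' := by
  have h1 : (star u).snd (star d) = star (u.fst d) := by
    rw [DoubleCentralizer.star_snd, star_star]
  rw [← h1, (star u).central]
  have h2 : (star u).fst (u.fst d') = (star u * u).fst d' := by
    rw [DoubleCentralizer.mul_fst]; rfl
  rw [h2, Unitary.star_mul_self_of_mem hu]
  rfl

theorem leftMap_unitary {u : 𝓜(ℂ, D)} {v : 𝓜(ℂ, E)} (hu : u ∈ unitary 𝓜(ℂ, D))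
    (hv : v ∈ unitary 𝓜(ℂ, E)) (x y : D ⊗[ℂ] E) :
    star (leftMap u v x) * leftMap u v y = star x * y := by
  induction x using TensorProduct.induction_on with
  | zero => simp
  | add x x' hx hx' => simp only [map_add, star_add, add_mul, hx, hx']
  | tmul d e =>
    induction y using TensorProduct.induction_on with
    | zero => simp
    | add y y' hy hy' => simp only [map_add, mul_add, hy, hy']
    | tmul d' e' =>
      simp only [leftMap_tmul, TensorProduct.star_tmul, Algebra.TensorProduct.tmul_mul_tmul,
        unitary_fst hu, unitary_fst hv]

theorem leftMap_bdd (m : 𝓜(ℂ, D)) (n : 𝓜(ℂ, E)) :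
    ∃ C : ℝ, ∀ x, minNorm (leftMap m n x) ≤ C * minNorm x := by
  have hm : m ∈ Submodule.span ℂ (unitary 𝓜(ℂ, D) : Set 𝓜(ℂ, D)) := by
    rw [CStarAlgebra.span_unitary]; trivial
  have hn : n ∈ Submodule.span ℂ (unitary 𝓜(ℂ, E) : Set 𝓜(ℂ, E)) := by
    rw [CStarAlgebra.span_unitary]; trivial
  have zero_l : ∀ n : 𝓜(ℂ, E), leftMap (0 : 𝓜(ℂ, D)) n = 0 := fun n =>
    TensorProduct.ext' fun d e => by simp
  have zero_r : ∀ m : 𝓜(ℂ, D), leftMap m (0 : 𝓜(ℂ, E)) = 0 := fun m =>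
    TensorProduct.ext' fun d e => by simp
  have add_l : ∀ (m m' : 𝓜(ℂ, D)) (n : 𝓜(ℂ, E)),
      leftMap (m + m') n = leftMap m n + leftMap m' n := fun m m' n =>
    TensorProduct.ext' fun d e => by simp [TensorProduct.add_tmul]
  have add_r : ∀ (m : 𝓜(ℂ, D)) (n n' : 𝓜(ℂ, E)),
      leftMap m (n + n') = leftMap m n + leftMap m n' := fun m n n' =>
    TensorProduct.ext' fun d e => by simp [TensorProduct.tmul_add]
  have smul_l : ∀ (c : ℂ) (m : 𝓜(ℂ, D)) (n : 𝓜(ℂ, E)),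
      leftMap (c • m) n = c • leftMap m n := fun c m n =>
    TensorProduct.ext' fun d e => by simp [TensorProduct.smul_tmul']
  have smul_r : ∀ (c : ℂ) (m : 𝓜(ℂ, D)) (n : 𝓜(ℂ, E)),
      leftMap m (c • n) = c • leftMap m n := fun c m n =>
    TensorProduct.ext' fun d e => by simp
  have h_add : ∀ {f g : D ⊗[ℂ] E →ₗ[ℂ] D ⊗[ℂ] E},
      (∃ C : ℝ, ∀ x, minNorm (f x) ≤ C * minNorm x) →
      (∃ C : ℝ, ∀ x, minNorm (g x) ≤ C * minNorm x) →
      ∃ C : ℝ, ∀ x, minNorm ((f + g) x) ≤ C * minNorm x := by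
    rintro f g ⟨C, hC⟩ ⟨C', hC'⟩
    refine ⟨C + C', fun x => ?_⟩
    rw [add_mul]
    exact (minNorm_add_le _ _).trans (add_le_add (hC x) (hC' x))
  have h_smul : ∀ {f : D ⊗[ℂ] E →ₗ[ℂ] D ⊗[ℂ] E} (c : ℂ),
      (∃ C : ℝ, ∀ x, minNorm (f x) ≤ C * minNorm x) →
      ∃ C : ℝ, ∀ x, minNorm ((c • f) x) ≤ C * minNorm x := by
    rintro f c ⟨C, hC⟩
    refine ⟨‖c‖ * C, fun x => ?_⟩
    rw [LinearMap.smul_apply, minNorm_smul, mul_assoc]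
    exact mul_le_mul_of_nonneg_left (hC x) (norm_nonneg c)
  have h_zero : ∃ C : ℝ, ∀ x, minNorm ((0 : D ⊗[ℂ] E →ₗ[ℂ] D ⊗[ℂ] E) x) ≤ C * minNorm x :=
    ⟨0, fun x => by rw [LinearMap.zero_apply, minNorm_zero, zero_mul]⟩
  induction hm using Submodule.span_induction with
  | zero => rw [zero_l]; exact h_zero
  | add m m' _ _ h h' => rw [add_l]; exact h_add h h'
  | smul c m _ h => rw [smul_l]; exact h_smul c h
  | mem u hu =>
    induction hn using Submodule.span_induction with
    | zero => rw [zero_r]; exact h_zero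
    | add n n' _ _ h h' => rw [add_r]; exact h_add h h'
    | smul c n _ h => rw [smul_r]; exact h_smul c h
    | mem v hv =>
      refine ⟨1, fun x => ?_⟩
      rw [one_mul]
      refine abs_le_of_sq_le_sq' ?_ (minNorm_nonneg x) |>.2
      rw [sq, sq]
      refine (minNorm_sq_le _).trans ?_
      rw [leftMap_unitary hu hv]
      refine (minNorm_mul_le _ _).trans_eq ?_
      rw [minNorm_star]

theorem rightMap_eq (m : 𝓜(ℂ, D)) (n : 𝓜(ℂ, E)) (x : D ⊗[ℂ] E) :
    rightMap m n x = star (leftMap (star m) (star n) (star x)) := by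
  induction x using TensorProduct.induction_on with
  | zero => simp
  | add x x' hx hx' => simp only [map_add, star_add, hx, hx']
  | tmul d e => simp

theorem rightMap_bdd (m : 𝓜(ℂ, D)) (n : 𝓜(ℂ, E)) :
    ∃ C : ℝ, ∀ x, minNorm (rightMap m n x) ≤ C * minNorm x := by
  obtain ⟨C, hC⟩ := leftMap_bdd (star m) (star n)
  refine ⟨C, fun x => ?_⟩
  rw [rightMap_eq, minNorm_star, ← minNorm_star x]
  exact hC _

theorem central_aux (m : 𝓜(ℂ, D)) (n : 𝓜(ℂ, E)) (x y : D ⊗[ℂ] E) :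
    rightMap m n x * y = x * leftMap m n y := by
  induction x using TensorProduct.induction_on with
  | zero => simp
  | add x x' hx hx' => simp only [map_add, add_mul, hx, hx']
  | tmul d e =>
    induction y using TensorProduct.induction_on with
    | zero => simp
    | add y y' hy hy' => simp only [map_add, mul_add, hy, hy']
    | tmul d' e' =>
      simp only [leftMap_tmul, rightMap_tmul, Algebra.TensorProduct.tmul_mul_tmul, m.central,
        n.central]

theorem extend_toMin_apply {f : D ⊗[ℂ] E →ₗ[ℂ] D ⊗[ℂ] E}
    (hf : ∃ C : ℝ, ∀ x, minNorm (f x) ≤ C * minNorm x) (x : D ⊗[ℂ] E) :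
    (toMin D E ∘ₗ f).extendOfNorm (toMin D E) (toMin D E x) = toMin D E (f x) := by
  obtain ⟨C, hC⟩ := hf
  rw [LinearMap.extendOfNorm_eq denseRange_toMin ⟨C, fun x => ?_⟩]
  · rfl
  · simpa only [LinearMap.comp_apply, norm_toMin] using hC x

/-- The multiplier `m ⊗ n` of `D ⊗ E` for multipliers `m` of `D` and `n` of `E`, determined by
`(m ⊗ n)(d ⊗ e) = m d ⊗ n e` and `(d ⊗ e)(m ⊗ n) = d m ⊗ e n`. -/
noncomputable def mtmul (m : 𝓜(ℂ, D)) (n : 𝓜(ℂ, E)) : 𝓜(ℂ, D ⊗ᵐ E) where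
  fst := (toMin D E ∘ₗ leftMap m n).extendOfNorm (toMin D E)
  snd := (toMin D E ∘ₗ rightMap m n).extendOfNorm (toMin D E)
  central x y := by
    induction x using denseRange_toMin.induction_on with
    | hp => exact isClosed_eq (by fun_prop) (by fun_prop)
    | ih x =>
    induction y using denseRange_toMin.induction_on with
    | hp => exact isClosed_eq (by fun_prop) (by fun_prop)
    | ih y =>
      rw [extend_toMin_apply (leftMap_bdd m n), extend_toMin_apply (rightMap_bdd m n),
        ← toMin_mul, ← toMin_mul, central_aux]

theorem mtmul_fst_tmul (m : 𝓜(ℂ, D)) (n : 𝓜(ℂ, E)) (d : D) (e : E) :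
    (mtmul m n).fst (tmul d e) = tmul (m.fst d) (n.fst e) :=
  extend_toMin_apply (leftMap_bdd m n) (d ⊗ₜ e)

theorem mtmul_snd_tmul (m : 𝓜(ℂ, D)) (n : 𝓜(ℂ, E)) (d : D) (e : E) :
    (mtmul m n).snd (tmul d e) = tmul (m.snd d) (n.snd e) :=
  extend_toMin_apply (rightMap_bdd m n) (d ⊗ₜ e)

end Multipliers

section Extensions

variable {D E F G A : Type u} [NonUnitalCStarAlgebra D] [NonUnitalCStarAlgebra E]
  [NonUnitalCStarAlgebra F] [NonUnitalCStarAlgebra G] [NonUnitalCStarAlgebra A]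

/-- The inclusion of a `C*`-algebra into its multiplier algebra. -/
noncomputable def incl (D : Type u) [NonUnitalCStarAlgebra D] : D →⋆ₙₐ[ℂ] 𝓜(ℂ, D) :=
  DoubleCentralizer.coeHom

theorem mult_ext {m n : 𝓜(ℂ, D ⊗ᵐ E)}
    (h1 : ∀ d e, m.fst (tmul d e) = n.fst (tmul d e))
    (h2 : ∀ d e, m.snd (tmul d e) = n.snd (tmul d e)) : m = n := by
  refine DoubleCentralizer.ext _ _ _ _ (Prod.ext ?_ ?_)
  · exact toMin_ext fun x => LinearMap.congr_fun (f := m.fst.toLinearMap ∘ₗ toMin D E)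
      (g := n.fst.toLinearMap ∘ₗ toMin D E) (TensorProduct.ext' h1) x
  · exact toMin_ext fun x => LinearMap.congr_fun (f := m.snd.toLinearMap ∘ₗ toMin D E)
      (g := n.snd.toLinearMap ∘ₗ toMin D E) (TensorProduct.ext' h2) x

theorem tmul_add_left (d d' : D) (e : E) : tmul (d + d') e = tmul d e + tmul d' e := by
  simp only [tmul, TensorProduct.add_tmul, map_add]

theorem tmul_add_right (d : D) (e e' : E) : tmul d (e + e') = tmul d e + tmul d e' := by
  simp only [tmul, TensorProduct.tmul_add, map_add]

theorem tmul_smul_left (c : ℂ) (d : D) (e : E) : tmul (c • d) e = c • tmul d e := by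
  simp only [tmul, ← TensorProduct.smul_tmul', map_smul]

theorem tmul_smul_right (c : ℂ) (d : D) (e : E) : tmul d (c • e) = c • tmul d e := by
  simp only [tmul, TensorProduct.tmul_smul, map_smul]

/-- `m ⊗ n` as a bilinear map of the multipliers `m` and `n`. -/
noncomputable def mtmulBilin : 𝓜(ℂ, D) →ₗ[ℂ] 𝓜(ℂ, E) →ₗ[ℂ] 𝓜(ℂ, D ⊗ᵐ E) :=
  LinearMap.mk₂ ℂ mtmul
    (fun m m' n => mult_ext
      (fun d e => by simp [mtmul_fst_tmul, tmul_add_left])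
      (fun d e => by simp [mtmul_snd_tmul, tmul_add_left]))
    (fun c m n => mult_ext
      (fun d e => by simp [mtmul_fst_tmul, tmul_smul_left])
      (fun d e => by simp [mtmul_snd_tmul, tmul_smul_left]))
    (fun m n n' => mult_ext
      (fun d e => by simp [mtmul_fst_tmul, tmul_add_right])
      (fun d e => by simp [mtmul_snd_tmul, tmul_add_right]))
    (fun c m n => mult_ext
      (fun d e => by simp [mtmul_fst_tmul, tmul_smul_right])
      (fun d e => by simp [mtmul_snd_tmul, tmul_smul_right]))

/-- The continuous extension `φ ⊗ ψ : D ⊗ E → F ⊗ G` of `d ⊗ e ↦ φ(d) ⊗ ψ(e)`. -/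
noncomputable def tensorMap (φ : D →⋆ₙₐ[ℂ] F) (ψ : E →⋆ₙₐ[ℂ] G) : D ⊗ᵐ E →L[ℂ] F ⊗ᵐ G :=
  (toMin F G ∘ₗ TensorProduct.map (φ : D →ₗ[ℂ] F) (ψ : E →ₗ[ℂ] G)).extendOfNorm (toMin D E)

/-- The continuous extension `φ ⊗ ψ : D ⊗ E → M(F ⊗ G)` of `d ⊗ e ↦ φ(d) ⊗ ψ(e)`, for
`*`-homomorphisms `φ : D → M(F)` and `ψ : E → M(G)`. -/
noncomputable def homTensor (φ : D →⋆ₙₐ[ℂ] 𝓜(ℂ, F)) (ψ : E →⋆ₙₐ[ℂ] 𝓜(ℂ, G)) :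
    D ⊗ᵐ E →L[ℂ] 𝓜(ℂ, F ⊗ᵐ G) :=
  (TensorProduct.lift (mtmulBilin.compl₁₂ (φ : D →ₗ[ℂ] 𝓜(ℂ, F))
    (ψ : E →ₗ[ℂ] 𝓜(ℂ, G)))).extendOfNorm (toMin D E)

/-- The slice map `id ⊗ ω : D ⊗ A → D`, the continuous extension of `d ⊗ a ↦ ω(a) d`. -/
noncomputable def slice (D : Type u) [NonUnitalCStarAlgebra D] (ω : A →L[ℂ] ℂ) : D ⊗ᵐ A →L[ℂ] D :=
  ((TensorProduct.rid ℂ D).toLinearMap ∘ₗ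
    TensorProduct.map LinearMap.id ω.toLinearMap).extendOfNorm (toMin D A)

/-- The canonical isomorphism `D ⊗ (E ⊗ F) → (D ⊗ E) ⊗ F`, the continuous extension of
`d ⊗ (e ⊗ f) ↦ (d ⊗ e) ⊗ f` from the image of the algebraic tensor product. -/
noncomputable def assoc (D E F : Type u) [NonUnitalCStarAlgebra D] [NonUnitalCStarAlgebra E]
    [NonUnitalCStarAlgebra F] : D ⊗ᵐ (E ⊗ᵐ F) →L[ℂ] (D ⊗ᵐ E) ⊗ᵐ F :=
  (toMin (D ⊗ᵐ E) F ∘ₗ TensorProduct.map (toMin D E) LinearMap.id ∘ₗ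
    (TensorProduct.assoc ℂ D E F).symm.toLinearMap).extendOfNorm
  (toMin D (E ⊗ᵐ F) ∘ₗ TensorProduct.map LinearMap.id (toMin E F))

/-- The strict topology on the multiplier algebra: the coarsest topology for which
`m ↦ m d` and `m ↦ d m` are continuous for all `d` in `D`. -/
noncomputable abbrev strictTopology (D : Type u) [NonUnitalCStarAlgebra D] : TopologicalSpace 𝓜(ℂ, D) :=
  TopologicalSpace.induced (fun m (d : D) => (m.fst d, m.snd d)) inferInstance

/-- A map `D → M(E)` is strict if it is strictly continuous on the unit ball. -/
def IsStrict (φ : D → 𝓜(ℂ, E)) : Prop :=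
  @ContinuousOn D 𝓜(ℂ, E) (TopologicalSpace.induced (incl D) (strictTopology D))
    (strictTopology E) φ (Metric.closedBall 0 1)

/-- The extension to multipliers of a strict map `D → M(E)`: its value at `m` is the strict limit
of `φ(d)`, as `d` in `D` tends strictly to `m` while `‖d‖ ≤ ‖m‖`. -/
noncomputable def strictExt (φ : D → 𝓜(ℂ, E)) (m : 𝓜(ℂ, D)) : 𝓜(ℂ, E) :=
  @Filter.lim 𝓜(ℂ, E) (strictTopology E) ⟨0⟩
    (Filter.map φ (Filter.comap (incl D) (@nhds 𝓜(ℂ, D) (strictTopology D) m) ⊓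
      Filter.principal (Metric.closedBall 0 ‖m‖)))

/-- `φ ⊗ id : M(D ⊗ A) → M(E ⊗ A)` for a strict `*`-homomorphism `φ : D → M(E)`. -/
noncomputable def tensorId (φ : D →⋆ₙₐ[ℂ] 𝓜(ℂ, E)) : 𝓜(ℂ, D ⊗ᵐ A) → 𝓜(ℂ, E ⊗ᵐ A) :=
  strictExt (homTensor φ (incl A))

/-- `id ⊗ Δ : M(D ⊗ A) → M(D ⊗ A ⊗ A)` for a strict `*`-homomorphism `Δ : A → M(A ⊗ A)`. -/
noncomputable def idTensor (D : Type u) [NonUnitalCStarAlgebra D]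
    (Δ : A →⋆ₙₐ[ℂ] 𝓜(ℂ, A ⊗ᵐ A)) (m : 𝓜(ℂ, D ⊗ᵐ A)) : 𝓜(ℂ, (D ⊗ᵐ A) ⊗ᵐ A) :=
  strictExt (fun x => incl _ (assoc D A A x)) (strictExt (homTensor (incl D) Δ) m)

/-- `IsSlice ω T m` says that the multiplier `m` of `D` is the slice `(id ⊗ ω)(T)` of the
multiplier `T` of `D ⊗ A`. Every functional has the form `ω(x) = υ(x a)`, and then
`(id ⊗ ω)(T) d = (id ⊗ υ)(T (d ⊗ a))`. -/
def IsSlice (ω : A →L[ℂ] ℂ) (T : 𝓜(ℂ, D ⊗ᵐ A)) (m : 𝓜(ℂ, D)) : Prop :=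
  ∃ (a : A) (υ : A →L[ℂ] ℂ), (∀ x, ω x = υ (x * a)) ∧
    ∀ d, m.fst d = slice D υ (T.fst (tmul d a))

/-- `A` has the slice map property: for each `C*`-algebra `D` and each `C*`-subalgebra `S` of `D`,
an element of `D ⊗ A` all of whose slices are in `S` belongs to `S ⊗ A`. -/
def SliceMapProperty (A : Type u) [NonUnitalCStarAlgebra A] : Prop :=
  ∀ (D : Type u) [NonUnitalCStarAlgebra D] (S : NonUnitalStarSubalgebra ℂ D),
    IsClosed (S : Set D) → ∀ x : D ⊗ᵐ A, (∀ ω : A →L[ℂ] ℂ, slice D ω x ∈ S) →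
      x ∈ (Submodule.span ℂ {y : D ⊗ᵐ A | ∃ s ∈ S, ∃ a : A, y = tmul s a}).topologicalClosure

end Extensions

section Coactions

variable {A B C D : Type u} [NonUnitalCStarAlgebra A] [NonUnitalCStarAlgebra B]
  [NonUnitalCStarAlgebra C] [NonUnitalCStarAlgebra D]

/-- `φ : D → M(B)` is nondegenerate: the span of `φ(D) B` is dense in `B`. -/
def IsNondegenerate (φ : D →⋆ₙₐ[ℂ] 𝓜(ℂ, B)) : Prop :=
  (Submodule.span ℂ {x : B | ∃ d b, x = (φ d).fst b}).topologicalClosure = ⊤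

/-- `(A, Δ)` is a `C*`-bialgebra. -/
structure IsComultiplication (Δ : A →⋆ₙₐ[ℂ] 𝓜(ℂ, A ⊗ᵐ A)) : Prop where
  nondegenerate : IsNondegenerate Δ
  coassoc : ∀ a, tensorId Δ (Δ a) = idTensor A Δ (Δ a)

/-- `δ` is a partial coaction of the `C*`-bialgebra `(A, Δ)` on `C`. -/
structure IsPartialCoaction (Δ : A →⋆ₙₐ[ℂ] 𝓜(ℂ, A ⊗ᵐ A)) (δ : C →⋆ₙₐ[ℂ] 𝓜(ℂ, C ⊗ᵐ A)) :
    Prop where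
  strict : IsStrict δ
  mul_mem : ∀ c a, ∃ z : C ⊗ᵐ A, δ c * mtmul 1 (incl A a) = incl _ z
  partial_coassoc : ∀ c, tensorId δ (δ c) = mtmul (strictExt δ 1) 1 * idTensor C Δ (δ c)

/-- `δ` is a coaction of the `C*`-bialgebra `(A, Δ)` on `B`. -/
structure IsCoaction (Δ : A →⋆ₙₐ[ℂ] 𝓜(ℂ, A ⊗ᵐ A)) (δ : B →⋆ₙₐ[ℂ] 𝓜(ℂ, B ⊗ᵐ A)) : Prop where
  strict : IsStrict δ
  mul_mem : ∀ b a, ∃ z : B ⊗ᵐ A, δ b * mtmul 1 (incl A a) = incl _ z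
  coassoc : ∀ b, tensorId δ (δ b) = idTensor B Δ (δ b)

/-- `δ` is regular: `(id ⊗ Δ)(δ(C)) (1 ⊗ 1 ⊗ A)` is contained in `M(C ⊗ A) ⊗ A`. -/
def IsRegularCoaction (Δ : A →⋆ₙₐ[ℂ] 𝓜(ℂ, A ⊗ᵐ A)) (δ : C →⋆ₙₐ[ℂ] 𝓜(ℂ, C ⊗ᵐ A)) : Prop :=
  ∀ c a, ∃ y : 𝓜(ℂ, C ⊗ᵐ A) ⊗ᵐ A,
    homTensor (NonUnitalStarAlgHom.id ℂ 𝓜(ℂ, C ⊗ᵐ A)) (incl A) y =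
      idTensor C Δ (δ c) * mtmul 1 (incl A a)

/-- `(B, δB, ι)` is a dilation of the partial coaction `δ` on `C`: a coaction `δB` with an embedding
`ι` satisfying `δB(ι(c)) (ι(c') ⊗ a) = (ι ⊗ id)(δ(c) (c' ⊗ a))`. -/
structure IsDilation (Δ : A →⋆ₙₐ[ℂ] 𝓜(ℂ, A ⊗ᵐ A)) (δ : C →⋆ₙₐ[ℂ] 𝓜(ℂ, C ⊗ᵐ A))
    (δB : B →⋆ₙₐ[ℂ] 𝓜(ℂ, B ⊗ᵐ A)) (ι : C →⋆ₙₐ[ℂ] B) : Prop where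
  coaction : IsCoaction Δ δB
  injective : Function.Injective ι
  weak_morphism : ∀ c c' a, (δB (ι c)).fst (tmul (ι c') a) =
    tensorMap ι (NonUnitalStarAlgHom.id ℂ A) ((δ c).fst (tmul c' a))

/-- `(B, δB, ι)` is a minimal dilation: a dilation such that `ι(C)` and the elements
`ω ▷ ι(c) = (id ⊗ ω)(δB(ι(c)))` generate `B` as a `C*`-algebra. -/
structure IsMinimalDilation (Δ : A →⋆ₙₐ[ℂ] 𝓜(ℂ, A ⊗ᵐ A)) (δ : C →⋆ₙₐ[ℂ] 𝓜(ℂ, C ⊗ᵐ A))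
    (δB : B →⋆ₙₐ[ℂ] 𝓜(ℂ, B ⊗ᵐ A)) (ι : C →⋆ₙₐ[ℂ] B) : Prop extends IsDilation Δ δ δB ι where
  minimal : (NonUnitalStarAlgebra.adjoin ℂ
    ({b : B | ∃ (ω : A →L[ℂ] ℂ) (c : C), IsSlice ω (δB (ι c)) (incl B b)} ∪
      Set.range ι)).topologicalClosure = ⊤

/-- `φ` is a morphism of dilations `(B, δB, ιB) → (D, δD, ιD)`: it satisfies `φ(ιB(c)) = ιD(c)` and
`δD(φ(b)) (1 ⊗ a) = (φ ⊗ id)(δB(b) (1 ⊗ a))`. -/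
structure IsDilationMorphism (δB : B →⋆ₙₐ[ℂ] 𝓜(ℂ, B ⊗ᵐ A)) (ιB : C →⋆ₙₐ[ℂ] B)
    (δD : D →⋆ₙₐ[ℂ] 𝓜(ℂ, D ⊗ᵐ A)) (ιD : C →⋆ₙₐ[ℂ] D) (φ : B →⋆ₙₐ[ℂ] D) : Prop where
  map_embedding : ∀ c, φ (ιB c) = ιD c
  equivariant : ∀ b a (w : B ⊗ᵐ A), incl _ w = δB b * mtmul 1 (incl A a) →
    δD (φ b) * mtmul 1 (incl A a) = incl _ (tensorMap φ (NonUnitalStarAlgHom.id ℂ A) w)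

/-- The `C*`-algebra of multipliers of `C ⊗ A` generated by `δ(C)` and the slices
`(id ⊗ id ⊗ ω)((id ⊗ Δ)(δ(c)))`. -/
noncomputable def globalization (Δ : A →⋆ₙₐ[ℂ] 𝓜(ℂ, A ⊗ᵐ A)) (δ : C →⋆ₙₐ[ℂ] 𝓜(ℂ, C ⊗ᵐ A)) :
    NonUnitalStarSubalgebra ℂ 𝓜(ℂ, C ⊗ᵐ A) :=
  (NonUnitalStarAlgebra.adjoin ℂ
    ({m : 𝓜(ℂ, C ⊗ᵐ A) | ∃ (ω : A →L[ℂ] ℂ) (c : C), IsSlice ω (idTensor C Δ (δ c)) m} ∪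
      Set.range δ)).topologicalClosure

noncomputable instance (Δ : A →⋆ₙₐ[ℂ] 𝓜(ℂ, A ⊗ᵐ A)) (δ : C →⋆ₙₐ[ℂ] 𝓜(ℂ, C ⊗ᵐ A)) :
    NonUnitalCStarAlgebra (globalization Δ δ) :=
  NonUnitalStarSubalgebra.nonUnitalCStarAlgebra _
    (h_closed := NonUnitalStarSubalgebra.isClosed_topologicalClosure _)

/-- The map `c ↦ δ(c)` from `C` to the globalization. -/
noncomputable def globalizationEmbedding (Δ : A →⋆ₙₐ[ℂ] 𝓜(ℂ, A ⊗ᵐ A))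
    (δ : C →⋆ₙₐ[ℂ] 𝓜(ℂ, C ⊗ᵐ A)) : C →⋆ₙₐ[ℂ] globalization Δ δ :=
  NonUnitalStarAlgHom.codRestrict δ (globalization Δ δ) fun c =>
    NonUnitalStarSubalgebra.le_topologicalClosure _
      (NonUnitalStarAlgebra.subset_adjoin ℂ _ (Or.inr ⟨c, rfl⟩))

/-- `δG` is the restriction of `id ⊗ Δ` to the globalization: its values, which are multipliers of
`globalization Δ δ ⊗ A`, act there like the multipliers `(id ⊗ Δ)(x)` of `C ⊗ A ⊗ A`. -/
def IsGlobalizationCoaction (Δ : A →⋆ₙₐ[ℂ] 𝓜(ℂ, A ⊗ᵐ A)) (δ : C →⋆ₙₐ[ℂ] 𝓜(ℂ, C ⊗ᵐ A))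
    (δG : globalization Δ δ →⋆ₙₐ[ℂ] 𝓜(ℂ, globalization Δ δ ⊗ᵐ A)) : Prop :=
  ∀ (x : globalization Δ δ) (z : globalization Δ δ ⊗ᵐ A),
    homTensor (NonUnitalStarSubalgebraClass.subtype (globalization Δ δ)) (incl A) ((δG x).fst z) =
      idTensor C Δ (x : 𝓜(ℂ, C ⊗ᵐ A)) *
        homTensor (NonUnitalStarSubalgebraClass.subtype (globalization Δ δ)) (incl A) z

end Coactions

end CStarTensor

open CStarTensor

namespace CStarTensor

section States

open scoped ComplexOrder CStarAlgebra

variable {U : Type u} [CStarAlgebra U]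

/-- A functional `g` of norm at most one with `g 1 = 1` is real on self-adjoint elements. -/
theorem im_apply_eq_zero (g : U →L[ℂ] ℂ) (hg : ‖g‖ ≤ 1) (h1 : g 1 = 1) {x : U}
    (hx : IsSelfAdjoint x) : (g x).im = 0 := by
  have key : ∀ t : ℝ, 2 * t * (g x).im ≤ ‖x‖ ^ 2 := fun t => by
    have h2 : ‖g (x + ((t : ℂ) * Complex.I) • (1 : U))‖ ^ 2 ≤ ‖x‖ ^ 2 + t ^ 2 := by
      have h3 : ‖x + ((t : ℂ) * Complex.I) • (1 : U)‖ ^ 2 ≤ ‖x‖ ^ 2 + t ^ 2 := by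
        rw [sq, ← CStarRing.norm_star_mul_self]
        have h4 : star (x + ((t : ℂ) * Complex.I) • (1 : U)) * (x + ((t : ℂ) * Complex.I) • (1 : U))
            = x * x + ((t ^ 2 : ℝ) : ℂ) • (1 : U) := by
          rw [star_add, star_smul, hx.star_eq, star_one]
          simp only [add_mul, mul_add, smul_mul_assoc, mul_smul_comm, one_mul, mul_one, smul_smul,
            star_mul', Complex.star_def, Complex.conj_ofReal, Complex.conj_I, smul_add]
          have : (t * -Complex.I * (t * Complex.I) : ℂ) = ((t ^ 2 : ℝ) : ℂ) := by
            push_cast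
            linear_combination (-(t : ℂ) ^ 2) * Complex.I_sq
          rw [mul_comm ((t : ℂ) * Complex.I), this]
          module
        rw [h4]
        refine (norm_add_le _ _).trans (add_le_add ?_ ?_)
        · rw [sq]; exact norm_mul_le _ _
        · rw [norm_smul, Complex.norm_real, Real.norm_of_nonneg (sq_nonneg t)]
          rcases subsingleton_or_nontrivial U with h | h
          · rw [Subsingleton.elim (1 : U) 0, norm_zero, mul_zero]; positivity
          · rw [CStarRing.norm_one, mul_one]
      refine le_trans ?_ h3
      gcongr
      exact (g.le_opNorm _).trans (mul_le_of_le_one_left (norm_nonneg _) hg)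
    rw [map_add, map_smul, h1, smul_eq_mul, mul_one, Complex.sq_norm, Complex.normSq_apply] at h2
    simp at h2
    nlinarith [mul_self_nonneg (g x).re, mul_self_nonneg (g x).im]
  by_contra h
  have := key ((‖x‖ ^ 2 + 1) / (2 * (g x).im))
  have h3 : 2 * ((‖x‖ ^ 2 + 1) / (2 * (g x).im)) * (g x).im = ‖x‖ ^ 2 + 1 := by
    field_simp
  linarith

variable [PartialOrder U] [StarOrderedRing U]

theorem apply_nonneg_of_norm_le_one (g : U →L[ℂ] ℂ) (hg : ‖g‖ ≤ 1) (h1 : g 1 = 1) {x : U}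
    (hx : 0 ≤ x) : 0 ≤ g x := by
  rw [Complex.nonneg_iff]
  have hsa : IsSelfAdjoint x := .of_nonneg hx
  refine ⟨?_, (im_apply_eq_zero g hg h1 hsa).symm⟩
  have h2 : ‖algebraMap ℝ U ‖x‖ - x‖ ≤ ‖x‖ := by
    have h0 : 0 ≤ algebraMap ℝ U ‖x‖ - x :=
      sub_nonneg.mpr (IsSelfAdjoint.le_algebraMap_norm_self hsa)
    refine (CStarAlgebra.norm_le_norm_of_nonneg_of_le h0 (sub_le_self _ hx)).trans ?_
    rw [norm_algebraMap]
    rcases subsingleton_or_nontrivial U with h | h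
    · rw [Subsingleton.elim (1 : U) 0, norm_zero, mul_zero]; positivity
    · rw [CStarRing.norm_one, mul_one, norm_norm]
  have h3 : ‖g (algebraMap ℝ U ‖x‖ - x)‖ ≤ ‖x‖ :=
    ((g.le_opNorm _).trans (mul_le_of_le_one_left (norm_nonneg _) hg)).trans h2
  have h4 : g (algebraMap ℝ U ‖x‖) = (‖x‖ : ℂ) := by
    rw [Algebra.algebraMap_eq_smul_one, ← Complex.coe_smul, map_smul, h1, smul_eq_mul, mul_one]
  rw [map_sub, h4] at h3
  have h5 := (Complex.re_le_norm _).trans h3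
  simp at h5
  exact h5

/-- Every positive element attains its norm at a state. -/
theorem exists_state [Nontrivial U] {h : U} (hh : 0 ≤ h) :
    ∃ g : U →ₚ[ℂ] ℂ, g 1 = 1 ∧ g h = ‖h‖ := by
  have hsa : IsSelfAdjoint h := .of_nonneg hh
  have hmem : ‖h‖ ∈ spectrum ℝ h := CStarAlgebra.norm_mem_spectrum_of_nonneg hh
  have hnorm : ‖algebraMap ℝ U ‖h‖ + h‖ = 2 * ‖h‖ := by
    refine le_antisymm ?_ ?_
    · refine (norm_add_le _ _).trans ?_
      rw [norm_algebraMap, CStarRing.norm_one, mul_one, norm_norm, two_mul]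
    · have h1 : ‖h‖ + ‖h‖ ∈ spectrum ℝ (algebraMap ℝ U ‖h‖ + h) := by
        rwa [spectrum.add_mem_add_iff]
      have := spectrum.norm_le_norm_of_mem h1
      rwa [← two_mul, Real.norm_of_nonneg (by positivity)] at this
  obtain ⟨g, hg, hgx⟩ : ∃ g : U →L[ℂ] ℂ, ‖g‖ ≤ 1 ∧ g 1 = 1 ∧ g h = ‖h‖ := by
    rcases eq_or_ne h 0 with rfl | h0
    · obtain ⟨g, hg, h⟩ := exists_dual_vector'' ℂ (1 : U)
      refine ⟨g, hg, ?_, by simp⟩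
      rw [h, CStarRing.norm_one]; simp
    obtain ⟨g, hg, h⟩ := exists_dual_vector'' ℂ (algebraMap ℝ U ‖h‖ + h)
    refine ⟨g, hg, ?_⟩
    rename_i h'
    rw [hnorm, map_add, Algebra.algebraMap_eq_smul_one, ← Complex.coe_smul, map_smul,
      smul_eq_mul] at h
    have hp : 0 < ‖h'‖ := norm_pos_iff.mpr h0
    have e1 : ‖g 1‖ ≤ 1 := by
      refine (g.le_opNorm _).trans ?_
      rwa [CStarRing.norm_one, mul_one]
    have e2 : ‖g h'‖ ≤ ‖h'‖ := (g.le_opNorm _).trans (mul_le_of_le_one_left (norm_nonneg _) hg)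
    have hre := congrArg Complex.re h
    simp at hre
    have r1 : (g 1).re ≤ 1 := (Complex.re_le_norm _).trans e1
    have r2 : (g h').re ≤ ‖h'‖ := (Complex.re_le_norm _).trans e2
    have r3 : (g 1).re = 1 := by nlinarith
    have r4 : (g 1).im = 0 := by
      have := Complex.sq_norm (g 1)
      rw [Complex.normSq_apply, r3] at this
      nlinarith [norm_nonneg (g 1)]
    have r5 : g 1 = 1 := Complex.ext (by simpa using r3) (by simpa using r4)
    refine ⟨r5, ?_⟩
    rw [r5, mul_one] at h
    push_cast at h
    linear_combination h
  refine ⟨PositiveLinearMap.mk₀ g.toLinearMap fun x hx => apply_nonneg_of_norm_le_one g hg hgx.1 hx,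
    hgx.1, hgx.2⟩

end States

section FaithfulRep

open scoped ComplexOrder CStarAlgebra

variable {A : Type u} [NonUnitalCStarAlgebra A]

/-- Every element of a `C*`-algebra attains its norm in some representation. -/
theorem exists_rep_norm_eq (a : A) : ∃ r : HilbRep A, ‖r.π a‖ = ‖a‖ := by
  set U := Unitization ℂ A
  set x : U := (a : Unitization ℂ A)
  have hx : ‖x‖ = ‖a‖ := Unitization.norm_inr a
  let _ : PartialOrder U := CStarAlgebra.spectralOrder U
  have : StarOrderedRing U := CStarAlgebra.spectralOrderedRing U
  obtain ⟨g, h1, h2⟩ := exists_state (star_mul_self_nonneg x)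
  refine ⟨{ H := g.GNS
            π := g.gnsNonUnitalStarAlgHom.comp (Unitization.inrNonUnitalStarAlgHom ℂ A) },
    le_antisymm ?_ ?_⟩
  · exact NonUnitalStarAlgHom.norm_apply_le _ _
  · change ‖a‖ ≤ ‖g.gnsNonUnitalStarAlgHom x‖
    have h3 := (g.gnsNonUnitalStarAlgHom x).le_opNorm (g.toPreGNS 1 : g.GNS)
    rw [g.gnsNonUnitalStarAlgHom_apply_coe, Completion.norm_coe, Completion.norm_coe,
      g.preGNS_norm_def, g.preGNS_norm_def] at h3
    simp only [g.leftMulMapPreGNS_apply, g.ofPreGNS_toPreGNS, mul_one, star_one, h1] at h3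
    have h4 : (g (star x * x)).re = ‖a‖ * ‖a‖ := by
      rw [h2, CStarRing.norm_star_mul_self, hx]; rfl
    simpa [h4, Real.sqrt_mul_self (norm_nonneg a)] using h3

variable {ι : Type u} {H : ι → Type u} [∀ i, NormedAddCommGroup (H i)]
  [∀ i, InnerProductSpace ℂ (H i)]

/-- The diagonal operator on a Hilbert sum with uniformly bounded entries. -/
noncomputable def diagOp (T : ∀ i, H i →L[ℂ] H i) (C : ℝ) (hC : ∀ i, ‖T i‖ ≤ C) :
    lp H 2 →L[ℂ] lp H 2 :=
  have bd : ∀ (f : lp H 2) i, ‖T i (f i)‖ ≤ ‖((C : ℂ) • f) i‖ := fun f i => by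
    rw [lp.coeFn_smul, Pi.smul_apply, norm_smul, Complex.norm_real]
    exact ((T i).le_opNorm _).trans
      (mul_le_mul_of_nonneg_right ((hC i).trans (le_abs_self C)) (norm_nonneg _))
  LinearMap.mkContinuous
    { toFun := fun f => ⟨fun i => T i (f i), (lp.memℓp ((C : ℂ) • f)).mono' (bd f)⟩
      map_add' := fun f g => lp.ext (funext fun i => map_add (T i) (f i) (g i))
      map_smul' := fun c f => lp.ext (funext fun i => map_smul (T i) c (f i)) }
    |C| fun f => by
      refine (lp.norm_mono two_ne_zero (y := (C : ℂ) • f) (bd f)).trans_eq ?_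
      rw [norm_smul, Complex.norm_real, Real.norm_eq_abs]

theorem diagOp_apply (T : ∀ i, H i →L[ℂ] H i) (C : ℝ) (hC : ∀ i, ‖T i‖ ≤ C) (f : lp H 2) (i : ι) :
    diagOp T C hC f i = T i (f i) := rfl

/-- The Hilbert sum of a family of representations. -/
noncomputable def sumRep (r : ι → HilbRep A) : HilbRep A where
  H := lp (fun i => (r i).H) 2
  π :=
    { toFun := fun a => diagOp (fun i => (r i).π a) ‖a‖ fun i =>
        NonUnitalStarAlgHom.norm_apply_le (r i).π a
      map_smul' := fun c a => ContinuousLinearMap.ext fun f => lp.ext (funext fun i => by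
        simp [diagOp_apply])
      map_zero' := ContinuousLinearMap.ext fun f => lp.ext (funext fun i => by
        simp [diagOp_apply])
      map_add' := fun a b => ContinuousLinearMap.ext fun f => lp.ext (funext fun i => by
        simp [diagOp_apply])
      map_mul' := fun a b => ContinuousLinearMap.ext fun f => lp.ext (funext fun i => by
        simp [diagOp_apply])
      map_star' := fun a => by
        rw [ContinuousLinearMap.star_eq_adjoint, ContinuousLinearMap.eq_adjoint_iff]
        intro f g
        rw [lp.inner_eq_tsum, lp.inner_eq_tsum]
        refine tsum_congr fun i => ?_
        rw [diagOp_apply, diagOp_apply, map_star, ContinuousLinearMap.star_eq_adjoint,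
          ContinuousLinearMap.adjoint_inner_left] }

variable (A) in
/-- Every `C*`-algebra has a faithful representation. -/
theorem exists_faithful_rep : ∃ r : HilbRep A, Function.Injective r.π := by
  classical
  choose r hr using exists_rep_norm_eq (A := A)
  refine ⟨sumRep r, (injective_iff_map_eq_zero _).mpr fun a ha => ?_⟩
  have h : (r a).π a = 0 := ContinuousLinearMap.ext fun v => by
    have h1 : diagOp (fun i => (r i).π a) ‖a‖ (fun i =>
        NonUnitalStarAlgHom.norm_apply_le (r i).π a) = 0 := ha
    have h2 := diagOp_apply (fun i => (r i).π a) ‖a‖ (fun i =>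
        NonUnitalStarAlgHom.norm_apply_le (r i).π a) (lp.single 2 a v) a
    rw [h1, lp.single_apply_self] at h2
    exact h2.symm
  rw [← norm_eq_zero, ← hr a, h, norm_zero]

end FaithfulRep

section Lift

variable {B A : Type u} [NonUnitalCStarAlgebra B] [NonUnitalCStarAlgebra A]
  {E : Type*} [NonUnitalCStarAlgebra E]

theorem extendOfNorm_toMin {F : Type*} [NormedAddCommGroup F] [NormedSpace ℂ F] [CompleteSpace F]
    {f : B ⊗[ℂ] A →ₗ[ℂ] F} {C : ℝ} (hf : ∀ x, ‖f x‖ ≤ C * minNorm x) (x : B ⊗[ℂ] A) :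
    f.extendOfNorm (toMin B A) (toMin B A x) = f x :=
  LinearMap.extendOfNorm_eq denseRange_toMin ⟨C, fun x => by rw [norm_toMin]; exact hf x⟩ x

/-- A bounded `*`-homomorphism on the algebraic tensor product extends to the minimal tensor
product. -/
noncomputable def minLift (f : B ⊗[ℂ] A →ₗ[ℂ] E) (hmul : ∀ x y, f (x * y) = f x * f y)
    (hstar : ∀ x, f (star x) = star (f x)) {C : ℝ} (hf : ∀ x, ‖f x‖ ≤ C * minNorm x) :
    B ⊗ᵐ A →⋆ₙₐ[ℂ] E where
  toFun := f.extendOfNorm (toMin B A)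
  map_smul' c x := map_smul _ c x
  map_zero' := map_zero _
  map_add' := map_add _
  map_mul' x y := by
    induction x using denseRange_toMin.induction_on with
    | hp => exact isClosed_eq (by fun_prop) (by fun_prop)
    | ih x =>
    induction y using denseRange_toMin.induction_on with
    | hp => exact isClosed_eq (by fun_prop) (by fun_prop)
    | ih y =>
      rw [← toMin_mul, extendOfNorm_toMin hf, extendOfNorm_toMin hf, extendOfNorm_toMin hf, hmul]
  map_star' x := by
    induction x using denseRange_toMin.induction_on with
    | hp => exact isClosed_eq (by fun_prop) (by fun_prop)
    | ih x => rw [← toMin_star, extendOfNorm_toMin hf, extendOfNorm_toMin hf, hstar]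

theorem minLift_toMin {f : B ⊗[ℂ] A →ₗ[ℂ] E} {hmul : ∀ x y, f (x * y) = f x * f y}
    {hstar : ∀ x, f (star x) = star (f x)} {C : ℝ} {hf : ∀ x, ‖f x‖ ≤ C * minNorm x}
    (x : B ⊗[ℂ] A) : minLift f hmul hstar hf (toMin B A x) = f x :=
  extendOfNorm_toMin hf x

theorem continuous_starHom {D E : Type*} [NonUnitalCStarAlgebra D] [NonUnitalCStarAlgebra E]
    (φ : D →⋆ₙₐ[ℂ] E) : Continuous φ :=
  AddMonoidHomClass.continuous_of_bound φ 1 fun x => by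
    rw [one_mul]; exact NonUnitalStarAlgHom.norm_apply_le φ x

theorem induction_tmul {p : B ⊗ᵐ A → Prop} (hclosed : IsClosed {x | p x})
    (hadd : ∀ x y, p x → p y → p (x + y)) (htmul : ∀ b a, p (tmul b a)) (x : B ⊗ᵐ A) : p x := by
  induction x using denseRange_toMin.induction_on with
  | hp => exact hclosed
  | ih x =>
    induction x using TensorProduct.induction_on with
    | zero => simpa [tmul] using htmul 0 0
    | add x y hx hy => rw [map_add]; exact hadd _ _ hx hy
    | tmul b a => exact htmul b a

theorem tmul_mul_tmul (b b' : B) (a a' : A) : tmul b a * tmul b' a' = tmul (b * b') (a * a') := by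
  rw [tmul, tmul, ← toMin_mul, Algebra.TensorProduct.tmul_mul_tmul]; rfl

theorem star_tmul (b : B) (a : A) : star (tmul b a) = tmul (star b) (star a) := by
  rw [tmul, ← toMin_star, TensorProduct.star_tmul]; rfl

theorem norm_tmul_le (b : B) (a : A) : ‖tmul b a‖ ≤ ‖b‖ * ‖a‖ := by
  rw [tmul, norm_toMin]
  refine minNorm_le (by positivity) fun p q => ?_
  rw [tensorRep_tmul]
  refine (norm_opTensor_le _ _).trans ?_
  exact mul_le_mul (NonUnitalStarAlgHom.norm_apply_le p.π b)
    (NonUnitalStarAlgHom.norm_apply_le q.π a) (norm_nonneg _) (norm_nonneg _)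

variable (B A) in
/-- The elementary tensor as a continuous bilinear map. -/
noncomputable def tmulL : B →L[ℂ] A →L[ℂ] B ⊗ᵐ A :=
  LinearMap.mkContinuous₂ (LinearMap.mk₂ ℂ tmul
    (fun b b' a => by simp only [tmul, TensorProduct.add_tmul, map_add])
    (fun c b a => by simp only [tmul, ← TensorProduct.smul_tmul', map_smul])
    (fun b a a' => by simp only [tmul, TensorProduct.tmul_add, map_add])
    (fun c b a => by simp only [tmul, TensorProduct.tmul_smul, map_smul])) 1 fun b a => by
      rw [one_mul]; exact norm_tmul_le b a

theorem tmulL_apply (b : B) (a : A) : tmulL B A b a = tmul b a := rfl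

@[fun_prop]
theorem Continuous.tmul' {X : Type*} [TopologicalSpace X] {f : X → B} {g : X → A}
    (hf : Continuous f) (hg : Continuous g) : Continuous fun x => tmul (f x) (g x) := by
  simp only [← tmulL_apply]; fun_prop

theorem continuous_tmul_left (a : A) : Continuous fun b : B => tmul b a :=
  ((tmulL B A).flip a).continuous

theorem continuous_tmul_right (b : B) : Continuous fun a : A => tmul b a :=
  (tmulL B A b).continuous

/-- The representation `p ⊗ q` of `B ⊗ A`. -/
noncomputable def repTensor (p : HilbRep B) (q : HilbRep A) :
    B ⊗ᵐ A →⋆ₙₐ[ℂ] (HilbTensor p.H q.H →L[ℂ] HilbTensor p.H q.H) :=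
  minLift (tensorRep p q) (tensorRep_mul p q) (tensorRep_star p q) (C := 1)
    fun x => by rw [one_mul]; exact le_minNorm p q x

theorem repTensor_toMin (p : HilbRep B) (q : HilbRep A) (x : B ⊗[ℂ] A) :
    repTensor p q (toMin B A x) = tensorRep p q x := minLift_toMin x

theorem eq_zero_of_repTensor {x : B ⊗ᵐ A} (h : ∀ p q, repTensor p q x = 0) : x = 0 := by
  have key : ∀ ε > 0, ‖x‖ ≤ ε := fun ε hε => by
    obtain ⟨y, hy⟩ := Metric.denseRange_iff.mp (denseRange_toMin (B := B) (A := A)) x (ε / 2)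
      (half_pos hε)
    rw [dist_eq_norm] at hy
    have h1 : ‖toMin B A y‖ ≤ ε / 2 := by
      rw [norm_toMin]
      refine minNorm_le (half_pos hε).le fun p q => ?_
      rw [← repTensor_toMin, ← norm_neg, ← zero_sub, ← h p q, ← map_sub]
      exact (NonUnitalStarAlgHom.norm_apply_le _ _).trans hy.le
    calc ‖x‖ = ‖(x - toMin B A y) + toMin B A y‖ := by rw [sub_add_cancel]
      _ ≤ ε := (norm_add_le _ _).trans (by linarith)
  exact norm_le_zero_iff.mp (le_of_forall_pos_le_add fun ε hε => by simpa using key ε hε)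

end Lift

section Slices

variable {B A : Type u} [NonUnitalCStarAlgebra B] [NonUnitalCStarAlgebra A]

/-- The vector functional `b ↦ ⟨η, π(b) ξ⟩` of a representation `π`. -/
noncomputable def vecFun (p : HilbRep B) (ξ η : p.H) : B →L[ℂ] ℂ :=
  LinearMap.mkContinuous
    { toFun := fun b => inner ℂ η (p.π b ξ)
      map_add' := fun b b' => by simp
      map_smul' := fun c b => by simp } (‖ξ‖ * ‖η‖) fun b => by
    refine (norm_inner_le_norm _ _).trans ?_
    have h := ((p.π b).le_opNorm ξ).trans
      (mul_le_mul_of_nonneg_right (NonUnitalStarAlgHom.norm_apply_le p.π b) (norm_nonneg _))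
    calc ‖η‖ * ‖p.π b ξ‖ ≤ ‖η‖ * (‖b‖ * ‖ξ‖) := by gcongr
      _ = ‖ξ‖ * ‖η‖ * ‖b‖ := by ring

theorem vecFun_apply (p : HilbRep B) (ξ η : p.H) (b : B) :
    vecFun p ξ η b = inner ℂ η (p.π b ξ) := rfl

theorem opNorm_le_of_inner {H : Type*} [NormedAddCommGroup H] [InnerProductSpace ℂ H]
    {T : H →L[ℂ] H} {C : ℝ} (hC : 0 ≤ C) (h : ∀ ξ η, ‖inner ℂ η (T ξ)‖ ≤ C * ‖ξ‖ * ‖η‖) :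
    ‖T‖ ≤ C := by
  refine T.opNorm_le_bound hC fun ξ => ?_
  have h1 := h ξ (T ξ)
  rw [inner_self_eq_norm_sq_to_K, norm_pow, RCLike.norm_ofReal, abs_norm] at h1
  rcases (norm_nonneg (T ξ)).eq_or_lt with h0 | h0
  · rw [← h0]; positivity
  · exact le_of_mul_le_mul_right (by rwa [sq] at h1) h0

theorem norm_le_of_vecFun {b : B} {C : ℝ} (hC : 0 ≤ C)
    (h : ∀ (p : HilbRep B) ξ η, ‖vecFun p ξ η b‖ ≤ C * ‖ξ‖ * ‖η‖) : ‖b‖ ≤ C := by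
  obtain ⟨p, hp⟩ := exists_rep_norm_eq b
  rw [← hp]
  exact opNorm_le_of_inner hC (h p)

/-- The slice map `ω ⊗ id` on the algebraic tensor product. -/
noncomputable def leftSliceAlg (ω : B →L[ℂ] ℂ) : B ⊗[ℂ] A →ₗ[ℂ] A :=
  (TensorProduct.lid ℂ A).toLinearMap ∘ₗ TensorProduct.map ω.toLinearMap LinearMap.id

/-- The slice map `id ⊗ ω` on the algebraic tensor product. -/
noncomputable def sliceAlg (ω : A →L[ℂ] ℂ) : B ⊗[ℂ] A →ₗ[ℂ] B :=
  (TensorProduct.rid ℂ B).toLinearMap ∘ₗ TensorProduct.map LinearMap.id ω.toLinearMap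

theorem leftSliceAlg_tmul (ω : B →L[ℂ] ℂ) (b : B) (a : A) :
    leftSliceAlg ω (b ⊗ₜ a) = ω b • a := by simp [leftSliceAlg]

theorem sliceAlg_tmul (ω : A →L[ℂ] ℂ) (b : B) (a : A) :
    sliceAlg ω (b ⊗ₜ a) = ω a • b := by simp [sliceAlg]

theorem vecFun_leftSliceAlg (p : HilbRep B) (q : HilbRep A) (ξ η : p.H) (k k' : q.H)
    (x : B ⊗[ℂ] A) : vecFun q k k' (leftSliceAlg (vecFun p ξ η) x) =
      inner ℂ (toHilb (η ⊗ₜ[ℂ] k')) (tensorRep p q x (toHilb (ξ ⊗ₜ k))) := by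
  induction x using TensorProduct.induction_on with
  | zero => simp
  | add x y hx hy => simp only [map_add, hx, hy, add_apply, inner_add_right]
  | tmul b a =>
    rw [leftSliceAlg_tmul, map_smul, tensorRep_tmul, opTensor_tmul, toHilb_inner,
      TensorProduct.inner_tmul, vecFun_apply, vecFun_apply, smul_eq_mul]

theorem apply_leftSliceAlg (ω : A →L[ℂ] ℂ) (ω' : B →L[ℂ] ℂ) (x : B ⊗[ℂ] A) :
    ω (leftSliceAlg ω' x) = ω' (sliceAlg ω x) := by
  induction x using TensorProduct.induction_on with
  | zero => simp
  | add x y hx hy => simp only [map_add, hx, hy]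
  | tmul b a => simp [leftSliceAlg_tmul, sliceAlg_tmul, mul_comm]

theorem norm_toHilb_tmul {H K : Type u} [NormedAddCommGroup H] [InnerProductSpace ℂ H]
    [NormedAddCommGroup K] [InnerProductSpace ℂ K] (ξ : H) (k : K) :
    ‖toHilb (ξ ⊗ₜ[ℂ] k)‖ = ‖ξ‖ * ‖k‖ := by
  have h : ‖toHilb (ξ ⊗ₜ[ℂ] k)‖ = ‖ξ ⊗ₜ[ℂ] k‖ := Completion.norm_coe _
  rw [h, TensorProduct.norm_tmul]

theorem norm_leftSliceAlg_le (p : HilbRep B) (ξ η : p.H) (x : B ⊗[ℂ] A) :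
    ‖leftSliceAlg (vecFun p ξ η) x‖ ≤ ‖ξ‖ * ‖η‖ * minNorm x := by
  refine norm_le_of_vecFun (mul_nonneg (by positivity) (minNorm_nonneg x)) fun q k k' => ?_
  rw [vecFun_leftSliceAlg]
  refine (norm_inner_le_norm _ _).trans ?_
  have h := ((tensorRep p q x).le_opNorm (toHilb (ξ ⊗ₜ k))).trans
    (mul_le_mul_of_nonneg_right (le_minNorm p q x) (norm_nonneg _))
  rw [norm_toHilb_tmul] at h ⊢
  calc ‖η‖ * ‖k'‖ * ‖tensorRep p q x (toHilb (ξ ⊗ₜ k))‖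
      ≤ ‖η‖ * ‖k'‖ * (minNorm x * (‖ξ‖ * ‖k‖)) := by gcongr
    _ = _ := by ring

theorem norm_sliceAlg_le (ω : A →L[ℂ] ℂ) (x : B ⊗[ℂ] A) :
    ‖sliceAlg ω x‖ ≤ ‖ω‖ * minNorm x := by
  refine norm_le_of_vecFun (mul_nonneg (norm_nonneg _) (minNorm_nonneg x)) fun p ξ η => ?_
  rw [← apply_leftSliceAlg]
  refine (ω.le_opNorm _).trans ?_
  calc ‖ω‖ * ‖leftSliceAlg (vecFun p ξ η) x‖ ≤ ‖ω‖ * (‖ξ‖ * ‖η‖ * minNorm x) := by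
        gcongr; exact norm_leftSliceAlg_le p ξ η x
    _ = _ := by ring

theorem slice_toMin (ω : A →L[ℂ] ℂ) (x : B ⊗[ℂ] A) : slice B ω (toMin B A x) = sliceAlg ω x :=
  extendOfNorm_toMin (norm_sliceAlg_le ω) x

theorem slice_tmul (ω : A →L[ℂ] ℂ) (b : B) (a : A) : slice B ω (tmul b a) = ω a • b := by
  rw [tmul, slice_toMin, sliceAlg_tmul]

/-- The slice map `ω ⊗ id` for a vector functional `ω`. -/
noncomputable def leftSlice (p : HilbRep B) (ξ η : p.H) : B ⊗ᵐ A →L[ℂ] A :=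
  (leftSliceAlg (vecFun p ξ η)).extendOfNorm (toMin B A)

theorem leftSlice_toMin (p : HilbRep B) (ξ η : p.H) (x : B ⊗[ℂ] A) :
    leftSlice p ξ η (toMin B A x) = leftSliceAlg (vecFun p ξ η) x :=
  extendOfNorm_toMin (norm_leftSliceAlg_le p ξ η) x

theorem apply_leftSlice (ω : A →L[ℂ] ℂ) (p : HilbRep B) (ξ η : p.H) (x : B ⊗ᵐ A) :
    ω (leftSlice p ξ η x) = vecFun p ξ η (slice B ω x) := by
  induction x using denseRange_toMin.induction_on with
  | hp => exact isClosed_eq (by fun_prop) (by fun_prop)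
  | ih x => rw [leftSlice_toMin, slice_toMin, apply_leftSliceAlg]

theorem vecFun_leftSlice (p : HilbRep B) (q : HilbRep A) (ξ η : p.H) (k k' : q.H)
    (x : B ⊗ᵐ A) : vecFun q k k' (leftSlice p ξ η x) =
      inner ℂ (toHilb (η ⊗ₜ[ℂ] k')) (repTensor p q x (toHilb (ξ ⊗ₜ k))) := by
  induction x using denseRange_toMin.induction_on with
  | hp =>
    have := continuous_starHom (repTensor p q)
    exact isClosed_eq (by fun_prop) (by fun_prop)
  | ih x => rw [leftSlice_toMin, repTensor_toMin, vecFun_leftSliceAlg]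

theorem hilb_ext' {H K : Type u} [NormedAddCommGroup H] [InnerProductSpace ℂ H]
    [NormedAddCommGroup K] [InnerProductSpace ℂ K] {T : HilbTensor H K →L[ℂ] HilbTensor H K}
    (h : ∀ (ξ : H) (k : K) (η : H) (k' : K),
      inner ℂ (toHilb (η ⊗ₜ[ℂ] k')) (T (toHilb (ξ ⊗ₜ k))) = 0) : T = 0 := by
  refine hilb_ext fun ξ k => ?_
  have h1 : ∀ w : HilbTensor H K, inner ℂ w (T (toHilb (ξ ⊗ₜ k))) = 0 := fun w => by
    induction w using denseRange_toHilb.induction_on with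
    | hp => exact isClosed_eq (by fun_prop) (by fun_prop)
    | ih w =>
      induction w using TensorProduct.induction_on with
      | zero => simp
      | add v w hv hw => rw [map_add, inner_add_left, hv, hw, add_zero]
      | tmul η k' => exact h ξ k η k'
  exact inner_self_eq_zero.mp (h1 _)

/-- Slices separate the points of `B ⊗ A`. -/
theorem eq_zero_of_slice {x : B ⊗ᵐ A} (h : ∀ ω : A →L[ℂ] ℂ, slice B ω x = 0) : x = 0 := by
  refine eq_zero_of_repTensor fun p q => hilb_ext' fun ξ k η k' => ?_
  rw [← vecFun_leftSlice, apply_leftSlice, h, map_zero]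

end Slices

section Faithful

variable {B A D E F G : Type u} [NonUnitalCStarAlgebra B] [NonUnitalCStarAlgebra A]
  [NonUnitalCStarAlgebra D] [NonUnitalCStarAlgebra E]
  [NonUnitalCStarAlgebra F] [NonUnitalCStarAlgebra G]

theorem eq_zero_of_vecFun {p : HilbRep B} (hp : Function.Injective p.π) {b : B}
    (h : ∀ ξ η, vecFun p ξ η b = 0) : b = 0 :=
  (injective_iff_map_eq_zero p.π).mp hp b <| ContinuousLinearMap.ext fun ξ =>
    inner_self_eq_zero.mp (h ξ (p.π b ξ))

/-- The tensor product of faithful representations is faithful. -/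
theorem repTensor_injective {p : HilbRep B} {q : HilbRep A} (hp : Function.Injective p.π)
    (hq : Function.Injective q.π) : Function.Injective (repTensor p q) := by
  refine (injective_iff_map_eq_zero _).mpr fun x hx => eq_zero_of_slice fun ω =>
    eq_zero_of_vecFun hp fun ξ η => ?_
  rw [← apply_leftSlice, eq_zero_of_vecFun hq (b := leftSlice p ξ η x), map_zero]
  intro k k'
  rw [vecFun_leftSlice, hx, zero_apply, inner_zero_right]

/-- The composition of a representation with a `*`-homomorphism. -/
noncomputable abbrev HilbRep.comp (p : HilbRep F) (φ : D →⋆ₙₐ[ℂ] F) : HilbRep D where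
  H := p.H
  π := p.π.comp φ

theorem tensorRep_map (p : HilbRep F) (q : HilbRep G) (φ : D →⋆ₙₐ[ℂ] F) (ψ : E →⋆ₙₐ[ℂ] G)
    (x : D ⊗[ℂ] E) : tensorRep p q (TensorProduct.map (φ : D →ₗ[ℂ] F) (ψ : E →ₗ[ℂ] G) x) =
      tensorRep (p.comp φ) (q.comp ψ) x := by
  induction x using TensorProduct.induction_on with
  | zero => simp
  | add x y hx hy => simp only [map_add, hx, hy]
  | tmul d e => rfl

theorem minNorm_map_le (φ : D →⋆ₙₐ[ℂ] F) (ψ : E →⋆ₙₐ[ℂ] G) (x : D ⊗[ℂ] E) :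
    minNorm (TensorProduct.map (φ : D →ₗ[ℂ] F) (ψ : E →ₗ[ℂ] G) x) ≤ minNorm x :=
  minNorm_le (minNorm_nonneg x) fun p q => by
    rw [tensorRep_map]; exact le_minNorm _ _ x

theorem map_mul_tensor (φ : D →⋆ₙₐ[ℂ] F) (ψ : E →⋆ₙₐ[ℂ] G) (x y : D ⊗[ℂ] E) :
    TensorProduct.map (φ : D →ₗ[ℂ] F) (ψ : E →ₗ[ℂ] G) (x * y) =
      TensorProduct.map (φ : D →ₗ[ℂ] F) (ψ : E →ₗ[ℂ] G) x *
        TensorProduct.map (φ : D →ₗ[ℂ] F) (ψ : E →ₗ[ℂ] G) y := by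
  induction x using TensorProduct.induction_on with
  | zero => simp
  | add x x' hx hx' => simp only [add_mul, map_add, hx, hx']
  | tmul d e =>
    induction y using TensorProduct.induction_on with
    | zero => simp
    | add y y' hy hy' => simp only [mul_add, map_add, hy, hy']
    | tmul d' e' => simp [Algebra.TensorProduct.tmul_mul_tmul]

theorem map_star_tensor (φ : D →⋆ₙₐ[ℂ] F) (ψ : E →⋆ₙₐ[ℂ] G) (x : D ⊗[ℂ] E) :
    TensorProduct.map (φ : D →ₗ[ℂ] F) (ψ : E →ₗ[ℂ] G) (star x) =
      star (TensorProduct.map (φ : D →ₗ[ℂ] F) (ψ : E →ₗ[ℂ] G) x) := by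
  induction x using TensorProduct.induction_on with
  | zero => simp
  | add x x' hx hx' => simp only [star_add, map_add, hx, hx']
  | tmul d e => simp [map_star]

/-- `tensorMap φ ψ` as a `*`-homomorphism. -/
noncomputable def tensorHom (φ : D →⋆ₙₐ[ℂ] F) (ψ : E →⋆ₙₐ[ℂ] G) : D ⊗ᵐ E →⋆ₙₐ[ℂ] F ⊗ᵐ G :=
  minLift (toMin F G ∘ₗ TensorProduct.map (φ : D →ₗ[ℂ] F) (ψ : E →ₗ[ℂ] G))
    (fun x y => by
      simp only [LinearMap.comp_apply, map_mul_tensor, toMin_mul])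
    (fun x => by simp only [LinearMap.comp_apply, map_star_tensor, toMin_star]) (C := 1)
    fun x => by
      rw [one_mul, LinearMap.comp_apply, norm_toMin]
      exact minNorm_map_le φ ψ x

theorem tensorHom_apply (φ : D →⋆ₙₐ[ℂ] F) (ψ : E →⋆ₙₐ[ℂ] G) (x : D ⊗ᵐ E) :
    tensorHom φ ψ x = tensorMap φ ψ x := rfl

theorem tensorHom_toMin (φ : D →⋆ₙₐ[ℂ] F) (ψ : E →⋆ₙₐ[ℂ] G) (x : D ⊗[ℂ] E) :
    tensorHom φ ψ (toMin D E x) =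
      toMin F G (TensorProduct.map (φ : D →ₗ[ℂ] F) (ψ : E →ₗ[ℂ] G) x) :=
  minLift_toMin x

theorem tensorHom_tmul (φ : D →⋆ₙₐ[ℂ] F) (ψ : E →⋆ₙₐ[ℂ] G) (d : D) (e : E) :
    tensorHom φ ψ (tmul d e) = tmul (φ d) (ψ e) :=
  tensorHom_toMin φ ψ (d ⊗ₜ e)

theorem repTensor_tensorHom (p : HilbRep F) (q : HilbRep G) (φ : D →⋆ₙₐ[ℂ] F) (ψ : E →⋆ₙₐ[ℂ] G)
    (x : D ⊗ᵐ E) : repTensor p q (tensorHom φ ψ x) = repTensor (p.comp φ) (q.comp ψ) x := by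
  induction x using denseRange_toMin.induction_on with
  | hp =>
    exact isClosed_eq ((continuous_starHom _).comp (continuous_starHom _)) (continuous_starHom _)
  | ih x => rw [tensorHom_toMin, repTensor_toMin, tensorRep_map, repTensor_toMin]

theorem tensorHom_injective {φ : D →⋆ₙₐ[ℂ] F} {ψ : E →⋆ₙₐ[ℂ] G} (hφ : Function.Injective φ)
    (hψ : Function.Injective ψ) : Function.Injective (tensorHom φ ψ) := by
  obtain ⟨p, hp⟩ := exists_faithful_rep F
  obtain ⟨q, hq⟩ := exists_faithful_rep G
  have h : Function.Injective (repTensor (p.comp φ) (q.comp ψ)) :=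
    repTensor_injective (p := p.comp φ) (q := q.comp ψ) (hp.comp hφ) (hq.comp hψ)
  intro x y hxy
  apply h
  rw [← repTensor_tensorHom, ← repTensor_tensorHom, hxy]

end Faithful

section Assoc

variable {D E F : Type u} [NonUnitalCStarAlgebra D] [NonUnitalCStarAlgebra E]
  [NonUnitalCStarAlgebra F]

section Hilb

variable (H K L : Type u) [NormedAddCommGroup H] [InnerProductSpace ℂ H]
    [NormedAddCommGroup K] [InnerProductSpace ℂ K] [NormedAddCommGroup L] [InnerProductSpace ℂ L]

/-- The map `ξ ⊗ (η ⊗ ζ) ↦ (ξ ⊗ η) ⊗ ζ` into the iterated Hilbert space tensor product. -/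
noncomputable def hilbLeft : H ⊗[ℂ] (K ⊗[ℂ] L) →ₗ[ℂ] HilbTensor (HilbTensor H K) L :=
  toHilb ∘ₗ TensorProduct.map toHilb LinearMap.id ∘ₗ (TensorProduct.assoc ℂ H K L).symm.toLinearMap

/-- The map `ξ ⊗ (η ⊗ ζ) ↦ ξ ⊗ (η ⊗ ζ)` into the iterated Hilbert space tensor product. -/
noncomputable def hilbRight : H ⊗[ℂ] (K ⊗[ℂ] L) →ₗ[ℂ] HilbTensor H (HilbTensor K L) :=
  toHilb ∘ₗ TensorProduct.map LinearMap.id toHilb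

variable {H K L}

theorem norm_hilbLeft (v : H ⊗[ℂ] (K ⊗[ℂ] L)) : ‖hilbLeft H K L v‖ = ‖v‖ := by
  have h := TensorProduct.norm_map
    (Completion.toComplₗᵢ (𝕜 := ℂ) (E := H ⊗[ℂ] K)) (LinearIsometry.id (R := ℂ) (E := L))
    ((TensorProduct.assocIsometry ℂ H K L).symm v)
  rw [LinearIsometryEquiv.norm_map] at h
  rw [← h]
  exact Completion.norm_coe (E := HilbTensor H K ⊗[ℂ] L) _

theorem norm_hilbRight (v : H ⊗[ℂ] (K ⊗[ℂ] L)) : ‖hilbRight H K L v‖ = ‖v‖ := by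
  have h := TensorProduct.norm_map
    (LinearIsometry.id (R := ℂ) (E := H)) (Completion.toComplₗᵢ (𝕜 := ℂ) (E := K ⊗[ℂ] L)) v
  rw [← h]
  exact Completion.norm_coe (E := H ⊗[ℂ] HilbTensor K L) _

theorem denseRange_hilbLeft : DenseRange (hilbLeft H K L) := by
  have h1 : ∀ v : HilbTensor (HilbTensor H K) L,
      v ∈ (LinearMap.range (hilbLeft H K L)).topologicalClosure := fun v => by
    induction v using denseRange_toHilb.induction_on with
    | hp => exact Submodule.isClosed_topologicalClosure _
    | ih v =>
      induction v using TensorProduct.induction_on with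
      | zero => rw [map_zero]; exact zero_mem _
      | add v w hv hw => rw [map_add]; exact add_mem hv hw
      | tmul v ζ =>
        induction v using denseRange_toHilb.induction_on with
        | hp =>
          refine (Submodule.isClosed_topologicalClosure _).preimage ?_
          refine (Completion.continuous_coe (HilbTensor H K ⊗[ℂ] L)).comp ?_
          exact TensorProduct.continuous_tmul.comp (by fun_prop : Continuous fun v => (v, ζ))
        | ih v =>
          refine Submodule.le_topologicalClosure _ ⟨TensorProduct.assoc ℂ H K L (v ⊗ₜ ζ), ?_⟩
          simp [hilbLeft]
  exact fun v => h1 v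

end Hilb

/-- The representation `p ⊗ q` of `D ⊗ E`. -/
noncomputable abbrev HilbRep.tensor (p : HilbRep D) (q : HilbRep E) : HilbRep (D ⊗ᵐ E) where
  H := HilbTensor p.H q.H
  π := repTensor p q

variable (D E F) in
/-- The map `d ⊗ (e ⊗ f) ↦ (d ⊗ e) ⊗ f` on the algebraic tensor product. -/
noncomputable def assocLeft : D ⊗[ℂ] (E ⊗[ℂ] F) →ₗ[ℂ] (D ⊗ᵐ E) ⊗ᵐ F :=
  toMin (D ⊗ᵐ E) F ∘ₗ TensorProduct.map (toMin D E) LinearMap.id ∘ₗ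
    (TensorProduct.assoc ℂ D E F).symm.toLinearMap

variable (D E F) in
/-- The map `d ⊗ (e ⊗ f) ↦ d ⊗ (e ⊗ f)` on the algebraic tensor product. -/
noncomputable def assocRight : D ⊗[ℂ] (E ⊗[ℂ] F) →ₗ[ℂ] D ⊗ᵐ (E ⊗ᵐ F) :=
  toMin D (E ⊗ᵐ F) ∘ₗ TensorProduct.map LinearMap.id (toMin E F)

theorem assocLeft_tmul (d : D) (e : E) (f : F) :
    assocLeft D E F (d ⊗ₜ (e ⊗ₜ f)) = tmul (tmul d e) f := by simp [assocLeft, tmul]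

theorem assocRight_tmul (d : D) (e : E) (f : F) :
    assocRight D E F (d ⊗ₜ (e ⊗ₜ f)) = tmul d (tmul e f) := by simp [assocRight, tmul]

theorem exists_hilbLeft_hilbRight (p : HilbRep D) (q : HilbRep E) (r : HilbRep F)
    (x : D ⊗[ℂ] (E ⊗[ℂ] F)) (v : p.H ⊗[ℂ] (q.H ⊗[ℂ] r.H)) :
    ∃ w, repTensor (p.tensor q) r (assocLeft D E F x) (hilbLeft p.H q.H r.H v) = hilbLeft _ _ _ w ∧
      repTensor p (q.tensor r) (assocRight D E F x) (hilbRight p.H q.H r.H v) =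
        hilbRight _ _ _ w := by
  induction x using TensorProduct.induction_on with
  | zero => exact ⟨0, by simp⟩
  | add x y hx hy =>
    obtain ⟨w, h1, h2⟩ := hx
    obtain ⟨w', h1', h2'⟩ := hy
    exact ⟨w + w', by simp only [map_add, add_apply, h1, h1'],
      by simp only [map_add, add_apply, h2, h2']⟩
  | tmul d y =>
  induction y using TensorProduct.induction_on with
  | zero => exact ⟨0, by simp⟩
  | add x y hx hy =>
    obtain ⟨w, h1, h2⟩ := hx
    obtain ⟨w', h1', h2'⟩ := hy
    exact ⟨w + w', by simp only [TensorProduct.tmul_add, map_add, add_apply, h1, h1'],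
      by simp only [TensorProduct.tmul_add, map_add, add_apply, h2, h2']⟩
  | tmul e f =>
  induction v using TensorProduct.induction_on with
  | zero => exact ⟨0, by simp⟩
  | add x y hx hy =>
    obtain ⟨w, h1, h2⟩ := hx
    obtain ⟨w', h1', h2'⟩ := hy
    exact ⟨w + w', by simp only [map_add, h1, h1'], by simp only [map_add, h2, h2']⟩
  | tmul ξ v =>
  induction v using TensorProduct.induction_on with
  | zero => exact ⟨0, by simp⟩
  | add x y hx hy =>
    obtain ⟨w, h1, h2⟩ := hx
    obtain ⟨w', h1', h2'⟩ := hy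
    exact ⟨w + w', by simp only [TensorProduct.tmul_add, map_add, h1, h1'],
      by simp only [TensorProduct.tmul_add, map_add, h2, h2']⟩
  | tmul η ζ =>
  refine ⟨p.π d ξ ⊗ₜ (q.π e η ⊗ₜ r.π f ζ), ?_, ?_⟩
  · rw [assocLeft_tmul, tmul, repTensor_toMin, tensorRep_tmul]
    change opTensor (repTensor p q (toMin D E (d ⊗ₜ e))) (r.π f)
      (toHilb (toHilb (ξ ⊗ₜ η) ⊗ₜ ζ)) = toHilb (toHilb (p.π d ξ ⊗ₜ q.π e η) ⊗ₜ r.π f ζ)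
    rw [opTensor_tmul, repTensor_toMin, tensorRep_tmul, opTensor_tmul]
  · rw [assocRight_tmul, tmul, repTensor_toMin, tensorRep_tmul]
    change opTensor (p.π d) (repTensor q r (toMin E F (e ⊗ₜ f)))
      (toHilb (ξ ⊗ₜ toHilb (η ⊗ₜ ζ))) = toHilb (p.π d ξ ⊗ₜ toHilb (q.π e η ⊗ₜ r.π f ζ))
    rw [opTensor_tmul, repTensor_toMin, tensorRep_tmul, opTensor_tmul]

theorem norm_assocLeft_le (x : D ⊗[ℂ] (E ⊗[ℂ] F)) :
    ‖assocLeft D E F x‖ ≤ 1 * ‖assocRight D E F x‖ := by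
  obtain ⟨p, hp⟩ := exists_faithful_rep D
  obtain ⟨q, hq⟩ := exists_faithful_rep E
  obtain ⟨r, hr⟩ := exists_faithful_rep F
  have h1 : Function.Injective (repTensor (p.tensor q) r) :=
    repTensor_injective (repTensor_injective hp hq) hr
  rw [one_mul, ← NonUnitalStarAlgHom.norm_map _ h1]
  refine le_trans ?_ (NonUnitalStarAlgHom.norm_apply_le (repTensor p (q.tensor r)) _)
  refine ContinuousLinearMap.opNorm_le_bound _ (norm_nonneg _) fun v => ?_
  refine (denseRange_hilbLeft (H := p.H) (K := q.H) (L := r.H)).induction_on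
    (p := fun v : HilbTensor (HilbTensor p.H q.H) r.H =>
      ‖repTensor (p.tensor q) r (assocLeft D E F x) v‖ ≤
        ‖repTensor p (q.tensor r) (assocRight D E F x)‖ * ‖v‖) v
    (isClosed_le (by fun_prop) (by fun_prop)) fun v => ?_
  obtain ⟨w, h1, h2⟩ := exists_hilbLeft_hilbRight p q r x v
  rw [h1, norm_hilbLeft, norm_hilbLeft, ← norm_hilbRight, ← norm_hilbRight (v := v), ← h2]
  exact ContinuousLinearMap.le_opNorm _ _

theorem denseRange_assocRight : DenseRange (assocRight D E F) := by
  have h1 : ∀ v, v ∈ (LinearMap.range (assocRight D E F)).topologicalClosure := fun v => by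
    refine induction_tmul (p := fun v => v ∈ (LinearMap.range (assocRight D E F)).topologicalClosure)
      (Submodule.isClosed_topologicalClosure _)
      (fun _ _ h h' => add_mem h h')
      (fun d y => ?_) v
    refine induction_tmul (p := fun y => tmul d y ∈ _) ?_ (fun y y' h h' => ?_) (fun e f => ?_) y
    · refine (Submodule.isClosed_topologicalClosure _).preimage ?_
      exact continuous_tmul_right d
    · rw [tmul_add_right]; exact add_mem h h'
    · exact Submodule.le_topologicalClosure _ ⟨_, assocRight_tmul d e f⟩
  exact fun v => h1 v

theorem assoc_assocRight (x : D ⊗[ℂ] (E ⊗[ℂ] F)) :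
    assoc D E F (assocRight D E F x) = assocLeft D E F x :=
  LinearMap.extendOfNorm_eq denseRange_assocRight ⟨1, norm_assocLeft_le⟩ x

theorem assoc_tmul (d : D) (e : E) (f : F) :
    assoc D E F (tmul d (tmul e f)) = tmul (tmul d e) f := by
  rw [← assocRight_tmul, assoc_assocRight, assocLeft_tmul]

/-- Induction on the triple tensor product. -/
theorem induction_tmul₃ {p : D ⊗ᵐ (E ⊗ᵐ F) → Prop} (hclosed : IsClosed {x | p x})
    (hadd : ∀ x y, p x → p y → p (x + y)) (htmul : ∀ d e f, p (tmul d (tmul e f)))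
    (x : D ⊗ᵐ (E ⊗ᵐ F)) : p x := by
  refine induction_tmul hclosed hadd (fun d y => ?_) x
  refine induction_tmul (p := fun y => p (tmul d y)) ?_ (fun y y' h h' => ?_) (htmul d) y
  · exact hclosed.preimage (continuous_tmul_right d)
  · rw [tmul_add_right]; exact hadd _ _ h h'

variable (D E F) in
/-- `assoc` as a `*`-homomorphism. -/
noncomputable def assocHom : D ⊗ᵐ (E ⊗ᵐ F) →⋆ₙₐ[ℂ] (D ⊗ᵐ E) ⊗ᵐ F where
  toFun := assoc D E F
  map_smul' := map_smul _
  map_zero' := map_zero _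
  map_add' := map_add _
  map_mul' x y := by
    refine induction_tmul₃ (p := fun x => assoc D E F (x * y) = assoc D E F x * assoc D E F y)
      (isClosed_eq (by fun_prop) (by fun_prop)) (fun x x' h h' => ?_) (fun d e f => ?_) x
    · rw [add_mul, map_add, h, h', map_add, add_mul]
    refine induction_tmul₃ (p := fun y => assoc D E F (_ * y) = _ * assoc D E F y)
      (isClosed_eq (by fun_prop) (by fun_prop)) (fun y y' h h' => ?_) (fun d' e' f' => ?_) y
    · rw [mul_add, map_add, h, h', map_add, mul_add]
    simp only [tmul_mul_tmul, assoc_tmul]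
  map_star' x := by
    refine induction_tmul₃ (p := fun x => assoc D E F (star x) = star (assoc D E F x))
      (isClosed_eq (by fun_prop) (by fun_prop)) (fun x x' h h' => ?_) (fun d e f => ?_) x
    · rw [star_add, map_add, h, h', map_add, star_add]
    simp only [star_tmul, assoc_tmul]

theorem assocHom_tmul (d : D) (e : E) (f : F) :
    assocHom D E F (tmul d (tmul e f)) = tmul (tmul d e) f := assoc_tmul d e f

theorem denseRange_assocHom : DenseRange (assocHom D E F) := by
  have h1 : ∀ v, v ∈ (LinearMap.range (assoc D E F).toLinearMap).topologicalClosure := fun v => by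
    refine induction_tmul
      (p := fun v => v ∈ (LinearMap.range (assoc D E F).toLinearMap).topologicalClosure)
      (Submodule.isClosed_topologicalClosure _)
      (fun _ _ h h' => add_mem h h')
      (fun y f => ?_) v
    refine induction_tmul (p := fun y => tmul y f ∈ _) ?_ (fun y y' h h' => ?_) (fun d e => ?_) y
    · refine (Submodule.isClosed_topologicalClosure _).preimage ?_
      exact continuous_tmul_left f
    · rw [tmul_add_left]; exact add_mem h h'
    · exact Submodule.le_topologicalClosure _ ⟨_, assoc_tmul d e f⟩
  exact fun v => h1 v

end Assoc

section Range

variable {D E : Type*} [NonUnitalCStarAlgebra D] [NonUnitalCStarAlgebra E]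

theorem exists_lift_of_isSelfAdjoint (φ : D →⋆ₙₐ[ℂ] E) {h : D} (hh : IsSelfAdjoint h) :
    ∃ h', φ h' = φ h ∧ ‖h'‖ ≤ ‖φ h‖ := by
  set M := ‖φ h‖
  have hM : 0 ≤ M := norm_nonneg _
  set g : ℝ → ℝ := fun t => max (-M) (min t M)
  have hg : Continuous g := by fun_prop
  have hg0 : g 0 = 0 := by simp [g, hM]
  refine ⟨cfcₙ g h, ?_, ?_⟩
  · rw [NonUnitalStarAlgHomClass.map_cfcₙ (R := ℝ) (S := ℂ) φ g h hg.continuousOn hg0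
      (continuous_starHom φ) hh (hh.map φ)]
    conv_rhs => rw [← cfcₙ_id' ℝ (φ h) (hh.map φ)]
    refine cfcₙ_congr fun t ht => ?_
    have h1 : ‖t‖ ≤ M := by
      have := norm_apply_le_norm_cfcₙ (fun x : ℝ => x) (φ h) ht
      rwa [cfcₙ_id' ℝ (φ h) (hh.map φ)] at this
    rw [Real.norm_eq_abs, abs_le] at h1
    simp [g, h1.1, h1.2]
  · refine norm_cfcₙ_le fun t _ => ?_
    rw [Real.norm_eq_abs, abs_le]
    exact ⟨le_max_left _ _, max_le (by linarith) (min_le_right _ _)⟩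

/-- Elements of the range of a `*`-homomorphism have preimages of controlled norm. -/
theorem exists_lift_le (φ : D →⋆ₙₐ[ℂ] E) (d : D) : ∃ d', φ d' = φ d ∧ ‖d'‖ ≤ 2 * ‖φ d‖ := by
  obtain ⟨h, h1, h2⟩ := exists_lift_of_isSelfAdjoint φ (realPart d).2
  obtain ⟨k, k1, k2⟩ := exists_lift_of_isSelfAdjoint φ (imaginaryPart d).2
  refine ⟨h + Complex.I • k, ?_, ?_⟩
  · rw [map_add, map_smul, h1, k1, ← map_smul, ← map_add, realPart_add_I_smul_imaginaryPart]
  · have e1 : φ (realPart d : D) = realPart (φ d) := by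
      simp [realPart_apply_coe, ← Complex.coe_smul, map_smul, map_add, map_star]
    have e2 : φ (imaginaryPart d : D) = imaginaryPart (φ d) := by
      simp [imaginaryPart_apply_coe, ← Complex.coe_smul, map_smul, map_sub, map_star]
    have b1 : ‖h‖ ≤ ‖φ d‖ := h2.trans (by rw [e1]; exact realPart.norm_le (φ d))
    have b2 : ‖k‖ ≤ ‖φ d‖ := k2.trans (by rw [e2]; exact imaginaryPart.norm_le (φ d))
    refine (norm_add_le _ _).trans ?_
    rw [norm_smul, Complex.norm_I, one_mul]
    linarith

theorem isClosed_range_starHom (φ : D →⋆ₙₐ[ℂ] E) : IsClosed (Set.range φ) := by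
  let f : NormedAddGroupHom D E :=
    { toFun := φ
      map_add' := map_add φ
      bound' := ⟨1, fun x => by rw [one_mul]; exact NonUnitalStarAlgHom.norm_apply_le φ x⟩ }
  have h1 : f.SurjectiveOnWith f.range 2 := by
    rintro _ ⟨d, rfl⟩
    exact exists_lift_le φ d
  have h2 := controlled_closure_of_complete two_pos one_pos h1
  refine isClosed_of_closure_subset fun x hx => ?_
  obtain ⟨d, hd, -⟩ := h2 x hx
  exact ⟨d, hd⟩

end Range

section Mult

variable {D E F G A : Type u} [NonUnitalCStarAlgebra D] [NonUnitalCStarAlgebra E]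
  [NonUnitalCStarAlgebra F] [NonUnitalCStarAlgebra G] [NonUnitalCStarAlgebra A]

theorem eq_of_forall_mul_left {x y : D} (h : ∀ z, z * x = z * y) : x = y := by
  rw [← sub_eq_zero, ← CStarRing.star_mul_self_eq_zero_iff, mul_sub, h, sub_self]

theorem eq_of_forall_mul_right {x y : D} (h : ∀ z, x * z = y * z) : x = y := by
  rw [← sub_eq_zero, ← CStarRing.mul_star_self_eq_zero_iff, sub_mul, h, sub_self]

theorem fst_mul (m : 𝓜(ℂ, D)) (x y : D) : m.fst (x * y) = m.fst x * y :=
  eq_of_forall_mul_left fun z => by rw [← m.central, ← mul_assoc, m.central, mul_assoc]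

theorem mult_ext_fst {m n : 𝓜(ℂ, D)} (h : ∀ x, m.fst x = n.fst x) : m = n :=
  DoubleCentralizer.ext _ _ _ _ <| Prod.ext (ContinuousLinearMap.ext h) <|
    ContinuousLinearMap.ext fun x => eq_of_forall_mul_right fun z => by
      rw [m.central, n.central, h]

theorem incl_fst (d x : D) : (incl D d).fst x = d * x := rfl

theorem incl_snd (d x : D) : (incl D d).snd x = x * d := rfl

theorem mult_mul_fst (m n : 𝓜(ℂ, D)) (x : D) : (m * n).fst x = m.fst (n.fst x) := rfl

theorem mult_mul_snd (m n : 𝓜(ℂ, D)) (x : D) : (m * n).snd x = n.snd (m.snd x) := rfl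

theorem incl_injective : Function.Injective (incl D) := fun x y h =>
  eq_of_forall_mul_right fun z => by rw [← incl_fst, h, incl_fst]

theorem norm_incl (d : D) : ‖incl D d‖ = ‖d‖ := NonUnitalStarAlgHom.norm_map _ incl_injective d

theorem mult_mul_incl (m : 𝓜(ℂ, D)) (d : D) : m * incl D d = incl D (m.fst d) :=
  mult_ext_fst fun x => by rw [mult_mul_fst, incl_fst, fst_mul, incl_fst]

theorem norm_fst_apply_le (m : 𝓜(ℂ, D)) (x : D) : ‖m.fst x‖ ≤ ‖m‖ * ‖x‖ := by
  rw [← DoubleCentralizer.norm_fst]; exact m.fst.le_opNorm x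

theorem mtmul_mul (m m' : 𝓜(ℂ, D)) (n n' : 𝓜(ℂ, E)) :
    mtmul (m * m') (n * n') = mtmul m n * mtmul m' n' :=
  mult_ext (fun d e => by simp only [mult_mul_fst, mtmul_fst_tmul])
    (fun d e => by simp only [mult_mul_snd, mtmul_snd_tmul])

theorem mtmul_star (m : 𝓜(ℂ, D)) (n : 𝓜(ℂ, E)) :
    mtmul (star m) (star n) = star (mtmul m n) :=
  mult_ext
    (fun d e => by
      simp only [mtmul_fst_tmul, DoubleCentralizer.star_fst, star_tmul, mtmul_snd_tmul])
    (fun d e => by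
      simp only [mtmul_snd_tmul, DoubleCentralizer.star_snd, star_tmul, mtmul_fst_tmul])

/-- The linear extension of `m ⊗ n ↦ mtmul m n`. -/
noncomputable def multLift : 𝓜(ℂ, F) ⊗[ℂ] 𝓜(ℂ, G) →ₗ[ℂ] 𝓜(ℂ, F ⊗ᵐ G) :=
  TensorProduct.lift mtmulBilin

theorem multLift_tmul (m : 𝓜(ℂ, F)) (n : 𝓜(ℂ, G)) : multLift (m ⊗ₜ n) = mtmul m n := rfl

theorem tensorHom_multLift_fst (y : 𝓜(ℂ, F) ⊗[ℂ] 𝓜(ℂ, G)) (x : F ⊗ᵐ G) :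
    tensorHom (incl F) (incl G) ((multLift y).fst x) =
      toMin _ _ y * tensorHom (incl F) (incl G) x := by
  induction y using TensorProduct.induction_on with
  | zero => simp
  | add y y' h h' =>
    rw [map_add, DoubleCentralizer.add_fst, add_apply, map_add, h, h', map_add, add_mul]
  | tmul m n =>
    refine induction_tmul (p := fun x => tensorHom (incl F) (incl G) ((multLift (m ⊗ₜ n)).fst x) =
      toMin _ _ (m ⊗ₜ n) * tensorHom (incl F) (incl G) x) ?_ (fun x x' h h' => ?_)
      (fun f g => ?_) x
    · exact isClosed_eq ((continuous_starHom _).comp (ContinuousLinearMap.continuous _))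
        ((continuous_starHom _).const_mul _)
    · rw [map_add, map_add, h, h', map_add, mul_add]
    · rw [multLift_tmul, mtmul_fst_tmul, tensorHom_tmul, tensorHom_tmul, ← mult_mul_incl,
        ← mult_mul_incl, ← tmul_mul_tmul]
      rfl

theorem norm_multLift_le (y : 𝓜(ℂ, F) ⊗[ℂ] 𝓜(ℂ, G)) : ‖multLift y‖ ≤ minNorm y := by
  rw [← DoubleCentralizer.norm_fst]
  refine ContinuousLinearMap.opNorm_le_bound _ (minNorm_nonneg y) fun x => ?_
  have h := tensorHom_injective (incl_injective (D := F)) (incl_injective (D := G))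
  rw [← NonUnitalStarAlgHom.norm_map _ h, tensorHom_multLift_fst]
  refine (norm_mul_le _ _).trans ?_
  rw [norm_toMin, NonUnitalStarAlgHom.norm_map _ h]

theorem multLift_mul (x y : 𝓜(ℂ, F) ⊗[ℂ] 𝓜(ℂ, G)) :
    multLift (x * y) = multLift x * multLift y := by
  induction x using TensorProduct.induction_on with
  | zero => simp
  | add x x' hx hx' => simp only [add_mul, map_add, hx, hx']
  | tmul d e =>
    induction y using TensorProduct.induction_on with
    | zero => simp
    | add y y' hy hy' => simp only [mul_add, map_add, hy, hy']
    | tmul d' e' => rw [Algebra.TensorProduct.tmul_mul_tmul]; exact mtmul_mul _ _ _ _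

theorem multLift_star (x : 𝓜(ℂ, F) ⊗[ℂ] 𝓜(ℂ, G)) : multLift (star x) = star (multLift x) := by
  induction x using TensorProduct.induction_on with
  | zero => simp
  | add x x' hx hx' => simp only [star_add, map_add, hx, hx']
  | tmul d e => rw [TensorProduct.star_tmul]; exact mtmul_star _ _

theorem lift_eq_multLift (φ : D →⋆ₙₐ[ℂ] 𝓜(ℂ, F)) (ψ : E →⋆ₙₐ[ℂ] 𝓜(ℂ, G)) (x : D ⊗[ℂ] E) :
    TensorProduct.lift (mtmulBilin.compl₁₂ (φ : D →ₗ[ℂ] 𝓜(ℂ, F)) (ψ : E →ₗ[ℂ] 𝓜(ℂ, G))) x =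
      multLift (TensorProduct.map (φ : D →ₗ[ℂ] 𝓜(ℂ, F)) (ψ : E →ₗ[ℂ] 𝓜(ℂ, G)) x) := by
  induction x using TensorProduct.induction_on with
  | zero => simp
  | add x y hx hy => rw [map_add, hx, hy, map_add, map_add]
  | tmul d e => rfl

/-- `homTensor φ ψ` as a `*`-homomorphism. -/
noncomputable def multHom (φ : D →⋆ₙₐ[ℂ] 𝓜(ℂ, F)) (ψ : E →⋆ₙₐ[ℂ] 𝓜(ℂ, G)) :
    D ⊗ᵐ E →⋆ₙₐ[ℂ] 𝓜(ℂ, F ⊗ᵐ G) :=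
  minLift (TensorProduct.lift (mtmulBilin.compl₁₂ (φ : D →ₗ[ℂ] 𝓜(ℂ, F))
    (ψ : E →ₗ[ℂ] 𝓜(ℂ, G))))
    (fun x y => by simp only [lift_eq_multLift, map_mul_tensor, multLift_mul])
    (fun x => by simp only [lift_eq_multLift, map_star_tensor, multLift_star]) (C := 1)
    fun x => by
      rw [one_mul, lift_eq_multLift]
      exact (norm_multLift_le _).trans (minNorm_map_le φ ψ x)

theorem multHom_tmul (φ : D →⋆ₙₐ[ℂ] 𝓜(ℂ, F)) (ψ : E →⋆ₙₐ[ℂ] 𝓜(ℂ, G)) (d : D) (e : E) :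
    multHom φ ψ (tmul d e) = mtmul (φ d) (ψ e) :=
  minLift_toMin (d ⊗ₜ e)

theorem incl_tmul (d : D) (e : E) : incl _ (tmul d e) = mtmul (incl D d) (incl E e) :=
  mult_ext (fun d' e' => by rw [incl_fst, tmul_mul_tmul, mtmul_fst_tmul]; rfl)
    (fun d' e' => by rw [incl_snd, tmul_mul_tmul, mtmul_snd_tmul]; rfl)

theorem multHom_incl_incl (x : D ⊗ᵐ E) : multHom (incl D) (incl E) x = incl _ x := by
  refine induction_tmul (p := fun x => multHom (incl D) (incl E) x = incl _ x)
    (isClosed_eq (continuous_starHom _) (continuous_starHom _)) (fun x y h h' => ?_)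
    (fun d e => ?_) x
  · rw [map_add, h, h', map_add]
  · rw [multHom_tmul, incl_tmul]

/-- The map `x ↦ f(x) d` from `D` to `F`. -/
noncomputable def evalFst (f : D →⋆ₙₐ[ℂ] 𝓜(ℂ, F)) (d : F) : D →ₗ[ℂ] F where
  toFun x := (f x).fst d
  map_add' x y := by rw [map_add]; rfl
  map_smul' c x := by rw [map_smul]; rfl

theorem multHom_toMin_mul (f : D →⋆ₙₐ[ℂ] 𝓜(ℂ, F)) (d : F) (x : D ⊗[ℂ] A) :
    multHom f (incl A) (toMin D A x) * mtmul (incl F d) 1 =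
      incl _ (toMin F A (TensorProduct.map (evalFst f d) LinearMap.id x)) := by
  induction x using TensorProduct.induction_on with
  | zero => simp
  | add x y hx hy => simp only [map_add, add_mul, hx, hy]
  | tmul e a =>
    have h : multHom f (incl A) (toMin D A (e ⊗ₜ a)) = mtmul (f e) (incl A a) :=
      multHom_tmul _ _ e a
    rw [h, ← mtmul_mul, mul_one, mult_mul_incl, ← incl_tmul]
    rfl

theorem norm_evalFst_map_le (f : D →⋆ₙₐ[ℂ] 𝓜(ℂ, F)) (d : F) (x : D ⊗[ℂ] A) :
    ‖(toMin F A ∘ₗ TensorProduct.map (evalFst f d) LinearMap.id) x‖ ≤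
      ‖mtmul (incl F d) (1 : 𝓜(ℂ, A))‖ * minNorm x := by
  rw [LinearMap.comp_apply, ← norm_incl, ← multHom_toMin_mul, mul_comm, ← norm_toMin]
  exact (norm_mul_le _ _).trans
    (mul_le_mul_of_nonneg_right (NonUnitalStarAlgHom.norm_apply_le _ _) (norm_nonneg _))

/-- The map `y ↦ (f ⊗ id)(y) (d ⊗ 1)` from `D ⊗ A` to `F ⊗ A`. -/
noncomputable def multApply (f : D →⋆ₙₐ[ℂ] 𝓜(ℂ, F)) (d : F) : D ⊗ᵐ A →L[ℂ] F ⊗ᵐ A :=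
  (toMin F A ∘ₗ TensorProduct.map (evalFst f d) LinearMap.id).extendOfNorm (toMin D A)

theorem multApply_tmul (f : D →⋆ₙₐ[ℂ] 𝓜(ℂ, F)) (d : F) (e : D) (a : A) :
    multApply f d (tmul e a) = tmul ((f e).fst d) a :=
  extendOfNorm_toMin (norm_evalFst_map_le f d) (e ⊗ₜ a)

theorem multHom_mul_eq_incl (f : D →⋆ₙₐ[ℂ] 𝓜(ℂ, F)) (d : F) (y : D ⊗ᵐ A) :
    multHom f (incl A) y * mtmul (incl F d) 1 = incl _ (multApply f d y) := by
  refine induction_tmul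
    (p := fun y => multHom f (incl A) y * mtmul (incl F d) 1 = incl _ (multApply f d y))
    (isClosed_eq ((continuous_starHom _).mul_const _)
      ((continuous_starHom _).comp (ContinuousLinearMap.continuous _)))
    (fun x y h h' => ?_) (fun e a => ?_) y
  · rw [map_add, add_mul, h, h', map_add, map_add]
  · rw [multApply_tmul, incl_tmul, multHom_tmul, ← mtmul_mul, mul_one, mult_mul_incl]

theorem slice_multApply (υ : A →L[ℂ] ℂ) (f : D →⋆ₙₐ[ℂ] 𝓜(ℂ, F)) (d : F) (y : D ⊗ᵐ A) :
    slice F υ (multApply f d y) = (f (slice D υ y)).fst d := by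
  have hc : Continuous fun x => (f x).fst d := by
    refine AddMonoidHomClass.continuous_of_bound (evalFst f d) ‖d‖ fun x => ?_
    refine (norm_fst_apply_le _ _).trans ?_
    rw [mul_comm]
    exact mul_le_mul_of_nonneg_left (NonUnitalStarAlgHom.norm_apply_le f x) (norm_nonneg _)
  refine induction_tmul
    (p := fun y => slice F υ (multApply f d y) = (f (slice D υ y)).fst d)
    (isClosed_eq (by fun_prop) (hc.comp (ContinuousLinearMap.continuous _)))
    (fun x y h h' => ?_) (fun e a => ?_) y
  · rw [map_add, map_add, h, h', map_add, map_add]; rfl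
  · rw [multApply_tmul, slice_tmul, slice_tmul, map_smul]; rfl

/-- If `f` is injective, then so is `f ⊗ id : D ⊗ A → M(F ⊗ A)`. -/
theorem multHom_injective {f : D →⋆ₙₐ[ℂ] 𝓜(ℂ, F)} (hf : Function.Injective f) :
    Function.Injective (multHom f (incl A)) := by
  refine (injective_iff_map_eq_zero _).mpr fun y hy => eq_zero_of_slice fun υ =>
    (injective_iff_map_eq_zero f).mp hf _ <| mult_ext_fst fun d => ?_
  have h := multHom_mul_eq_incl f d y
  rw [hy, zero_mul, eq_comm] at h
  rw [← slice_multApply, (injective_iff_map_eq_zero _).mp incl_injective _ h, map_zero]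
  rfl

/-- If `(f ⊗ id)(y) = T (1 ⊗ a)`, then `(f ⊗ id)(y) (d ⊗ 1) = T (d ⊗ a)`. -/
theorem multApply_eq {f : D →⋆ₙₐ[ℂ] 𝓜(ℂ, F)} {y : D ⊗ᵐ A} {T : 𝓜(ℂ, F ⊗ᵐ A)} {a : A}
    (h : multHom f (incl A) y = T * mtmul 1 (incl A a)) (d : F) :
    multApply f d y = T.fst (tmul d a) := by
  apply incl_injective
  rw [← multHom_mul_eq_incl, h, mul_assoc, ← mtmul_mul, one_mul, mul_one, ← incl_tmul,
    mult_mul_incl]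

theorem slice_fst_tmul {f : D →⋆ₙₐ[ℂ] 𝓜(ℂ, F)} {y : D ⊗ᵐ A} {T : 𝓜(ℂ, F ⊗ᵐ A)} {a : A}
    (h : multHom f (incl A) y = T * mtmul 1 (incl A a)) (υ : A →L[ℂ] ℂ) (d : F) :
    slice F υ (T.fst (tmul d a)) = (f (slice D υ y)).fst d := by
  rw [← multApply_eq h, slice_multApply]

/-- Naturality of slicing. -/
theorem map_slice (φ : D →⋆ₙₐ[ℂ] F) (υ : A →L[ℂ] ℂ) (y : D ⊗ᵐ A) :
    φ (slice D υ y) = slice F υ (tensorHom φ (NonUnitalStarAlgHom.id ℂ A) y) := by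
  refine induction_tmul
    (p := fun y => φ (slice D υ y) = slice F υ (tensorHom φ (NonUnitalStarAlgHom.id ℂ A) y))
    (isClosed_eq ((continuous_starHom _).comp (ContinuousLinearMap.continuous _))
      ((ContinuousLinearMap.continuous _).comp (continuous_starHom _)))
    (fun x y h h' => ?_) (fun e a => ?_) y
  · rw [map_add, map_add, h, h', map_add, map_add]
  · rw [slice_tmul, map_smul, tensorHom_tmul, slice_tmul]; rfl

/-- Naturality of `f ⊗ id`. -/
theorem multHom_comp (f : D →⋆ₙₐ[ℂ] E) (g : E →⋆ₙₐ[ℂ] 𝓜(ℂ, F)) (y : D ⊗ᵐ A) :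
    multHom g (incl A) (tensorHom f (NonUnitalStarAlgHom.id ℂ A) y) =
      multHom (g.comp f) (incl A) y := by
  refine induction_tmul
    (p := fun y => multHom g (incl A) (tensorHom f (NonUnitalStarAlgHom.id ℂ A) y) =
      multHom (g.comp f) (incl A) y)
    (isClosed_eq ((continuous_starHom _).comp (continuous_starHom _)) (continuous_starHom _))
    (fun x y h h' => ?_) (fun e a => ?_) y
  · rw [map_add, map_add, h, h', map_add]
  · rw [tensorHom_tmul, multHom_tmul, multHom_tmul]; rfl

end Mult

open Filter

section ApproxUnit

variable {D E A : Type u} [NonUnitalCStarAlgebra D] [NonUnitalCStarAlgebra E]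
  [NonUnitalCStarAlgebra A]

/-- An approximate unit in the closed unit ball. -/
structure IsContractiveUnit (l : Filter D) : Prop where
  neBot : l.NeBot
  norm_le : ∀ᶠ e in l, ‖e‖ ≤ 1
  right : ∀ x, Tendsto (fun e => x * e) l (𝓝 x)
  left : ∀ x, Tendsto (fun e => e * x) l (𝓝 x)

variable (D) in
theorem exists_contractiveUnit : ∃ l : Filter D, IsContractiveUnit l := by
  let _ : PartialOrder D := CStarAlgebra.spectralOrder D
  have : StarOrderedRing D := CStarAlgebra.spectralOrderedRing D
  have h := CStarAlgebra.increasingApproximateUnit D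
  exact ⟨_, h.neBot, h.eventually_norm, h.tendsto_mul_left, h.tendsto_mul_right⟩

variable (D) in
/-- A fixed contractive approximate unit. -/
noncomputable def contrUnit : Filter D := (exists_contractiveUnit D).choose

theorem isContractiveUnit_contrUnit : IsContractiveUnit (contrUnit D) :=
  (exists_contractiveUnit D).choose_spec

instance : (contrUnit D).NeBot := isContractiveUnit_contrUnit.neBot

theorem isClosed_setOf_tendsto {ι X Y : Type*} [NormedAddCommGroup X] [NormedSpace ℂ X]
    [NormedAddCommGroup Y] [NormedSpace ℂ Y] {l : Filter ι} {T : ι → X →L[ℂ] Y} {S : X →L[ℂ] Y}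
    {C : ℝ} (hC : ∀ᶠ i in l, ‖T i‖ ≤ C) : IsClosed {x | Tendsto (fun i => T i x) l (𝓝 (S x))} := by
  refine isClosed_of_closure_subset fun x hx => ?_
  refine Metric.tendsto_nhds.mpr fun ε hε => ?_
  set K := |C| + ‖S‖ + 1
  have hK : 0 < K := by positivity
  obtain ⟨y, hy, hxy⟩ := Metric.mem_closure_iff.mp hx (ε / (2 * K)) (by positivity)
  filter_upwards [hC, Metric.tendsto_nhds.mp hy (ε / 2) (half_pos hε)] with i h1 h2
  rw [dist_eq_norm] at *
  have e1 : T i x - S x = (T i (x - y) - S (x - y)) + (T i y - S y) := by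
    simp only [map_sub]; abel
  have e2 : ‖T i (x - y)‖ ≤ |C| * ‖x - y‖ := ((T i).le_opNorm _).trans
    (mul_le_mul_of_nonneg_right (h1.trans (le_abs_self C)) (norm_nonneg _))
  have e3 := S.le_opNorm (x - y)
  have e4 : K * ‖x - y‖ < ε / 2 := by
    rw [lt_div_iff₀ (by positivity)] at hxy
    linarith
  rw [e1]
  refine (norm_add_le _ _).trans_lt ?_
  have e5 := norm_sub_le (T i (x - y)) (S (x - y))
  have e6 : K * ‖x - y‖ = |C| * ‖x - y‖ + ‖S‖ * ‖x - y‖ + ‖x - y‖ := by ring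
  linarith [norm_nonneg (x - y)]

theorem isClosed_setOf_tendsto_mul_right {ι : Type*} {l : Filter ι} {u : ι → D}
    (hu : ∀ᶠ i in l, ‖u i‖ ≤ 1) : IsClosed {x | Tendsto (fun i => x * u i) l (𝓝 x)} := by
  refine isClosed_setOf_tendsto (T := fun i => (ContinuousLinearMap.mul ℂ D).flip (u i))
    (S := ContinuousLinearMap.id ℂ _) (C := 1) ?_
  filter_upwards [hu] with p hp
  refine ContinuousLinearMap.opNorm_le_bound _ zero_le_one fun x => ?_
  rw [one_mul]
  exact (norm_mul_le _ _).trans (mul_le_of_le_one_right (norm_nonneg _) hp)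

theorem isClosed_setOf_tendsto_mul_left {ι : Type*} {l : Filter ι} {u : ι → D}
    (hu : ∀ᶠ i in l, ‖u i‖ ≤ 1) : IsClosed {x | Tendsto (fun i => u i * x) l (𝓝 x)} := by
  refine isClosed_setOf_tendsto (T := fun i => ContinuousLinearMap.mul ℂ D (u i))
    (S := ContinuousLinearMap.id ℂ _) (C := 1) ?_
  filter_upwards [hu] with p hp
  refine ContinuousLinearMap.opNorm_le_bound _ zero_le_one fun x => ?_
  rw [one_mul]
  exact (norm_mul_le _ _).trans (mul_le_of_le_one_left (norm_nonneg _) hp)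

theorem tendsto_tmul {ι : Type*} {l : Filter ι} {u : ι → D} {v : ι → A} {d : D} {a : A}
    (hu : Tendsto u l (𝓝 d)) (hv : Tendsto v l (𝓝 a)) :
    Tendsto (fun i => tmul (u i) (v i)) l (𝓝 (tmul d a)) := by
  have hc : Continuous fun p : D × A => tmul p.1 p.2 :=
    Continuous.tmul' continuous_fst continuous_snd
  have h := (hc.tendsto (d, a)).comp (hu.prodMk_nhds hv)
  rwa [Function.comp_def] at h

/-- The elementary tensors of contractive approximate units form one. -/
theorem IsContractiveUnit.tensor {l : Filter D} {k : Filter A} (hl : IsContractiveUnit l)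
    (hk : IsContractiveUnit k) :
    IsContractiveUnit (map (fun p : D × A => tmul p.1 p.2) (l ×ˢ k)) := by
  have := hl.neBot
  have := hk.neBot
  have hn : ∀ᶠ p : D × A in l ×ˢ k, ‖tmul p.1 p.2‖ ≤ 1 := by
    filter_upwards [hl.norm_le.prod_mk hk.norm_le] with p hp
    exact (norm_tmul_le _ _).trans (mul_le_one₀ hp.1 (norm_nonneg _) hp.2)
  refine ⟨inferInstance, eventually_map.mpr hn, fun x => tendsto_map'_iff.mpr ?_,
    fun x => tendsto_map'_iff.mpr ?_⟩
  · refine induction_tmul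
      (p := fun x => Tendsto (fun p : D × A => x * tmul p.1 p.2) (l ×ˢ k) (𝓝 x))
      (isClosed_setOf_tendsto_mul_right (u := fun p : D × A => tmul p.1 p.2) hn)
      (fun x y hx hy => ?_) (fun d a => ?_) x
    · simp only [add_mul]; exact hx.add hy
    · simp only [tmul_mul_tmul]
      have h1 := (hl.right d).comp (tendsto_fst (f := l) (g := k))
      have h2 := (hk.right a).comp (tendsto_snd (f := l) (g := k))
      rw [Function.comp_def] at h1 h2
      exact tendsto_tmul h1 h2
  · refine induction_tmul
      (p := fun x => Tendsto (fun p : D × A => tmul p.1 p.2 * x) (l ×ˢ k) (𝓝 x))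
      (isClosed_setOf_tendsto_mul_left (u := fun p : D × A => tmul p.1 p.2) hn)
      (fun x y hx hy => ?_) (fun d a => ?_) x
    · simp only [mul_add]; exact hx.add hy
    · simp only [tmul_mul_tmul]
      have h1 := (hl.left d).comp (tendsto_fst (f := l) (g := k))
      have h2 := (hk.left a).comp (tendsto_snd (f := l) (g := k))
      rw [Function.comp_def] at h1 h2
      exact tendsto_tmul h1 h2

end ApproxUnit

section StrictAt

variable {D E A : Type u} [NonUnitalCStarAlgebra D] [NonUnitalCStarAlgebra E]
  [NonUnitalCStarAlgebra A]

/-- `x ↦ Φ(x) z` is approximated by the maps `x ↦ Φ(x d) z`. -/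
def StrictAt (Φ : D →⋆ₙₐ[ℂ] 𝓜(ℂ, E)) (z : E) : Prop :=
  ∀ ε > 0, ∃ d, ∀ x, ‖(Φ x).fst z - (Φ (x * d)).fst z‖ ≤ ε * ‖x‖

theorem hom_mul_fst (Φ : D →⋆ₙₐ[ℂ] 𝓜(ℂ, E)) (x y : D) (z : E) :
    (Φ (x * y)).fst z = (Φ x).fst ((Φ y).fst z) := by rw [map_mul, mult_mul_fst]

theorem hom_sub_fst (Φ : D →⋆ₙₐ[ℂ] 𝓜(ℂ, E)) (x y : D) (z : E) :
    (Φ (x - y)).fst z = (Φ x).fst z - (Φ y).fst z := by rw [map_sub]; rfl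

theorem norm_hom_fst_le (Φ : D →⋆ₙₐ[ℂ] 𝓜(ℂ, E)) (x : D) (z : E) :
    ‖(Φ x).fst z‖ ≤ ‖x‖ * ‖z‖ :=
  (norm_fst_apply_le _ _).trans
    (mul_le_mul_of_nonneg_right (NonUnitalStarAlgHom.norm_apply_le Φ x) (norm_nonneg _))

theorem continuous_hom_fst (Φ : D →⋆ₙₐ[ℂ] 𝓜(ℂ, E)) (z : E) : Continuous fun x => (Φ x).fst z := by
  refine AddMonoidHomClass.continuous_of_bound (evalFst Φ z) ‖z‖ fun x => ?_
  rw [mul_comm]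
  exact norm_hom_fst_le Φ x z

theorem strictAt_of_tendsto {Φ : D →⋆ₙₐ[ℂ] 𝓜(ℂ, E)} {l : Filter D} (hl : IsContractiveUnit l)
    {y z : E} (h : Tendsto (fun e => (Φ e).fst z) l (𝓝 y)) : StrictAt Φ z := fun ε hε => by
  have := hl.neBot
  have h1 := Metric.tendsto_nhds.mp h (ε / 2) (half_pos hε)
  obtain ⟨d, hd⟩ := h1.exists
  refine ⟨d, fun x => ?_⟩
  have h2 : Tendsto (fun e => ‖(Φ (x * e)).fst z - (Φ (x * d)).fst z‖) l
      (𝓝 ‖(Φ x).fst z - (Φ (x * d)).fst z‖) :=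
    ((((continuous_hom_fst Φ z).tendsto x).comp (hl.right x)).sub_const _).norm
  refine le_of_tendsto h2 ?_
  filter_upwards [h1] with e he
  rw [hom_mul_fst, hom_mul_fst, ← map_sub, mul_comm]
  refine (norm_hom_fst_le Φ _ _).trans (mul_le_mul_of_nonneg_left ?_ (norm_nonneg _))
  rw [← dist_eq_norm]
  exact (dist_triangle_right _ _ y).trans (by linarith)

theorem StrictAt.tendsto_zero {Φ : D →⋆ₙₐ[ℂ] 𝓜(ℂ, E)} {z : E} (h : StrictAt Φ z) {ι : Type*}
    {G : Filter ι} {w : ι → D} {C : ℝ} (hC : ∀ᶠ i in G, ‖w i‖ ≤ C)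
    (hw : ∀ d, Tendsto (fun i => w i * d) G (𝓝 0)) :
    Tendsto (fun i => (Φ (w i)).fst z) G (𝓝 0) := by
  refine Metric.tendsto_nhds.mpr fun ε hε => ?_
  obtain ⟨d, hd⟩ := h (ε / (2 * (|C| + 1))) (by positivity)
  have h0 : (Φ 0).fst z = 0 := by rw [map_zero]; rfl
  have h1 : Tendsto (fun i => (Φ (w i * d)).fst z) G (𝓝 0) := by
    have := ((continuous_hom_fst Φ z).tendsto 0).comp (hw d)
    rwa [h0] at this
  filter_upwards [hC, Metric.tendsto_nhds.mp h1 (ε / 2) (half_pos hε)] with i h2 h3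
  rw [dist_zero_right] at h3 ⊢
  have h4 : ε / (2 * (|C| + 1)) * ‖w i‖ ≤ ε / 2 := by
    rw [div_mul_eq_mul_div, div_le_div_iff₀ (by positivity) two_pos]
    nlinarith [le_abs_self C]
  calc ‖(Φ (w i)).fst z‖
      = ‖((Φ (w i)).fst z - (Φ (w i * d)).fst z) + (Φ (w i * d)).fst z‖ := by rw [sub_add_cancel]
    _ ≤ ‖(Φ (w i)).fst z - (Φ (w i * d)).fst z‖ + ‖(Φ (w i * d)).fst z‖ := norm_add_le _ _
    _ < ε := by linarith [hd (w i)]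

theorem StrictAt.exists_tendsto {Φ : D →⋆ₙₐ[ℂ] 𝓜(ℂ, E)} {z : E} (h : StrictAt Φ z) {ι : Type*}
    {G : Filter ι} [G.NeBot] {w : ι → D} {C : ℝ} (hC : ∀ᶠ i in G, ‖w i‖ ≤ C) {L : D → D}
    (hw : ∀ d, Tendsto (fun i => w i * d) G (𝓝 (L d))) :
    ∃ y, Tendsto (fun i => (Φ (w i)).fst z) G (𝓝 y) := by
  refine cauchy_map_iff_exists_tendsto.mp (cauchy_map_iff.mpr ⟨inferInstance, ?_⟩)
  rw [tendsto_uniformity_iff_dist_tendsto_zero]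
  have h1 : Tendsto (fun p : ι × ι => (Φ (w p.1 - w p.2)).fst z) (G ×ˢ G) (𝓝 0) := by
    refine h.tendsto_zero (C := C + C) ?_ fun d => ?_
    · filter_upwards [hC.prod_mk hC] with p hp
      exact (norm_sub_le _ _).trans (add_le_add hp.1 hp.2)
    · simp only [sub_mul]
      rw [← sub_self (L d)]
      exact ((hw d).comp tendsto_fst).sub ((hw d).comp tendsto_snd)
  simpa only [dist_eq_norm, hom_sub_fst, norm_zero] using h1.norm

theorem StrictAt.exists_tendsto_unit {Φ : D →⋆ₙₐ[ℂ] 𝓜(ℂ, E)} {z : E} (h : StrictAt Φ z)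
    {l : Filter D} (hl : IsContractiveUnit l) : ∃ y, Tendsto (fun e => (Φ e).fst z) l (𝓝 y) := by
  have := hl.neBot
  exact h.exists_tendsto hl.norm_le (L := id) hl.left

/-- The closed subspace of all `z` for which `x ↦ Φ(x) z` is strictly continuous on bounded sets. -/
def strictSubmodule (Φ : D →⋆ₙₐ[ℂ] 𝓜(ℂ, E)) : Submodule ℂ E where
  carrier := {z | StrictAt Φ z}
  zero_mem' := fun ε hε => ⟨0, fun x => by
    rw [map_zero, map_zero, sub_zero, norm_zero]; positivity⟩
  add_mem' {z z'} h h' := by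
    obtain ⟨y, hy⟩ := StrictAt.exists_tendsto_unit h isContractiveUnit_contrUnit
    obtain ⟨y', hy'⟩ := StrictAt.exists_tendsto_unit h' isContractiveUnit_contrUnit
    refine strictAt_of_tendsto isContractiveUnit_contrUnit (y := y + y') ?_
    simp only [map_add]
    exact hy.add hy'
  smul_mem' c z h := by
    obtain ⟨y, hy⟩ := StrictAt.exists_tendsto_unit h isContractiveUnit_contrUnit
    refine strictAt_of_tendsto isContractiveUnit_contrUnit (y := c • y) ?_
    simp only [map_smul]
    exact hy.const_smul c

theorem isClosed_strictSubmodule (Φ : D →⋆ₙₐ[ℂ] 𝓜(ℂ, E)) :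
    IsClosed (strictSubmodule Φ : Set E) := by
  refine isClosed_of_closure_subset fun z hz => ?_
  have hcauchy : Cauchy (map (fun e => (Φ e).fst z) (contrUnit D)) := by
    rw [cauchy_map_iff]
    refine ⟨inferInstance, ?_⟩
    rw [tendsto_uniformity_iff_dist_tendsto_zero]
    refine Metric.tendsto_nhds.mpr fun ε hε => ?_
    obtain ⟨z', hz', hd⟩ := Metric.mem_closure_iff.mp hz (ε / 4) (by positivity)
    obtain ⟨y, hy⟩ := StrictAt.exists_tendsto_unit hz' isContractiveUnit_contrUnit
    have h1 := ((isContractiveUnit_contrUnit (D := D)).norm_le).and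
      (Metric.tendsto_nhds.mp hy (ε / 4) (by positivity))
    have key : ∀ e : D, (‖e‖ ≤ 1 ∧ dist ((Φ e).fst z') y < ε / 4) →
        dist ((Φ e).fst z) y < ε / 2 := fun e he => by
      have h2 : dist ((Φ e).fst z) ((Φ e).fst z') ≤ dist z z' := by
        rw [dist_eq_norm, dist_eq_norm, ← map_sub]
        exact (norm_hom_fst_le Φ _ _).trans (mul_le_of_le_one_left (norm_nonneg _) he.1)
      linarith [dist_triangle ((Φ e).fst z) ((Φ e).fst z') y, he.2]
    filter_upwards [h1.prod_mk h1] with p hp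
    rw [Real.dist_0_eq_abs, abs_of_nonneg dist_nonneg]
    linarith [dist_triangle_right ((Φ p.1).fst z) ((Φ p.2).fst z) y, key _ hp.1, key _ hp.2]
  obtain ⟨y, hy⟩ := cauchy_map_iff_exists_tendsto.mp hcauchy
  exact strictAt_of_tendsto isContractiveUnit_contrUnit hy

end StrictAt

section StrictExt

variable {D E A : Type u} [NonUnitalCStarAlgebra D] [NonUnitalCStarAlgebra E]
  [NonUnitalCStarAlgebra A]

theorem tendsto_nhds_strict {ι : Type*} {G : Filter ι} {f : ι → 𝓜(ℂ, E)} {m : 𝓜(ℂ, E)} :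
    Tendsto f G (@nhds _ (strictTopology E) m) ↔
      (∀ z, Tendsto (fun i => (f i).fst z) G (𝓝 (m.fst z))) ∧
        ∀ z, Tendsto (fun i => (f i).snd z) G (𝓝 (m.snd z)) := by
  rw [nhds_induced, tendsto_comap_iff, tendsto_pi_nhds]
  simp only [Prod.tendsto_iff, Function.comp_apply, forall_and]

/-- The filter along which the strict extension at `m` is computed. -/
noncomputable def strictBall (m : 𝓜(ℂ, D)) : Filter D :=
  Filter.comap (incl D) (@nhds 𝓜(ℂ, D) (strictTopology D) m) ⊓
      Filter.principal (Metric.closedBall 0 ‖m‖)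

theorem tendsto_strictBall {ι : Type*} {G : Filter ι} {u : ι → D} {m : 𝓜(ℂ, D)} :
    Tendsto u G (strictBall m) ↔ ((∀ z, Tendsto (fun i => u i * z) G (𝓝 (m.fst z))) ∧
        ∀ z, Tendsto (fun i => z * u i) G (𝓝 (m.snd z))) ∧ ∀ᶠ i in G, ‖u i‖ ≤ ‖m‖ := by
  rw [strictBall, tendsto_inf, tendsto_comap_iff, tendsto_nhds_strict, tendsto_principal]
  simp only [mem_closedBall_zero_iff, Function.comp_apply, incl_fst, incl_snd]

theorem tendsto_fst_strictBall (m : 𝓜(ℂ, D)) {l : Filter D} (hl : IsContractiveUnit l) :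
    Tendsto (fun e => m.fst e) l (strictBall m) := by
  rw [tendsto_strictBall]
  refine ⟨⟨fun z => ?_, fun z => ?_⟩, ?_⟩
  · simp only [← fst_mul]
    exact (m.fst.continuous.tendsto z).comp (hl.left z)
  · simp only [← m.central]
    exact hl.right _
  · filter_upwards [hl.norm_le] with e he
    exact (norm_fst_apply_le m e).trans (mul_le_of_le_one_right (norm_nonneg _) he)

instance (m : 𝓜(ℂ, D)) : (strictBall m).NeBot :=
  (tendsto_fst_strictBall m isContractiveUnit_contrUnit).neBot

theorem tendsto_star_strictBall (m : 𝓜(ℂ, D)) :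
    Tendsto star (strictBall m) (strictBall (star m)) := by
  obtain ⟨⟨h1, h2⟩, h3⟩ := tendsto_strictBall.mp (tendsto_id (x := strictBall m))
  rw [tendsto_strictBall]
  refine ⟨⟨fun z => ?_, fun z => ?_⟩, ?_⟩
  · rw [DoubleCentralizer.star_fst]
    simpa using (h2 (star z)).star
  · rw [DoubleCentralizer.star_snd]
    simpa using (h1 (star z)).star
  · simpa using h3

theorem strictTopology_t2 : @T2Space 𝓜(ℂ, E) (strictTopology E) := by
  let _ := strictTopology E
  refine T2Space.of_injective_continuous
    (f := fun (m : 𝓜(ℂ, E)) (d : E) => (m.fst d, m.snd d)) (fun m n h => ?_) continuous_induced_dom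
  exact mult_ext_fst fun x => congrArg Prod.fst (congrFun h x)

/-- A `*`-homomorphism which is strict at every point. -/
def IsStrictHom (Φ : D →⋆ₙₐ[ℂ] 𝓜(ℂ, E)) : Prop := ∀ z, StrictAt Φ z

theorem hom_snd (Φ : D →⋆ₙₐ[ℂ] 𝓜(ℂ, E)) (x : D) (z : E) :
    (Φ x).snd z = star ((Φ (star x)).fst (star z)) := by
  have h : Φ (star x) = star (Φ x) := map_star Φ x
  rw [h, DoubleCentralizer.star_fst, star_star, star_star]

theorem IsStrictHom.exists_limit {Φ : D →⋆ₙₐ[ℂ] 𝓜(ℂ, E)} (h : IsStrictHom Φ) (m : 𝓜(ℂ, D)) :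
    ∃ n : 𝓜(ℂ, E), Tendsto Φ (strictBall m) (@nhds _ (strictTopology E) n) := by
  have ex : ∀ (m : 𝓜(ℂ, D)) (z : E), ∃ y, Tendsto (fun x => (Φ x).fst z) (strictBall m) (𝓝 y) :=
    fun m z => by
      obtain ⟨⟨h1, -⟩, h3⟩ := tendsto_strictBall.mp (tendsto_id (x := strictBall m))
      exact (h z).exists_tendsto h3 h1
  have lim : ∀ m : 𝓜(ℂ, D), ∃ T : E →L[ℂ] E, ∀ z,
      Tendsto (fun x => (Φ x).fst z) (strictBall m) (𝓝 (T z)) := fun m => by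
    choose L hL using ex m
    refine ⟨LinearMap.mkContinuous
      { toFun := L
        map_add' := fun z z' => tendsto_nhds_unique (hL _) <| by
          simp only [map_add]; exact (hL z).add (hL z')
        map_smul' := fun c z => tendsto_nhds_unique (hL _) <| by
          simp only [map_smul]; exact (hL z).const_smul c } ‖m‖ fun z => ?_, hL⟩
    refine le_of_tendsto (hL z).norm ?_
    filter_upwards [(tendsto_strictBall.mp (tendsto_id (x := strictBall m))).2] with x hx
    exact (norm_hom_fst_le Φ x z).trans (mul_le_mul_of_nonneg_right hx (norm_nonneg _))
  obtain ⟨T, hT⟩ := lim m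
  obtain ⟨S, hS⟩ := lim (star m)
  have hS' : ∀ z, Tendsto (fun x => (Φ x).snd z) (strictBall m) (𝓝 (star (S (star z)))) :=
      fun z => by
    simp only [hom_snd]
    exact ((hS (star z)).comp (tendsto_star_strictBall m)).star
  choose R hR using fun z => (⟨_, hS' z⟩ : ∃ y, Tendsto (fun x => (Φ x).snd z) (strictBall m) (𝓝 y))
  let R' : E →L[ℂ] E := LinearMap.mkContinuous
      { toFun := R
        map_add' := fun z z' => tendsto_nhds_unique (hR _) <| by
          simp only [map_add]; exact (hR z).add (hR z')
        map_smul' := fun c z => tendsto_nhds_unique (hR _) <| by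
          simp only [map_smul]; exact (hR z).const_smul c } ‖S‖ fun z => by
    change ‖R z‖ ≤ _
    rw [tendsto_nhds_unique (hR z) (hS' z), norm_star, ← norm_star z]
    exact S.le_opNorm _
  refine ⟨⟨(T, R'), fun x y => ?_⟩, tendsto_nhds_strict.mpr ⟨hT, hR⟩⟩
  refine tendsto_nhds_unique ((hR x).mul_const y) ?_
  simp only [DoubleCentralizer.central]
  exact (hT y).const_mul x

theorem IsStrictHom.tendsto_strictBall {Φ : D →⋆ₙₐ[ℂ] 𝓜(ℂ, E)} (h : IsStrictHom Φ) (m : 𝓜(ℂ, D)) :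
    Tendsto Φ (strictBall m) (@nhds _ (strictTopology E) (strictExt Φ m)) := by
  obtain ⟨n, hn⟩ := h.exists_limit m
  have h2 : strictExt Φ m = n :=
    @lim_eq _ (strictTopology E) strictTopology_t2 _ _
      (map_neBot (hf := inferInstanceAs (strictBall m).NeBot)) hn
  rwa [h2]

/-- The strict extension is the limit along any bounded net converging strictly from the left. -/
theorem IsStrictHom.tendsto_strictExt {Φ : D →⋆ₙₐ[ℂ] 𝓜(ℂ, E)} (h : IsStrictHom Φ) {m : 𝓜(ℂ, D)}
    {ι : Type*} {G : Filter ι} {u : ι → D} {C : ℝ} (hC : ∀ᶠ i in G, ‖u i‖ ≤ C)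
    (hu : ∀ d, Tendsto (fun i => u i * d) G (𝓝 (m.fst d))) (z : E) :
    Tendsto (fun i => (Φ (u i)).fst z) G (𝓝 ((strictExt Φ m).fst z)) := by
  have h1 := (tendsto_nhds_strict.mp (h.tendsto_strictBall m)).1 z
  obtain ⟨⟨h2, -⟩, h3⟩ := CStarTensor.tendsto_strictBall.mp (tendsto_id (x := strictBall m))
  have h4 : Tendsto (fun p : ι × D => (Φ (u p.1 - p.2)).fst z) (G ×ˢ strictBall m) (𝓝 0) := by
    refine (h z).tendsto_zero (C := C + ‖m‖) ?_ fun d => ?_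
    · filter_upwards [hC.prod_mk h3] with p hp
      exact (norm_sub_le _ _).trans (add_le_add hp.1 hp.2)
    · simp only [sub_mul]
      rw [← sub_self (m.fst d)]
      exact ((hu d).comp tendsto_fst).sub ((h2 d).comp tendsto_snd)
  have h5 : Tendsto ((fun i => (Φ (u i)).fst z) ∘ Prod.fst) (G ×ˢ strictBall m)
      (𝓝 ((strictExt Φ m).fst z)) := by
    have := h4.add (h1.comp tendsto_snd)
    simpa [hom_sub_fst, Function.comp_def] using this
  rwa [← tendsto_map'_iff, map_fst_prod] at h5

theorem IsStrictHom.tendsto_strictExt_unit {Φ : D →⋆ₙₐ[ℂ] 𝓜(ℂ, E)} (h : IsStrictHom Φ)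
    (m : 𝓜(ℂ, D)) {l : Filter D} (hl : IsContractiveUnit l) (z : E) :
    Tendsto (fun e => (Φ (m.fst e)).fst z) l (𝓝 ((strictExt Φ m).fst z)) := by
  obtain ⟨⟨h1, -⟩, h2⟩ := CStarTensor.tendsto_strictBall.mp (tendsto_fst_strictBall m hl)
  exact h.tendsto_strictExt h2 h1 z

theorem IsStrictHom.strictExt_mul {Φ : D →⋆ₙₐ[ℂ] 𝓜(ℂ, E)} (h : IsStrictHom Φ) (m : 𝓜(ℂ, D))
    (d : D) : strictExt Φ m * Φ d = Φ (m.fst d) := mult_ext_fst fun z => by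
  have h1 := h.tendsto_strictExt_unit m isContractiveUnit_contrUnit ((Φ d).fst z)
  have h2 : Tendsto (fun e => (Φ (m.fst e)).fst ((Φ d).fst z)) (contrUnit D)
      (𝓝 ((Φ (m.fst d)).fst z)) := by
    simp only [← hom_mul_fst, ← fst_mul]
    exact (((continuous_hom_fst Φ z).comp m.fst.continuous).tendsto d).comp
      (isContractiveUnit_contrUnit.left d)
  exact tendsto_nhds_unique h1 h2

theorem isStrict_iff {Φ : D → 𝓜(ℂ, E)} : IsStrict Φ ↔ ∀ x₀ ∈ Metric.closedBall (0 : D) 1,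
    Tendsto Φ (Filter.comap (incl D) (@nhds 𝓜(ℂ, D) (strictTopology D) (incl D x₀)) ⊓
      Filter.principal (Metric.closedBall 0 1)) (@nhds _ (strictTopology E) (Φ x₀)) := by
  refine forall₂_congr fun x₀ _ => ?_
  change Tendsto Φ (@nhds D (TopologicalSpace.induced (incl D) (strictTopology D)) x₀ ⊓ _) _ ↔ _
  rw [@nhds_induced _ _ (strictTopology D) (incl D) x₀]

theorem isStrictHom_of_isStrict {Φ : D →⋆ₙₐ[ℂ] 𝓜(ℂ, E)} (h : IsStrict Φ) : IsStrictHom Φ :=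
  fun z => by
  have h0 := isStrict_iff.mp h 0 (by simp)
  rw [map_zero, map_zero] at h0
  have key : Tendsto (fun p : D × D => (Φ ((2⁻¹ : ℂ) • (p.1 - p.2))).fst z)
      (contrUnit D ×ˢ contrUnit D) (𝓝 0) := by
    have h1 : Tendsto (fun p : D × D => (2⁻¹ : ℂ) • (p.1 - p.2)) (contrUnit D ×ˢ contrUnit D)
        (Filter.comap (incl D) (@nhds 𝓜(ℂ, D) (strictTopology D) 0) ⊓
          Filter.principal (Metric.closedBall 0 1)) := by
      have hu := isContractiveUnit_contrUnit (D := D)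
      rw [tendsto_inf, tendsto_comap_iff, tendsto_nhds_strict, tendsto_principal]
      refine ⟨⟨fun d => ?_, fun d => ?_⟩, ?_⟩
      · have := (((hu.left d).comp tendsto_fst).sub ((hu.left d).comp
          (tendsto_snd (f := contrUnit D)))).const_smul (2⁻¹ : ℂ)
        simp only [sub_self, smul_zero, Function.comp_apply] at this
        change Tendsto _ _ (𝓝 (0 : D))
        simpa only [Function.comp_apply, incl_fst, smul_mul_assoc, sub_mul] using this
      · have := (((hu.right d).comp tendsto_fst).sub ((hu.right d).comp
          (tendsto_snd (f := contrUnit D)))).const_smul (2⁻¹ : ℂ)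
        simp only [sub_self, smul_zero, Function.comp_apply] at this
        change Tendsto _ _ (𝓝 (0 : D))
        simpa only [Function.comp_apply, incl_snd, mul_smul_comm, mul_sub] using this
      · filter_upwards [hu.norm_le.prod_mk hu.norm_le] with p hp
        rw [mem_closedBall_zero_iff, norm_smul, norm_inv, RCLike.norm_two]
        linarith [norm_sub_le p.1 p.2, hp.1, hp.2]
    exact (tendsto_nhds_strict.mp (h0.comp h1)).1 z
  have hcauchy : Cauchy (map (fun e => (Φ e).fst z) (contrUnit D)) := by
    rw [cauchy_map_iff]
    refine ⟨inferInstance, ?_⟩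
    rw [tendsto_uniformity_iff_dist_tendsto_zero]
    have h2 := (key.const_smul (2 : ℂ)).norm
    simp only [smul_zero, norm_zero] at h2
    refine h2.congr fun p => ?_
    rw [map_smul, DoubleCentralizer.smul_fst, smul_apply, smul_smul, hom_sub_fst, dist_eq_norm]
    norm_num
  obtain ⟨y, hy⟩ := cauchy_map_iff_exists_tendsto.mp hcauchy
  exact strictAt_of_tendsto isContractiveUnit_contrUnit hy

theorem IsStrictHom.isStrict {Φ : D →⋆ₙₐ[ℂ] 𝓜(ℂ, E)} (h : IsStrictHom Φ) : IsStrict Φ := by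
  refine isStrict_iff.mpr fun x₀ _ => ?_
  have h1 : ∀ {x₀ : D} {G : Filter D}, (∀ d, Tendsto (fun x => x * d) G (𝓝 (x₀ * d))) →
      (∀ᶠ x in G, ‖x‖ ≤ 1) → ∀ z, Tendsto (fun x => (Φ x).fst z) G (𝓝 ((Φ x₀).fst z)) :=
    fun {x₀ G} hG hb z => by
      have := (h z).tendsto_zero (G := G) (w := fun x => x - x₀) (C := 1 + ‖x₀‖) ?_ fun d => ?_
      · simp only [hom_sub_fst] at this
        simpa using this.add_const ((Φ x₀).fst z)
      · filter_upwards [hb] with x hx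
        exact (norm_sub_le _ _).trans (by linarith)
      · simp only [sub_mul]
        simpa using (hG d).sub_const (x₀ * d)
  set G := Filter.comap (incl D) (@nhds 𝓜(ℂ, D) (strictTopology D) (incl D x₀)) ⊓
          Filter.principal (Metric.closedBall 0 1)
  have h2 := tendsto_id (x := G)
  rw [tendsto_inf, tendsto_comap_iff, tendsto_nhds_strict, tendsto_principal] at h2
  obtain ⟨⟨h2, h3⟩, h4⟩ := h2
  simp only [mem_closedBall_zero_iff, id_eq] at h4
  refine tendsto_nhds_strict.mpr ⟨h1 h2 h4, fun z => ?_⟩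
  simp only [hom_snd]
  refine Tendsto.star ?_
  refine (h1 (x₀ := star x₀) (G := map star G) (fun d => ?_) ?_ (star z)).comp tendsto_map
  · rw [tendsto_map'_iff]
    have := (h3 (star d)).star
    simpa [Function.comp_def, incl_snd] using this
  · rw [eventually_map]
    simpa using h4

end StrictExt

section ConcreteHoms

variable {D D' E E' F F' G G' A : Type u} [NonUnitalCStarAlgebra D] [NonUnitalCStarAlgebra D']
  [NonUnitalCStarAlgebra E] [NonUnitalCStarAlgebra E'] [NonUnitalCStarAlgebra F]
  [NonUnitalCStarAlgebra F'] [NonUnitalCStarAlgebra G] [NonUnitalCStarAlgebra G']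
  [NonUnitalCStarAlgebra A]

theorem isStrictHom_multHom {δ : D →⋆ₙₐ[ℂ] 𝓜(ℂ, E)} (h : IsStrictHom δ) :
    IsStrictHom (multHom δ (incl A)) := fun z => by
  refine induction_tmul (p := fun z => z ∈ strictSubmodule (multHom δ (incl A)))
    (isClosed_strictSubmodule _) (fun x y hx hy => add_mem hx hy) (fun e a => ?_) z
  obtain ⟨y, hy⟩ := (h e).exists_tendsto_unit isContractiveUnit_contrUnit
  refine strictAt_of_tendsto (isContractiveUnit_contrUnit.tensor isContractiveUnit_contrUnit)
    (y := tmul y a) (tendsto_map'_iff.mpr ?_)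
  simp only [Function.comp_def, multHom_tmul, mtmul_fst_tmul, incl_fst]
  have h1 := hy.comp (tendsto_fst (f := contrUnit D) (g := contrUnit A))
  have h2 := (isContractiveUnit_contrUnit.left a).comp
    (tendsto_snd (f := contrUnit D) (g := contrUnit A))
  rw [Function.comp_def] at h1 h2
  exact tendsto_tmul h1 h2

theorem isStrictHom_multHom_incl {Δ : F →⋆ₙₐ[ℂ] 𝓜(ℂ, E)} (h : IsNondegenerate Δ) :
    IsStrictHom (multHom (incl D) Δ) := fun z => by
  refine induction_tmul (p := fun z => z ∈ strictSubmodule (multHom (incl D) Δ))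
    (isClosed_strictSubmodule _) (fun x y hx hy => add_mem hx hy) (fun d e => ?_) z
  have hle : (⊤ : Submodule ℂ E) ≤
      (strictSubmodule (multHom (incl D) Δ)).comap (tmulL D E d).toLinearMap := by
    rw [← h]
    refine Submodule.topologicalClosure_minimal _ (Submodule.span_le.mpr ?_)
      ((isClosed_strictSubmodule _).preimage (tmulL D E d).continuous)
    rintro _ ⟨a, b, rfl⟩
    refine strictAt_of_tendsto (isContractiveUnit_contrUnit.tensor isContractiveUnit_contrUnit)
      (y := tmul d ((Δ a).fst b)) (tendsto_map'_iff.mpr ?_)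
    have h1 := (isContractiveUnit_contrUnit.left d).comp
      (tendsto_fst (f := contrUnit D) (g := contrUnit F))
    have h2 := (((continuous_hom_fst Δ b).tendsto a).comp
      (isContractiveUnit_contrUnit.left a)).comp
      (tendsto_snd (f := contrUnit D) (g := contrUnit F))
    simp only [Function.comp_def, hom_mul_fst] at h1 h2
    have h3 := tendsto_tmul h1 h2
    refine h3.congr fun p => ?_
    change _ = (multHom (incl D) Δ (tmul p.1 p.2)).fst (tmul d ((Δ a).fst b))
    rw [multHom_tmul, mtmul_fst_tmul, incl_fst]
  exact hle (Submodule.mem_top (x := e))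

theorem isNondegenerate_multHom_incl {Δ : F →⋆ₙₐ[ℂ] 𝓜(ℂ, E)} (h : IsNondegenerate Δ) :
    IsNondegenerate (multHom (incl D) Δ) := by
  refine Submodule.eq_top_iff'.mpr fun z => ?_
  set S := (Submodule.span ℂ
    {x : D ⊗ᵐ E | ∃ d b, x = (multHom (incl D) Δ d).fst b}).topologicalClosure
  have hS : IsClosed (S : Set (D ⊗ᵐ E)) := Submodule.isClosed_topologicalClosure _
  refine induction_tmul (p := fun z => z ∈ S) hS (fun x y hx hy => add_mem hx hy)
    (fun d e => ?_) z
  have hle : (⊤ : Submodule ℂ E) ≤ S.comap (tmulL D E d).toLinearMap := by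
    rw [← h]
    refine Submodule.topologicalClosure_minimal _ (Submodule.span_le.mpr ?_)
      (hS.preimage (tmulL D E d).continuous)
    rintro _ ⟨a, b, rfl⟩
    have h1 := tendsto_tmul (isContractiveUnit_contrUnit.right d)
      (tendsto_const_nhds (x := (Δ a).fst b))
    refine hS.mem_of_tendsto h1 (Eventually.of_forall fun u => ?_)
    refine Submodule.le_topologicalClosure _ (Submodule.subset_span ⟨tmul d a, tmul u b, ?_⟩)
    rw [multHom_tmul, mtmul_fst_tmul, incl_fst]
  exact hle (Submodule.mem_top (x := e))

theorem IsNondegenerate.ext {φ : D →⋆ₙₐ[ℂ] 𝓜(ℂ, E)} (h : IsNondegenerate φ) {N : Type*}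
    [NormedAddCommGroup N] [NormedSpace ℂ N] {S T : E →L[ℂ] N}
    (hST : ∀ d e, S ((φ d).fst e) = T ((φ d).fst e)) : S = T := by
  refine ContinuousLinearMap.ext fun x => ?_
  have hle : (⊤ : Submodule ℂ E) ≤ LinearMap.eqLocus S.toLinearMap T.toLinearMap := by
    rw [← h]
    refine Submodule.topologicalClosure_minimal _ (Submodule.span_le.mpr ?_)
      (isClosed_eq S.continuous T.continuous)
    rintro _ ⟨a, b, rfl⟩
    exact hST a b
  exact hle (Submodule.mem_top (x := x))

theorem isStrictHom_incl_comp {f : D →⋆ₙₐ[ℂ] E} (hf : DenseRange f) :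
    IsStrictHom ((incl E).comp f) := fun z => by
  have hcl : IsClosed {z | z ∈ strictSubmodule ((incl E).comp f)} := isClosed_strictSubmodule _
  refine hf.induction_on (p := fun z => z ∈ strictSubmodule ((incl E).comp f)) z hcl fun y => ?_
  refine strictAt_of_tendsto isContractiveUnit_contrUnit (y := f y) ?_
  have h1 := ((continuous_starHom f).tendsto y).comp (isContractiveUnit_contrUnit.left y)
  refine h1.congr fun u => ?_
  rw [Function.comp_apply, map_mul, ← incl_fst]
  rfl

theorem strictExt_incl_comp_fst {f : D →⋆ₙₐ[ℂ] E} (hf : DenseRange f) (m : 𝓜(ℂ, D)) (d : D) :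
    (strictExt ((incl E).comp f) m).fst (f d) = f (m.fst d) := by
  apply incl_injective
  rw [← mult_mul_incl]
  exact (isStrictHom_incl_comp hf).strictExt_mul m d

/-- Naturality of the tensor product of homomorphisms into multiplier algebras. -/
theorem tensorHom_multHom_fst {δ : D →⋆ₙₐ[ℂ] 𝓜(ℂ, E)} {δ' : D' →⋆ₙₐ[ℂ] 𝓜(ℂ, E')}
    {ψ : F →⋆ₙₐ[ℂ] 𝓜(ℂ, G)} {ψ' : F' →⋆ₙₐ[ℂ] 𝓜(ℂ, G')} {f : D →⋆ₙₐ[ℂ] D'} {g : E →⋆ₙₐ[ℂ] E'}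
    {k : F →⋆ₙₐ[ℂ] F'} {l : G →⋆ₙₐ[ℂ] G'}
    (hg : ∀ d e, g ((δ d).fst e) = (δ' (f d)).fst (g e))
    (hl : ∀ d e, l ((ψ d).fst e) = (ψ' (k d)).fst (l e)) (x : D ⊗ᵐ F) (z : E ⊗ᵐ G) :
    tensorHom g l ((multHom δ ψ x).fst z) =
      (multHom δ' ψ' (tensorHom f k x)).fst (tensorHom g l z) := by
  have hz : ∀ x, Continuous fun z => tensorHom g l ((multHom δ ψ x).fst z) := fun x =>
    (continuous_starHom _).comp (ContinuousLinearMap.continuous _)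
  refine induction_tmul (p := fun x => ∀ z, tensorHom g l ((multHom δ ψ x).fst z) =
      (multHom δ' ψ' (tensorHom f k x)).fst (tensorHom g l z)) ?_ (fun x y hx hy z => ?_)
      (fun d e z => ?_) x z
  · simp only [Set.ofPred_forall]
    exact isClosed_iInter fun z => isClosed_eq
      ((continuous_starHom _).comp (continuous_hom_fst _ _))
      ((continuous_hom_fst _ _).comp (continuous_starHom _))
  · rw [map_add, map_add, map_add, DoubleCentralizer.add_fst, DoubleCentralizer.add_fst, add_apply,
      add_apply, map_add, hx, hy]
  · refine induction_tmul (p := fun z => tensorHom g l ((multHom δ ψ (tmul d e)).fst z) =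
      (multHom δ' ψ' (tensorHom f k (tmul d e))).fst (tensorHom g l z)) ?_ (fun x y hx hy => ?_)
      (fun d e => ?_) z
    · exact isClosed_eq (hz _)
        ((ContinuousLinearMap.continuous _).comp (continuous_starHom _))
    · simp only [map_add, hx, hy]
    · rw [multHom_tmul, tensorHom_tmul, multHom_tmul, mtmul_fst_tmul, tensorHom_tmul,
        tensorHom_tmul, mtmul_fst_tmul, hg, hl]

theorem tensorHom_id (x : D ⊗ᵐ E) :
    tensorHom (NonUnitalStarAlgHom.id ℂ D) (NonUnitalStarAlgHom.id ℂ E) x = x := by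
  refine induction_tmul (p := fun x =>
    tensorHom (NonUnitalStarAlgHom.id ℂ D) (NonUnitalStarAlgHom.id ℂ E) x = x)
    (isClosed_eq (continuous_starHom _) continuous_id) (fun x y hx hy => ?_) (fun d e => ?_) x
  · rw [map_add, hx, hy]
  · rw [tensorHom_tmul]; rfl

theorem tensorHom_surjective {f : D →⋆ₙₐ[ℂ] E} (hf : Function.Surjective f) :
    Function.Surjective (tensorHom f (NonUnitalStarAlgHom.id ℂ A)) := fun z =>
  induction_tmul (p := fun z => z ∈ Set.range (tensorHom f (NonUnitalStarAlgHom.id ℂ A)))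
    (isClosed_range_starHom _)
    (fun x y ⟨x', hx⟩ ⟨y', hy⟩ => ⟨x' + y', by rw [map_add, hx, hy]⟩)
    (fun d a => by
      obtain ⟨d', rfl⟩ := hf d
      exact ⟨tmul d' a, tensorHom_tmul _ _ _ _⟩) z

theorem tensorHom_assocHom (f : D →⋆ₙₐ[ℂ] D') (x : D ⊗ᵐ (E ⊗ᵐ F)) :
    tensorHom (tensorHom f (NonUnitalStarAlgHom.id ℂ E)) (NonUnitalStarAlgHom.id ℂ F)
      (assocHom D E F x) = assocHom D' E F (tensorHom f (NonUnitalStarAlgHom.id ℂ _) x) := by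
  refine induction_tmul₃ (p := fun x =>
    tensorHom (tensorHom f (NonUnitalStarAlgHom.id ℂ E)) (NonUnitalStarAlgHom.id ℂ F)
      (assocHom D E F x) = assocHom D' E F (tensorHom f (NonUnitalStarAlgHom.id ℂ _) x)) ?_
    (fun x y hx hy => ?_) (fun d e g => ?_) x
  · exact isClosed_eq ((continuous_starHom _).comp (continuous_starHom _))
      ((continuous_starHom _).comp (continuous_starHom _))
  · rw [map_add, map_add, hx, hy, map_add, map_add]
  · rw [assocHom_tmul, tensorHom_tmul, tensorHom_tmul, tensorHom_tmul]
    exact (assocHom_tmul _ _ _).symm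

end ConcreteHoms

section Extensions

variable {D D' E E' A : Type u} [NonUnitalCStarAlgebra D] [NonUnitalCStarAlgebra D']
  [NonUnitalCStarAlgebra E] [NonUnitalCStarAlgebra E'] [NonUnitalCStarAlgebra A]

theorem idTensor_fst {Δ : A →⋆ₙₐ[ℂ] 𝓜(ℂ, A ⊗ᵐ A)} (hΔ : IsNondegenerate Δ) (m : 𝓜(ℂ, D ⊗ᵐ A))
    (x : D ⊗ᵐ A) (w : D ⊗ᵐ (A ⊗ᵐ A)) :
    (idTensor D Δ m).fst (assocHom D A A ((multHom (incl D) Δ x).fst w)) =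
      assocHom D A A ((multHom (incl D) Δ (m.fst x)).fst w) := by
  have h := strictExt_incl_comp_fst (f := assocHom D A A) denseRange_assocHom
    (strictExt (multHom (incl D) Δ) m) ((multHom (incl D) Δ x).fst w)
  rw [← mult_mul_fst, (isStrictHom_multHom_incl hΔ).strictExt_mul] at h
  exact h

theorem ext_idTensor {Δ : A →⋆ₙₐ[ℂ] 𝓜(ℂ, A ⊗ᵐ A)} (hΔ : IsNondegenerate Δ) {N : Type*}
    [NormedAddCommGroup N] [NormedSpace ℂ N] {S T : (D ⊗ᵐ A) ⊗ᵐ A →L[ℂ] N}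
    (hST : ∀ x w, S (assocHom D A A ((multHom (incl D) Δ x).fst w)) =
      T (assocHom D A A ((multHom (incl D) Δ x).fst w))) : S = T := by
  have h : S.comp (assoc D A A) = T.comp (assoc D A A) :=
    (isNondegenerate_multHom_incl hΔ).ext hST
  refine ContinuousLinearMap.ext fun x => ?_
  refine congrFun (denseRange_assocHom.equalizer S.continuous T.continuous ?_) x
  funext v
  exact DFunLike.congr_fun h v

theorem idTensor_zero {Δ : A →⋆ₙₐ[ℂ] 𝓜(ℂ, A ⊗ᵐ A)} (hΔ : IsNondegenerate Δ) :
    idTensor D Δ 0 = 0 := by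
  refine mult_ext_fst fun z => ?_
  refine DFunLike.congr_fun (ext_idTensor hΔ (S := (idTensor D Δ 0).fst) (T := 0) fun x w => ?_) z
  rw [idTensor_fst hΔ]
  change assocHom D A A ((multHom (incl D) Δ 0).fst w) = 0
  rw [map_zero]
  exact map_zero _

/-- Naturality of `id ⊗ Δ` with respect to the left leg. -/
theorem idTensor_natural {Δ : A →⋆ₙₐ[ℂ] 𝓜(ℂ, A ⊗ᵐ A)} (hΔ : IsNondegenerate Δ)
    (f : D →⋆ₙₐ[ℂ] D') {m : 𝓜(ℂ, D ⊗ᵐ A)} {m' : 𝓜(ℂ, D' ⊗ᵐ A)}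
    (h : ∀ x, tensorHom f (NonUnitalStarAlgHom.id ℂ A) (m.fst x) =
      m'.fst (tensorHom f (NonUnitalStarAlgHom.id ℂ A) x)) (z : (D ⊗ᵐ A) ⊗ᵐ A) :
    tensorHom (tensorHom f (NonUnitalStarAlgHom.id ℂ A)) (NonUnitalStarAlgHom.id ℂ A)
        ((idTensor D Δ m).fst z) = (idTensor D' Δ m').fst
      (tensorHom (tensorHom f (NonUnitalStarAlgHom.id ℂ A)) (NonUnitalStarAlgHom.id ℂ A) z) := by
  have key : ∀ x w, tensorHom (tensorHom f (NonUnitalStarAlgHom.id ℂ A))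
      (NonUnitalStarAlgHom.id ℂ A) (assocHom D A A ((multHom (incl D) Δ x).fst w)) =
      assocHom D' A A ((multHom (incl D') Δ (tensorHom f (NonUnitalStarAlgHom.id ℂ A) x)).fst
        (tensorHom f (NonUnitalStarAlgHom.id ℂ _) w)) := fun x w => by
    rw [tensorHom_assocHom]
    refine congrArg _ (tensorHom_multHom_fst (fun d e => ?_) (fun d e => rfl) x w)
    rw [incl_fst, incl_fst, map_mul]
  let F : (D ⊗ᵐ A) ⊗ᵐ A →L[ℂ] (D' ⊗ᵐ A) ⊗ᵐ A :=
    tensorMap (tensorHom f (NonUnitalStarAlgHom.id ℂ A)) (NonUnitalStarAlgHom.id ℂ A)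
  refine DFunLike.congr_fun (ext_idTensor hΔ (S := F.comp (idTensor D Δ m).fst)
    (T := (idTensor D' Δ m').fst.comp F) fun x w => ?_) z
  change tensorHom (tensorHom f (NonUnitalStarAlgHom.id ℂ A)) (NonUnitalStarAlgHom.id ℂ A)
    ((idTensor D Δ m).fst _) = (idTensor D' Δ m').fst (tensorHom (tensorHom f
      (NonUnitalStarAlgHom.id ℂ A)) (NonUnitalStarAlgHom.id ℂ A) _)
  rw [idTensor_fst hΔ, key, key, idTensor_fst hΔ, h]

theorem multHom_mul_mtmul_one (δ : D →⋆ₙₐ[ℂ] 𝓜(ℂ, E)) (x : D ⊗ᵐ A) (a : A) :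
    multHom δ (incl A) x * mtmul 1 (incl A a) =
      multHom δ (incl A) ((mtmul 1 (incl A a)).snd x) := by
  refine induction_tmul (p := fun x => multHom δ (incl A) x * mtmul 1 (incl A a) =
      multHom δ (incl A) ((mtmul 1 (incl A a)).snd x))
    (isClosed_eq ((continuous_starHom _).mul_const _)
      ((continuous_starHom _).comp (ContinuousLinearMap.continuous _)))
    (fun x y h h' => ?_) (fun d b => ?_) x
  · rw [map_add, add_mul, h, h', map_add, map_add]
  · rw [mtmul_snd_tmul, multHom_tmul, multHom_tmul, ← mtmul_mul, mul_one, incl_snd, map_mul]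
    rfl

/-- If `m (1 ⊗ a) = w`, then `(δ ⊗ id)(m) (1 ⊗ a) = (δ ⊗ id)(w)`. -/
theorem tensorId_mul_eq {δ : D →⋆ₙₐ[ℂ] 𝓜(ℂ, E)} (h : IsStrictHom δ) {m : 𝓜(ℂ, D ⊗ᵐ A)}
    {w : D ⊗ᵐ A} {a : A} (hw : m * mtmul 1 (incl A a) = incl _ w) :
    tensorId δ m * mtmul 1 (incl A a) = multHom δ (incl A) w := mult_ext_fst fun z => by
  set Φ := multHom δ (incl A)
  have hΦ : IsStrictHom Φ := isStrictHom_multHom h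
  obtain ⟨⟨h1, -⟩, h2⟩ := tendsto_strictBall.mp (tendsto_id (x := strictBall m))
  have h3 := hΦ.tendsto_strictExt h2 h1 ((mtmul 1 (incl A a)).fst z)
  have h4 : Tendsto (fun x => (Φ ((mtmul 1 (incl A a)).snd x - w)).fst z) (strictBall m) (𝓝 0) := by
    refine (hΦ z).tendsto_zero (C := ‖(mtmul (1 : 𝓜(ℂ, D)) (incl A a)).snd‖ * ‖m‖ + ‖w‖) ?_
      fun d => ?_
    · filter_upwards [h2] with x hx
      exact (norm_sub_le _ _).trans (add_le_add_left ((ContinuousLinearMap.le_opNorm _ _).trans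
        (mul_le_mul_of_nonneg_left hx (norm_nonneg _))) _)
    · have h5 := (h1 ((mtmul 1 (incl A a)).fst d)).sub_const (w * d)
      have h6 : m.fst ((mtmul 1 (incl A a)).fst d) - w * d = 0 := by
        rw [← mult_mul_fst, hw, incl_fst, sub_self]
      rw [h6] at h5
      refine h5.congr fun x => ?_
      rw [sub_mul, DoubleCentralizer.central]
      rfl
  have h5 := h4.add_const ((Φ w).fst z)
  rw [zero_add] at h5
  refine tendsto_nhds_unique h3 (h5.congr fun x => ?_)
  rw [hom_sub_fst, sub_add_cancel, ← multHom_mul_mtmul_one, mult_mul_fst]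
  rfl

/-- Naturality of `δ ⊗ id` with respect to `δ`. -/
theorem tensorId_natural {δ : D →⋆ₙₐ[ℂ] 𝓜(ℂ, E)} (hδ : IsStrictHom δ)
    {δ' : D' →⋆ₙₐ[ℂ] 𝓜(ℂ, E')} (hδ' : IsStrictHom δ') {f : D →⋆ₙₐ[ℂ] D'} {g : E →⋆ₙₐ[ℂ] E'}
    (hf : Function.Surjective f) (hg : ∀ d e, g ((δ d).fst e) = (δ' (f d)).fst (g e))
    {m : 𝓜(ℂ, D ⊗ᵐ A)} {m' : 𝓜(ℂ, D' ⊗ᵐ A)}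
    (h : ∀ x, tensorHom f (NonUnitalStarAlgHom.id ℂ A) (m.fst x) =
      m'.fst (tensorHom f (NonUnitalStarAlgHom.id ℂ A) x)) (z : E ⊗ᵐ A) :
    tensorHom g (NonUnitalStarAlgHom.id ℂ A) ((tensorId δ m).fst z) =
      (tensorId δ' m').fst (tensorHom g (NonUnitalStarAlgHom.id ℂ A) z) := by
  obtain ⟨⟨h1, -⟩, h2⟩ := tendsto_strictBall.mp (tendsto_id (x := strictBall m))
  have h3 := (isStrictHom_multHom (A := A) hδ).tendsto_strictExt h2 h1 z
  have h4 := ((continuous_starHom (tensorHom g (NonUnitalStarAlgHom.id ℂ A))).tendsto _).comp h3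
  have h5 := (isStrictHom_multHom (A := A) hδ').tendsto_strictExt (m := m') (G := strictBall m)
    (u := fun x => tensorHom f (NonUnitalStarAlgHom.id ℂ A) x) (C := ‖m‖) ?_ ?_
    (tensorHom g (NonUnitalStarAlgHom.id ℂ A) z)
  · refine tendsto_nhds_unique h4 (h5.congr fun x => ?_)
    exact (tensorHom_multHom_fst hg (fun d e => by simp [incl_fst]) x z).symm
  · filter_upwards [h2] with x hx
    exact (NonUnitalStarAlgHom.norm_apply_le _ x).trans hx
  · intro d'
    obtain ⟨d, rfl⟩ := tensorHom_surjective hf d'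
    have h6 := ((continuous_starHom (tensorHom f (NonUnitalStarAlgHom.id ℂ A))).tendsto _).comp
      (h1 d)
    rw [h] at h6
    exact h6.congr fun x => map_mul _ _ _

theorem IsContractiveUnit.map_starHom {l : Filter D} (hl : IsContractiveUnit l) {f : D →⋆ₙₐ[ℂ] D'}
    (hf : Function.Surjective f) : IsContractiveUnit (map f l) := by
  have := hl.neBot
  refine ⟨inferInstance, ?_, fun x => tendsto_map'_iff.mpr ?_, fun x => tendsto_map'_iff.mpr ?_⟩
  · rw [eventually_map]
    filter_upwards [hl.norm_le] with x hx
    exact (NonUnitalStarAlgHom.norm_apply_le f x).trans hx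
  · obtain ⟨x, rfl⟩ := hf x
    exact (((continuous_starHom f).tendsto x).comp (hl.right x)).congr fun y => map_mul _ _ _
  · obtain ⟨x, rfl⟩ := hf x
    exact (((continuous_starHom f).tendsto x).comp (hl.left x)).congr fun y => map_mul _ _ _

theorem IsStrictHom.of_surjective {δ : D →⋆ₙₐ[ℂ] 𝓜(ℂ, E)} (hδ : IsStrictHom δ)
    {δ' : D' →⋆ₙₐ[ℂ] 𝓜(ℂ, E')} {f : D →⋆ₙₐ[ℂ] D'} {g : E →⋆ₙₐ[ℂ] E'}
    (hf : Function.Surjective f) (hg : Function.Surjective g)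
    (h : ∀ d e, g ((δ d).fst e) = (δ' (f d)).fst (g e)) : IsStrictHom δ' := fun z => by
  obtain ⟨z, rfl⟩ := hg z
  obtain ⟨y, hy⟩ := (hδ z).exists_tendsto_unit isContractiveUnit_contrUnit
  refine strictAt_of_tendsto (isContractiveUnit_contrUnit.map_starHom hf) (y := g y)
    (tendsto_map'_iff.mpr ?_)
  exact (((continuous_starHom g).tendsto y).comp hy).congr fun x => h x z

end Extensions

section Actions

variable {D D' E E' : Type u} [NonUnitalCStarAlgebra D] [NonUnitalCStarAlgebra D']
  [NonUnitalCStarAlgebra E] [NonUnitalCStarAlgebra E']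

/-- Centralizers are automatically linear and bounded. -/
theorem exists_clm_of_central {L R : E → E} (h : ∀ x y, R x * y = x * L y) :
    ∃ T : E →L[ℂ] E, ∀ x, T x = L x := by
  let L' : E →ₗ[ℂ] E :=
    { toFun := L
      map_add' := fun x y => eq_of_forall_mul_left fun z => by
        rw [mul_add, ← h, ← h, ← h, mul_add]
      map_smul' := fun c x => eq_of_forall_mul_left fun z => by
        rw [RingHom.id_apply, mul_smul_comm, ← h, ← h, mul_smul_comm] }
  refine ⟨ContinuousLinearMap.ofSeqClosedGraph (g := L') fun u x y hu hy => ?_, fun x => rfl⟩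
  refine eq_of_forall_mul_left fun z => tendsto_nhds_unique (hy.const_mul z) ?_
  have h1 := hu.const_mul (R z)
  rw [h] at h1
  exact h1.congr fun n => h z (u n)

/-- A multiplier given by a pair of maps. -/
theorem exists_mult_of_central {L R : E → E} (h : ∀ x y, R x * y = x * L y) :
    ∃ m : 𝓜(ℂ, E), ∀ x, m.fst x = L x := by
  obtain ⟨T, hT⟩ := exists_clm_of_central h
  obtain ⟨S, hS⟩ := exists_clm_of_central (L := fun x => star (R (star x)))
    (R := fun x => star (L (star x))) fun x y => by
      have := congrArg star (h (star y) (star x))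
      rw [star_mul, star_mul, star_star, star_star] at this
      exact this.symm
  let S' : E →L[ℂ] E := LinearMap.mkContinuous
    { toFun := fun x => star (S (star x))
      map_add' := fun x y => by rw [star_add, map_add, star_add]
      map_smul' := fun c x => by rw [star_smul, map_smul, star_smul, star_star]; rfl } ‖S‖
    fun x => by
      change ‖star (S (star x))‖ ≤ _
      rw [norm_star, ← norm_star x]
      exact S.le_opNorm _
  have hS' : ∀ x, S' x = R x := fun x => by
    change star (S (star x)) = _
    rw [hS, star_star, star_star]
  exact ⟨⟨(T, S'), fun x y => by
    change S' x * y = x * T y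
    rw [hS', hT, h]⟩, hT⟩

/-- A `*`-homomorphism to multipliers given by an action. -/
theorem exists_hom_of_action {L : D → E → E}
    (hstar : ∀ d x y, star (L (star d) (star x)) * y = x * L d y)
    (hadd : ∀ d d' z, L (d + d') z = L d z + L d' z)
    (hsmul : ∀ (c : ℂ) d z, L (c • d) z = c • L d z)
    (hmul : ∀ d d' z, L (d * d') z = L d (L d' z)) :
    ∃ Φ : D →⋆ₙₐ[ℂ] 𝓜(ℂ, E), ∀ d z, (Φ d).fst z = L d z := by
  choose Φ hΦ using fun d => exists_mult_of_central (hstar d)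
  have hsnd : ∀ d x, (Φ d).snd x = star (L (star d) (star x)) := fun d x =>
    eq_of_forall_mul_right fun y => by rw [(Φ d).central, hΦ, hstar]
  have hz : ∀ d, L d 0 = 0 := fun d => by rw [← hΦ, map_zero]
  refine ⟨{ toFun := Φ
            map_smul' := fun c d => mult_ext_fst fun z => ?_
            map_zero' := mult_ext_fst fun z => ?_
            map_add' := fun d d' => mult_ext_fst fun z => ?_
            map_mul' := fun d d' => mult_ext_fst fun z => ?_
            map_star' := fun d => mult_ext_fst fun z => ?_ }, hΦ⟩
  · rw [hΦ, hsmul, DoubleCentralizer.smul_fst, smul_apply, hΦ]; rfl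
  · have := hsmul 0 0 z
    rw [zero_smul, zero_smul] at this
    rw [hΦ, this]; rfl
  · rw [hΦ, hadd, DoubleCentralizer.add_fst, add_apply, hΦ, hΦ]
  · rw [hΦ, hmul, mult_mul_fst, hΦ, hΦ]
  · rw [hΦ, DoubleCentralizer.star_fst, hsnd, star_star, star_star]

/-- The restriction of an action by multipliers to an invariant ideal. -/
theorem exists_restrict {Φ : D →⋆ₙₐ[ℂ] 𝓜(ℂ, E')} {j : E →⋆ₙₐ[ℂ] E'} (hj : Function.Injective j)
    (h : ∀ d z, ∃ z', j z' = (Φ d).fst (j z)) :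
    ∃ Ψ : D →⋆ₙₐ[ℂ] 𝓜(ℂ, E), ∀ d z, j ((Ψ d).fst z) = (Φ d).fst (j z) := by
  choose L hL using h
  refine (exists_hom_of_action (L := L) (fun d x y => hj ?_) (fun d d' z => hj ?_)
    (fun c d z => hj ?_) (fun d d' z => hj ?_)).imp fun Ψ hΨ d z => by rw [hΨ, hL]
  · rw [map_mul, map_mul, map_star j, hL, hL, map_star j, ← hom_snd, DoubleCentralizer.central]
  · rw [map_add, hL, hL, hL, map_add]; rfl
  · rw [map_smul, hL, hL, map_smul]; rfl
  · rw [hL, hL, hL, hom_mul_fst]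

theorem map_mult_fst_eq_zero (g : E →⋆ₙₐ[ℂ] E') (m : 𝓜(ℂ, E)) {e : E} (h : g e = 0) :
    g (m.fst e) = 0 := by
  have h1 := ((continuous_starHom g).comp m.fst.continuous).tendsto e |>.comp
    (isContractiveUnit_contrUnit.left e)
  refine tendsto_nhds_unique h1 (tendsto_const_nhds.congr fun u => ?_)
  simp only [Function.comp_apply]
  rw [fst_mul, map_mul, h, mul_zero]

/-- The action by multipliers induced on quotients. -/
theorem exists_push {Φ : D →⋆ₙₐ[ℂ] 𝓜(ℂ, E)} {f : D →⋆ₙₐ[ℂ] D'} {g : E →⋆ₙₐ[ℂ] E'}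
    (hf : Function.Surjective f) (hg : Function.Surjective g)
    (h : ∀ d, f d = 0 → ∀ e, g ((Φ d).fst e) = 0) :
    ∃ Ψ : D' →⋆ₙₐ[ℂ] 𝓜(ℂ, E'), ∀ d e, g ((Φ d).fst e) = (Ψ (f d)).fst (g e) := by
  obtain ⟨L, hL⟩ : ∃ L : D' → E' → E', ∀ d e, g ((Φ d).fst e) = L (f d) (g e) := by
    refine ⟨fun d' e' => g ((Φ (Function.surjInv hf d')).fst (Function.surjInv hg e')),
      fun d e => ?_⟩
    have h1 := h (d - Function.surjInv hf (f d))
      (by rw [map_sub, Function.surjInv_eq hf, sub_self]) e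
    have h2 := map_mult_fst_eq_zero g (Φ (Function.surjInv hf (f d)))
      (e := e - Function.surjInv hg (g e)) (by rw [map_sub, Function.surjInv_eq hg, sub_self])
    rw [hom_sub_fst, map_sub, sub_eq_zero] at h1
    rw [map_sub, map_sub, sub_eq_zero] at h2
    rw [h1, h2]
  refine (exists_hom_of_action (L := L) (fun d x y => ?_) (fun d d' z => ?_)
    (fun c d z => ?_) (fun d d' z => ?_)).imp fun Ψ hΨ d e => by rw [hΨ, hL]
  · obtain ⟨d, rfl⟩ := hf d
    obtain ⟨x, rfl⟩ := hg x
    obtain ⟨y, rfl⟩ := hg y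
    rw [← map_star, ← map_star, ← hL, ← hL, ← map_star, ← hom_snd, ← map_mul, ← map_mul,
      DoubleCentralizer.central]
  · obtain ⟨d, rfl⟩ := hf d
    obtain ⟨d', rfl⟩ := hf d'
    obtain ⟨z, rfl⟩ := hg z
    rw [← map_add f, ← hL, ← hL, ← hL, map_add Φ]; exact map_add g _ _
  · obtain ⟨d, rfl⟩ := hf d
    obtain ⟨z, rfl⟩ := hg z
    rw [← map_smul f, ← hL, ← hL, map_smul Φ]; exact map_smul g _ _
  · obtain ⟨d, rfl⟩ := hf d
    obtain ⟨d', rfl⟩ := hf d'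
    obtain ⟨z, rfl⟩ := hg z
    rw [← map_mul, ← hL, ← hL, ← hL, hom_mul_fst]

end Actions

/-- The amplification `f ⊗ id`. -/
local notation "amp(" f ")" => tensorHom f (NonUnitalStarAlgHom.id ℂ _)

section Amplification

variable {D E F A : Type u} [NonUnitalCStarAlgebra D] [NonUnitalCStarAlgebra E]
  [NonUnitalCStarAlgebra F] [NonUnitalCStarAlgebra A]

theorem tensorHom_comp (f : D →⋆ₙₐ[ℂ] E) (g : E →⋆ₙₐ[ℂ] F) (x : D ⊗ᵐ A) :
    amp(g) (amp(f) x) = amp(g.comp f) x := by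
  refine induction_tmul (p := fun x => amp(g) (amp(f) x) = amp(g.comp f) x)
    (isClosed_eq ((continuous_starHom _).comp (continuous_starHom _)) (continuous_starHom _))
    (fun x y hx hy => ?_) (fun d a => ?_) x
  · rw [map_add, map_add, hx, hy, map_add]
  · rw [tensorHom_tmul, tensorHom_tmul, tensorHom_tmul]; rfl

theorem tensorHom_mtmul_one_fst (f : D →⋆ₙₐ[ℂ] E) (a : A) (x : D ⊗ᵐ A) :
    amp(f) ((mtmul 1 (incl A a)).fst x) = (mtmul 1 (incl A a)).fst (amp(f) x) := by
  refine induction_tmul (p := fun x => amp(f) ((mtmul 1 (incl A a)).fst x) =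
      (mtmul 1 (incl A a)).fst (amp(f) x))
    (isClosed_eq ((continuous_starHom _).comp (ContinuousLinearMap.continuous _))
      ((ContinuousLinearMap.continuous _).comp (continuous_starHom _)))
    (fun x y hx hy => ?_) (fun d a => ?_) x
  · simp only [map_add, hx, hy]
  · rw [mtmul_fst_tmul, tensorHom_tmul, tensorHom_tmul, mtmul_fst_tmul]; rfl

theorem tensorHom_mtmul_one_snd (f : D →⋆ₙₐ[ℂ] E) (a : A) (x : D ⊗ᵐ A) :
    amp(f) ((mtmul 1 (incl A a)).snd x) = (mtmul 1 (incl A a)).snd (amp(f) x) := by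
  refine induction_tmul (p := fun x => amp(f) ((mtmul 1 (incl A a)).snd x) =
      (mtmul 1 (incl A a)).snd (amp(f) x))
    (isClosed_eq ((continuous_starHom _).comp (ContinuousLinearMap.continuous _))
      ((ContinuousLinearMap.continuous _).comp (continuous_starHom _)))
    (fun x y hx hy => ?_) (fun d a => ?_) x
  · simp only [map_add, hx, hy]
  · rw [mtmul_snd_tmul, tensorHom_tmul, tensorHom_tmul, mtmul_snd_tmul]; rfl

theorem slice_mtmul_fst (υ : A →L[ℂ] ℂ) (d : D) (x : D ⊗ᵐ A) :
    slice D υ ((mtmul (incl D d) 1).fst x) = d * slice D υ x := by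
  refine induction_tmul (p := fun x => slice D υ ((mtmul (incl D d) 1).fst x) = d * slice D υ x)
    (isClosed_eq (by fun_prop) ((ContinuousLinearMap.continuous _).const_mul d))
    (fun x y hx hy => ?_) (fun d a => ?_) x
  · simp only [map_add, hx, hy, mul_add]
  · rw [mtmul_fst_tmul, slice_tmul, slice_tmul, incl_fst, mul_smul_comm]; rfl

theorem tendsto_tmul_mul (d : D) (x : D ⊗ᵐ A) :
    Tendsto (fun a => tmul d a * x) (contrUnit A) (𝓝 ((mtmul (incl D d) 1).fst x)) := by
  have hcl : IsClosed {x : D ⊗ᵐ A | Tendsto (fun a => ContinuousLinearMap.mul ℂ _ (tmul d a) x)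
      (contrUnit A) (𝓝 ((mtmul (incl D d) 1).fst x))} := by
    refine isClosed_setOf_tendsto (C := ‖d‖) ?_
    filter_upwards [isContractiveUnit_contrUnit.norm_le] with a ha
    refine (ContinuousLinearMap.opNorm_mul_apply_le ℂ _ _).trans ((norm_tmul_le _ _).trans ?_)
    exact mul_le_of_le_one_right (norm_nonneg _) ha
  refine induction_tmul (p := fun x => Tendsto (fun a => tmul d a * x)
    (contrUnit A) (𝓝 ((mtmul (incl D d) 1).fst x))) hcl (fun x y hx hy => ?_) (fun e b => ?_) x
  · simp only [map_add, mul_add]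
    exact hx.add hy
  · rw [mtmul_fst_tmul, incl_fst]
    simp only [tmul_mul_tmul]
    exact tendsto_tmul tendsto_const_nhds (isContractiveUnit_contrUnit.left b)

theorem closure_adjoin_le {s : Set D} {S : NonUnitalStarSubalgebra ℂ D}
    (hS : IsClosed (S : Set D)) (h : s ⊆ S) :
    (NonUnitalStarAlgebra.adjoin ℂ s).topologicalClosure ≤ S :=
  NonUnitalStarSubalgebra.topologicalClosure_minimal _ (NonUnitalStarAlgebra.adjoin_le h) hS

theorem eq_slice {f : D →⋆ₙₐ[ℂ] 𝓜(ℂ, F)} {y : D ⊗ᵐ A} {T : 𝓜(ℂ, F ⊗ᵐ A)} {a : A}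
    (h : multHom f (incl A) y = T * mtmul 1 (incl A a)) {υ : A →L[ℂ] ℂ} {m : 𝓜(ℂ, F)}
    (hm : ∀ d, m.fst d = slice F υ (T.fst (tmul d a))) : m = f (slice D υ y) :=
  mult_ext_fst fun d => by rw [hm, slice_fst_tmul h]

theorem eq_slice_of_incl {T : 𝓜(ℂ, D ⊗ᵐ A)} {a : A} {w : D ⊗ᵐ A}
    (h : T * mtmul 1 (incl A a) = incl _ w) {υ : A →L[ℂ] ℂ} {b : D}
    (hb : ∀ d, (incl D b).fst d = slice D υ (T.fst (tmul d a))) : b = slice D υ w :=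
  incl_injective (eq_slice (f := incl D) (y := w) (by rw [multHom_incl_incl, h]) hb)

theorem mult_preserves_range {j : E →⋆ₙₐ[ℂ] D} (hj : ∀ w z, ∃ z', j z' = w * j z) (m : 𝓜(ℂ, D))
    (z : E) : ∃ z', j z' = m.fst (j z) := by
  have h1 := (m.fst.continuous.tendsto (j z)).comp (isContractiveUnit_contrUnit.left (j z))
  refine (isClosed_range_starHom j).mem_of_tendsto h1 (Eventually.of_forall fun u => ?_)
  rw [Function.comp_apply, fst_mul]
  exact hj _ z

end Amplification

section Ideal

variable {A B C : Type u} [NonUnitalCStarAlgebra A] [NonUnitalCStarAlgebra B]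
  [NonUnitalCStarAlgebra C]

theorem tensorHom_ideal {ι : C →⋆ₙₐ[ℂ] B} (h : ∀ b c, ∃ c', ι c' = b * ι c) (w : B ⊗ᵐ A)
    (z : C ⊗ᵐ A) : ∃ z', amp(ι) z' = w * amp(ι) z := by
  have hcl : IsClosed (Set.range (tensorHom ι (NonUnitalStarAlgHom.id ℂ A))) :=
    isClosed_range_starHom _
  refine induction_tmul (p := fun w => w * amp(ι) z ∈ Set.range amp(ι))
    (hcl.preimage (continuous_mul_const _)) (fun x y hx hy => ?_) (fun b a => ?_) w
  · obtain ⟨x', hx⟩ := hx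
    obtain ⟨y', hy⟩ := hy
    exact ⟨x' + y', by rw [map_add, hx, hy, add_mul]⟩
  · refine induction_tmul (p := fun z => tmul b a * amp(ι) z ∈ Set.range amp(ι))
      (hcl.preimage ((continuous_starHom _).const_mul _)) (fun x y hx hy => ?_) (fun c a' => ?_) z
    · obtain ⟨x', hx⟩ := hx
      obtain ⟨y', hy⟩ := hy
      exact ⟨x' + y', by rw [map_add, hx, hy, map_add, mul_add]⟩
    · obtain ⟨c', hc'⟩ := h b c
      exact ⟨tmul c' (a * a'), by rw [tensorHom_tmul, tensorHom_tmul, tmul_mul_tmul, hc']; rfl⟩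

/-- The largest `*`-subalgebra in which the image of `ι` is an ideal. -/
def idealizer (ι : C →⋆ₙₐ[ℂ] B) : NonUnitalStarSubalgebra ℂ B where
  carrier := {b | ∀ c, b * ι c ∈ Set.range ι ∧ ι c * b ∈ Set.range ι}
  zero_mem' c := ⟨⟨0, by simp⟩, ⟨0, by simp⟩⟩
  add_mem' {x y} hx hy c := by
    obtain ⟨⟨p, hp⟩, ⟨q, hq⟩⟩ := hx c
    obtain ⟨⟨p', hp'⟩, ⟨q', hq'⟩⟩ := hy c
    exact ⟨⟨p + p', by rw [map_add, hp, hp', add_mul]⟩, ⟨q + q', by rw [map_add, hq, hq', mul_add]⟩⟩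
  mul_mem' {x y} hx hy c := by
    obtain ⟨p, hp⟩ := (hy c).1
    obtain ⟨q, hq⟩ := (hx c).2
    rw [mul_assoc, ← hp, ← mul_assoc, ← hq]
    exact ⟨(hx p).1, (hy q).2⟩
  smul_mem' k x hx c := by
    obtain ⟨⟨p, hp⟩, ⟨q, hq⟩⟩ := hx c
    exact ⟨⟨k • p, by rw [map_smul, hp, smul_mul_assoc]⟩,
      ⟨k • q, by rw [map_smul, hq, mul_smul_comm]⟩⟩
  star_mem' {x} hx c := by
    obtain ⟨⟨p, hp⟩, ⟨q, hq⟩⟩ := hx (star c)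
    exact ⟨⟨star q, by rw [map_star, hq, star_mul, map_star, star_star]⟩,
      ⟨star p, by rw [map_star, hp, star_mul, map_star, star_star]⟩⟩

theorem isClosed_idealizer (ι : C →⋆ₙₐ[ℂ] B) : IsClosed (idealizer ι : Set B) := by
  have hcl := isClosed_range_starHom ι
  change IsClosed {b | ∀ c, b * ι c ∈ Set.range ι ∧ ι c * b ∈ Set.range ι}
  simp only [Set.ofPred_forall]
  exact isClosed_iInter fun c => (hcl.preimage (continuous_mul_const _)).inter
    (hcl.preimage (continuous_const_mul _))

variable {δC : C →⋆ₙₐ[ℂ] 𝓜(ℂ, C ⊗ᵐ A)} {δB : B →⋆ₙₐ[ℂ] 𝓜(ℂ, B ⊗ᵐ A)} {ι : C →⋆ₙₐ[ℂ] B}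

theorem weak_morphism_fst (hweak : ∀ c c' a, (δB (ι c)).fst (tmul (ι c') a) =
      amp(ι) ((δC c).fst (tmul c' a))) (c : C) (z : C ⊗ᵐ A) :
    (δB (ι c)).fst (amp(ι) z) = amp(ι) ((δC c).fst z) := by
  refine induction_tmul (p := fun z => (δB (ι c)).fst (amp(ι) z) = amp(ι) ((δC c).fst z))
    (isClosed_eq ((ContinuousLinearMap.continuous _).comp (continuous_starHom _))
      ((continuous_starHom _).comp (ContinuousLinearMap.continuous _)))
    (fun x y hx hy => ?_) (fun c' a => ?_) z
  · simp only [map_add, hx, hy]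
  · rw [tensorHom_tmul]; exact hweak c c' a

theorem restrict_snd {D E E' : Type u} [NonUnitalCStarAlgebra D] [NonUnitalCStarAlgebra E]
    [NonUnitalCStarAlgebra E'] {Φ : D →⋆ₙₐ[ℂ] 𝓜(ℂ, E')} {Ψ : D →⋆ₙₐ[ℂ] 𝓜(ℂ, E)} {j : E →⋆ₙₐ[ℂ] E'}
    (h : ∀ d z, j ((Ψ d).fst z) = (Φ d).fst (j z)) (d : D) (z : E) :
    j ((Ψ d).snd z) = (Φ d).snd (j z) := by
  rw [hom_snd, hom_snd, map_star j, h, map_star j]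

/-- In a minimal dilation, the image of `C` is an ideal. -/
theorem range_isIdeal (hmul : ∀ b a, ∃ w : B ⊗ᵐ A, δB b * mtmul 1 (incl A a) = incl _ w)
    (hweak : ∀ c c' a, (δB (ι c)).fst (tmul (ι c') a) = amp(ι) ((δC c).fst (tmul c' a)))
    (hmin : (NonUnitalStarAlgebra.adjoin ℂ
      ({b : B | ∃ (ω : A →L[ℂ] ℂ) (c : C), IsSlice ω (δB (ι c)) (incl B b)} ∪
        Set.range ι)).topologicalClosure = ⊤) (b : B) (c : C) :
    b * ι c ∈ Set.range ι ∧ ι c * b ∈ Set.range ι := by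
  have hle := closure_adjoin_le (s := {b : B | ∃ (ω : A →L[ℂ] ℂ) (c : C),
    IsSlice ω (δB (ι c)) (incl B b)} ∪ Set.range ι) (isClosed_idealizer ι) ?_
  · rw [hmin] at hle
    exact hle (NonUnitalStarAlgebra.mem_top) c
  rintro b (⟨ω, c, a, υ, -, hb⟩ | ⟨c, rfl⟩) c'
  · refine ⟨⟨slice C υ ((δC c).fst (tmul c' a)), ?_⟩, ?_⟩
    · rw [map_slice, ← weak_morphism_fst hweak, tensorHom_tmul, ← incl_fst, hb]; rfl
    · obtain ⟨w, hw⟩ := hmul (ι c) a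
      rw [eq_slice_of_incl hw hb, ← slice_mtmul_fst]
      refine (isClosed_range_starHom ι).mem_of_tendsto
        (((slice B υ).continuous.tendsto _).comp (tendsto_tmul_mul (ι c') w))
        (Eventually.of_forall fun a' => ?_)
      have h1 : tmul (ι c') a' * w =
          amp(ι) ((mtmul 1 (incl A a)).snd ((δC c).snd (tmul c' a'))) := by
        rw [tensorHom_mtmul_one_snd, restrict_snd (Φ := δB.comp ι) (fun d z =>
          (weak_morphism_fst hweak d z).symm), tensorHom_tmul, ← incl_snd, ← hw, mult_mul_snd]
        rfl
      refine ⟨slice C υ ((mtmul 1 (incl A a)).snd ((δC c).snd (tmul c' a'))), ?_⟩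
      rw [Function.comp_apply, h1, map_slice]
  · exact ⟨⟨c * c', map_mul _ _ _⟩, ⟨c' * c, map_mul _ _ _⟩⟩

end Ideal

section Restriction

variable {A B C G : Type u} [NonUnitalCStarAlgebra A] [NonUnitalCStarAlgebra B]
  [NonUnitalCStarAlgebra C] [NonUnitalCStarAlgebra G]
  {Δ : A →⋆ₙₐ[ℂ] 𝓜(ℂ, A ⊗ᵐ A)} {δB : B →⋆ₙₐ[ℂ] 𝓜(ℂ, B ⊗ᵐ A)} {ι : C →⋆ₙₐ[ℂ] B}
  {φ₀ : B →⋆ₙₐ[ℂ] 𝓜(ℂ, C ⊗ᵐ A)}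

theorem tensorHom_multHom_restrict (hφ : ∀ b z, amp(ι) ((φ₀ b).fst z) = (δB b).fst (amp(ι) z))
    (y : B ⊗ᵐ A) (z : (C ⊗ᵐ A) ⊗ᵐ A) :
    amp(amp(ι)) ((multHom φ₀ (incl A) y).fst z) = (multHom δB (incl A) y).fst (amp(amp(ι)) z) := by
  have h := tensorHom_multHom_fst (δ := φ₀) (δ' := δB) (ψ := incl A) (ψ' := incl A)
    (f := NonUnitalStarAlgHom.id ℂ B) (g := amp(ι)) (k := NonUnitalStarAlgHom.id ℂ A)
    (l := NonUnitalStarAlgHom.id ℂ A) hφ (fun d e => by simp [incl_fst]) y z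
  rwa [tensorHom_id] at h

theorem tensorHom_twice_injective (hι : Function.Injective ι) :
    Function.Injective (tensorHom (tensorHom ι (NonUnitalStarAlgHom.id ℂ A))
      (NonUnitalStarAlgHom.id ℂ A)) :=
  tensorHom_injective (tensorHom_injective hι Function.injective_id) Function.injective_id

/-- The restriction `φ₀` of a coaction to an ideal satisfies
`(φ₀ ⊗ id)(δ(b) y) = (id ⊗ Δ)(φ₀(b)) (φ₀ ⊗ id)(y)`. -/
theorem multHom_restrict_fst (hΔ : IsNondegenerate Δ) (hB : IsCoaction Δ δB)
    (hι : Function.Injective ι) (hφ : ∀ b z, amp(ι) ((φ₀ b).fst z) = (δB b).fst (amp(ι) z))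
    (b : B) (y : B ⊗ᵐ A) :
    multHom φ₀ (incl A) ((δB b).fst y) = idTensor C Δ (φ₀ b) * multHom φ₀ (incl A) y :=
  mult_ext_fst fun z => tensorHom_twice_injective hι <| by
    have h := (isStrictHom_multHom (A := A) (isStrictHom_of_isStrict hB.strict)).strictExt_mul
      (δB b) y
    change tensorId δB (δB b) * _ = _ at h
    rw [tensorHom_multHom_restrict hφ, ← h, hB.coassoc, mult_mul_fst, mult_mul_fst,
      idTensor_natural hΔ ι (hφ b), tensorHom_multHom_restrict hφ]

theorem multHom_restrict_eq (hΔ : IsNondegenerate Δ) (hB : IsCoaction Δ δB)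
    (hι : Function.Injective ι) (hφ : ∀ b z, amp(ι) ((φ₀ b).fst z) = (δB b).fst (amp(ι) z))
    {b : B} {a : A} {w : B ⊗ᵐ A} (hw : δB b * mtmul 1 (incl A a) = incl _ w) :
    multHom φ₀ (incl A) w = idTensor C Δ (φ₀ b) * mtmul 1 (incl A a) :=
  mult_ext_fst fun z => tensorHom_twice_injective hι <| by
    rw [tensorHom_multHom_restrict hφ, ← tensorId_mul_eq (isStrictHom_of_isStrict hB.strict) hw,
      hB.coassoc, mult_mul_fst, mult_mul_fst, idTensor_natural hΔ ι (hφ b), tensorHom_mtmul_one_fst]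

variable {φ : B →⋆ₙₐ[ℂ] G} {δG : G →⋆ₙₐ[ℂ] 𝓜(ℂ, G ⊗ᵐ A)}

theorem push_mul_mtmul_one (hφ : Function.Surjective φ)
    (h : ∀ b y, amp(φ) ((δB b).fst y) = (δG (φ b)).fst (amp(φ) y)) {b : B} {a : A} {w : B ⊗ᵐ A}
    (hw : δB b * mtmul 1 (incl A a) = incl _ w) :
    δG (φ b) * mtmul 1 (incl A a) = incl _ (amp(φ) w) := mult_ext_fst fun z => by
  obtain ⟨z, rfl⟩ := tensorHom_surjective hφ z
  rw [mult_mul_fst, ← tensorHom_mtmul_one_fst, ← h, ← mult_mul_fst, hw, incl_fst, incl_fst, map_mul]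

/-- A quotient of a coaction is a coaction. -/
theorem IsCoaction.push (hΔ : IsNondegenerate Δ) (hB : IsCoaction Δ δB)
    (hφ : Function.Surjective φ)
    (h : ∀ b y, amp(φ) ((δB b).fst y) = (δG (φ b)).fst (amp(φ) y)) : IsCoaction Δ δG := by
  have hs := isStrictHom_of_isStrict hB.strict
  have hs' : IsStrictHom δG := hs.of_surjective hφ (tensorHom_surjective hφ) h
  refine ⟨hs'.isStrict, fun g a => ?_, fun g => mult_ext_fst fun z => ?_⟩
  · obtain ⟨b, rfl⟩ := hφ g
    obtain ⟨w, hw⟩ := hB.mul_mem b a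
    exact ⟨_, push_mul_mtmul_one hφ h hw⟩
  · obtain ⟨b, rfl⟩ := hφ g
    obtain ⟨z, rfl⟩ := tensorHom_surjective (tensorHom_surjective hφ) z
    rw [← tensorId_natural hs hs' hφ h (h b), hB.coassoc, idTensor_natural hΔ φ (h b)]

/-- A coaction descends along the corestriction of its restriction to an ideal. -/
theorem exists_push_restrict (hΔ : IsNondegenerate Δ) (hB : IsCoaction Δ δB)
    (hι : Function.Injective ι) {s : G →⋆ₙₐ[ℂ] 𝓜(ℂ, C ⊗ᵐ A)} (hs : Function.Injective s)
    (hφs : Function.Surjective φ)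
    (hφ : ∀ b z, amp(ι) ((s (φ b)).fst z) = (δB b).fst (amp(ι) z)) :
    ∃ δG : G →⋆ₙₐ[ℂ] 𝓜(ℂ, G ⊗ᵐ A),
      (∀ b y, amp(φ) ((δB b).fst y) = (δG (φ b)).fst (amp(φ) y)) ∧
      ∀ x z, multHom s (incl A) ((δG x).fst z) = idTensor C Δ (s x) * multHom s (incl A) z := by
  have key : ∀ b y, multHom s (incl A) (amp(φ) ((δB b).fst y)) =
      idTensor C Δ (s (φ b)) * multHom s (incl A) (amp(φ) y) := fun b y => by
    rw [multHom_comp, multHom_comp]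
    exact multHom_restrict_fst hΔ hB hι (φ₀ := s.comp φ) hφ b y
  obtain ⟨δG, h⟩ := exists_push (Φ := δB) hφs (tensorHom_surjective (A := A) hφs) fun b hb y => by
    apply multHom_injective hs
    rw [key, hb, map_zero, idTensor_zero hΔ, zero_mul, map_zero]
  refine ⟨δG, h, fun x z => ?_⟩
  obtain ⟨b, rfl⟩ := hφs x
  obtain ⟨y, rfl⟩ := tensorHom_surjective hφs z
  rw [← h, key]

end Restriction

section Morphisms

variable {A B C G : Type u} [NonUnitalCStarAlgebra A] [NonUnitalCStarAlgebra B]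
  [NonUnitalCStarAlgebra C] [NonUnitalCStarAlgebra G]
  {Δ : A →⋆ₙₐ[ℂ] 𝓜(ℂ, A ⊗ᵐ A)} {δC : C →⋆ₙₐ[ℂ] 𝓜(ℂ, C ⊗ᵐ A)} {δB : B →⋆ₙₐ[ℂ] 𝓜(ℂ, B ⊗ᵐ A)}
  {ι : C →⋆ₙₐ[ℂ] B}

/-- Morphisms from a minimal dilation are unique. -/
theorem IsDilationMorphism.unique (hB : IsMinimalDilation Δ δC δB ι)
    {δG : G →⋆ₙₐ[ℂ] 𝓜(ℂ, G ⊗ᵐ A)} {ε : C →⋆ₙₐ[ℂ] G} {φ ψ : B →⋆ₙₐ[ℂ] G}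
    (hφ : IsDilationMorphism δB ι δG ε φ) (hψ : IsDilationMorphism δB ι δG ε ψ) : ψ = φ := by
  have hcl : IsClosed (NonUnitalStarAlgHom.equalizer ψ φ : Set B) :=
    isClosed_eq (continuous_starHom ψ) (continuous_starHom φ)
  have hle := closure_adjoin_le (s := {b : B | ∃ (ω : A →L[ℂ] ℂ) (c : C),
    IsSlice ω (δB (ι c)) (incl B b)} ∪ Set.range ι) hcl ?_
  · rw [hB.minimal] at hle
    exact NonUnitalStarAlgHom.ext fun b => hle (NonUnitalStarAlgebra.mem_top)
  rintro b (⟨ω, c, a, υ, -, hb⟩ | ⟨c, rfl⟩)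
  · obtain ⟨w, hw⟩ := hB.coaction.mul_mem (ι c) a
    have h1 := hφ.equivariant (ι c) a w hw.symm
    have h2 := hψ.equivariant (ι c) a w hw.symm
    rw [hφ.map_embedding] at h1
    rw [hψ.map_embedding, h1] at h2
    have h3 : amp(ψ) w = amp(φ) w := (incl_injective h2).symm
    change ψ b = φ b
    rw [eq_slice_of_incl hw hb, map_slice, map_slice, h3]
  · change ψ (ι c) = φ (ι c)
    rw [hφ.map_embedding, hψ.map_embedding]

/-- The image of the restriction of `δB` to `C ⊗ A` is the globalization. -/
theorem range_restrict_eq_globalization (hΔ : IsNondegenerate Δ) (hB : IsMinimalDilation Δ δC δB ι)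
    {φ₀ : B →⋆ₙₐ[ℂ] 𝓜(ℂ, C ⊗ᵐ A)} (hφ : ∀ b z, amp(ι) ((φ₀ b).fst z) = (δB b).fst (amp(ι) z))
    (hφι : ∀ c, φ₀ (ι c) = δC c) :
    (∀ b, φ₀ b ∈ globalization Δ δC) ∧ ∀ x ∈ globalization Δ δC, ∃ b, φ₀ b = x := by
  constructor
  · have hcl : IsClosed ((globalization Δ δC).comap φ₀ : Set B) :=
      (NonUnitalStarSubalgebra.isClosed_topologicalClosure _).preimage (continuous_starHom φ₀)
    have hle := closure_adjoin_le (s := {b : B | ∃ (ω : A →L[ℂ] ℂ) (c : C),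
      IsSlice ω (δB (ι c)) (incl B b)} ∪ Set.range ι) hcl ?_
    · rw [hB.minimal] at hle
      exact fun b => hle (NonUnitalStarAlgebra.mem_top)
    rintro b (⟨ω, c, a, υ, hω, hb⟩ | ⟨c, rfl⟩)
    · obtain ⟨w, hw⟩ := hB.coaction.mul_mem (ι c) a
      refine NonUnitalStarSubalgebra.le_topologicalClosure _
        (NonUnitalStarAlgebra.subset_adjoin ℂ _ (Or.inl ⟨ω, c, a, υ, hω, fun d => ?_⟩))
      rw [← hφι, slice_fst_tmul (multHom_restrict_eq hΔ hB.coaction hB.injective hφ hw),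
        ← eq_slice_of_incl hw hb]
      rfl
    · refine NonUnitalStarSubalgebra.le_topologicalClosure _
        (NonUnitalStarAlgebra.subset_adjoin ℂ _ (Or.inr ⟨c, ?_⟩))
      exact (hφι c).symm
  · have hcl : IsClosed (NonUnitalStarAlgHom.range φ₀ : Set 𝓜(ℂ, C ⊗ᵐ A)) := by
      have := isClosed_range_starHom φ₀
      rwa [← NonUnitalStarAlgHom.coe_range] at this
    refine closure_adjoin_le hcl ?_
    rintro m (⟨ω, c, a, υ, hω, hm⟩ | ⟨c, rfl⟩)
    · obtain ⟨w, hw⟩ := hB.coaction.mul_mem (ι c) a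
      rw [← hφι] at hm
      exact ⟨_, (eq_slice (multHom_restrict_eq hΔ hB.coaction hB.injective hφ hw) hm).symm⟩
    · exact ⟨ι c, hφι c⟩

end Morphisms

end CStarTensor

theorem proposition8p9 {A C B : Type u} [NonUnitalCStarAlgebra A] [NonUnitalCStarAlgebra C]
    [NonUnitalCStarAlgebra B]
    (Δ : A →⋆ₙₐ[ℂ] 𝓜(ℂ, A ⊗ᵐ A)) (hΔ : IsComultiplication Δ)
    (hA : SliceMapProperty A)
    (δC : C →⋆ₙₐ[ℂ] 𝓜(ℂ, C ⊗ᵐ A)) (hδC : IsPartialCoaction Δ δC)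
    (hinj : Function.Injective δC) (hreg : IsRegularCoaction Δ δC)
    (δB : B →⋆ₙₐ[ℂ] 𝓜(ℂ, B ⊗ᵐ A)) (ι : C →⋆ₙₐ[ℂ] B)
    (hB : IsMinimalDilation Δ δC δB ι) :
    -- `ι ⊗ id` identifies `C ⊗ A` with an ideal `ι(C) ⊗ A` of `B ⊗ A`
    Function.Injective (tensorMap ι (NonUnitalStarAlgHom.id ℂ A)) ∧
    (∀ (w : B ⊗ᵐ A) (z : C ⊗ᵐ A),
      (∃ z', tensorMap ι (NonUnitalStarAlgHom.id ℂ A) z' =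
        w * tensorMap ι (NonUnitalStarAlgHom.id ℂ A) z) ∧
      (∃ z', tensorMap ι (NonUnitalStarAlgHom.id ℂ A) z' =
        tensorMap ι (NonUnitalStarAlgHom.id ℂ A) z * w)) ∧
    -- `id ⊗ Δ` restricts to a coaction on the globalization, which thus becomes a dilation
    ∃ δG : globalization Δ δC →⋆ₙₐ[ℂ] 𝓜(ℂ, globalization Δ δC ⊗ᵐ A),
      IsGlobalizationCoaction Δ δC δG ∧
      IsDilation Δ δC δG (globalizationEmbedding Δ δC) ∧
      -- there is a unique morphism, it is surjective and given by restriction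
      ∃ φ : B →⋆ₙₐ[ℂ] globalization Δ δC,
        IsDilationMorphism δB ι δG (globalizationEmbedding Δ δC) φ ∧
        (∀ ψ : B →⋆ₙₐ[ℂ] globalization Δ δC,
          IsDilationMorphism δB ι δG (globalizationEmbedding Δ δC) ψ → ψ = φ) ∧
        Function.Surjective φ ∧
        ∀ (b : B) (z : C ⊗ᵐ A),
          tensorMap ι (NonUnitalStarAlgHom.id ℂ A) ((φ b : 𝓜(ℂ, C ⊗ᵐ A)).fst z) =
            (δB b).fst (tensorMap ι (NonUnitalStarAlgHom.id ℂ A) z) ∧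
          tensorMap ι (NonUnitalStarAlgHom.id ℂ A) ((φ b : 𝓜(ℂ, C ⊗ᵐ A)).snd z) =
            (δB b).snd (tensorMap ι (NonUnitalStarAlgHom.id ℂ A) z) := by
  have hΔ' := hΔ.nondegenerate
  have hweak := hB.weak_morphism
  have hideal := range_isIdeal hB.coaction.mul_mem hweak hB.minimal
  have hJ : Function.Injective (tensorHom ι (NonUnitalStarAlgHom.id ℂ A)) :=
    tensorHom_injective hB.injective Function.injective_id
  have hleft := tensorHom_ideal (A := A) fun b c => (hideal b c).1
  refine ⟨hJ, fun w z => ⟨hleft w z, ?_⟩, ?_⟩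
  · obtain ⟨z', hz'⟩ := hleft (star w) (star z)
    refine ⟨star z', ?_⟩
    change tensorHom ι (NonUnitalStarAlgHom.id ℂ A) (star z') =
      tensorHom ι (NonUnitalStarAlgHom.id ℂ A) z * w
    rw [map_star, hz', map_star, star_mul, star_star, star_star]
  obtain ⟨φ₀, hφ₀⟩ := exists_restrict (Φ := δB) hJ fun b z => mult_preserves_range hleft (δB b) z
  have hφι : ∀ c, φ₀ (ι c) = δC c := fun c => mult_ext_fst fun z => hJ <| by
    rw [hφ₀, weak_morphism_fst hweak]
  obtain ⟨hmem, hsurj⟩ := range_restrict_eq_globalization hΔ' hB hφ₀ hφι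
  let φ : B →⋆ₙₐ[ℂ] globalization Δ δC := NonUnitalStarAlgHom.codRestrict φ₀ _ hmem
  have hφs : Function.Surjective φ := fun x => by
    obtain ⟨b, hb⟩ := hsurj x x.2
    exact ⟨b, Subtype.ext hb⟩
  have hφι' : ∀ c, φ (ι c) = globalizationEmbedding Δ δC c := fun c => Subtype.ext (hφι c)
  obtain ⟨δG, hδG, hglob⟩ := exists_push_restrict hΔ' hB.coaction hB.injective
    (s := NonUnitalStarSubalgebraClass.subtype (globalization Δ δC)) Subtype.val_injective hφs hφ₀
  have hmor : IsDilationMorphism δB ι δG (globalizationEmbedding Δ δC) φ :=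
    ⟨hφι', fun b a w hw => push_mul_mtmul_one hφs hδG hw.symm⟩
  refine ⟨δG, hglob, ⟨hB.coaction.push hΔ' hφs hδG, fun c c' h => hinj (congrArg Subtype.val h),
    fun c c' a => ?_⟩, φ, hmor, fun ψ hψ => hmor.unique hB hψ, hφs, fun b z => ⟨hφ₀ b z, ?_⟩⟩
  · have hcomp : φ.comp ι = globalizationEmbedding Δ δC := NonUnitalStarAlgHom.ext hφι'
    have h := hδG (ι c) (tmul (ι c') a)
    rw [hweak, tensorHom_tmul, hφι', hφι', ← tensorHom_apply, tensorHom_comp, hcomp] at h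
    exact h.symm
  · exact restrict_snd hφ₀ b z
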